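/- **Setting.** Let $d,n\ge 1$, let $S\subset\mathbb Z^d$ have $n$ elements and put $\mathbb Z^d_1=\mathbb Z^d\setminus S$. For $j\in\mathbb Z^d$ let $|j|_2$ be the Euclidean length and $\langle j\rangle=\max(1,|j|_2)$. For $p\in\mathbb R$ let $\ell^2_p$ be the space of complex sequences $q=(q_j)_{j\in\mathbb Z^d_1}$ with $\|q\|_p^2=\sum_j|q_j|^2\langle j\rangle^{2p}<\infty$; for $z=(q,\bar q)\in\ell^2_p\times\ell^2_p$ put $\|z\|_p=\|q\|_p+\|\bar q\|_p$, and use the sup norm on $\mathbb C^n$. On points $w=(x,y,q,\bar q)$, $x,y\in\mathbb C^n$ ($x$ is an angle modulo $2\pi$, lifted to $\mathbb C^n$), put $$D(s,r)=\{\|\mathrm{Im}\,x\|<s,\ \|y\|<r^2,\ \|z\|_p<r\},\qquad \|w\|_{(r)}=\|x\|+\frac{\|y\|}{r^2}+\frac{\|z\|_p}{r},$$ with the symplectic form $\sum dy_i\wedge dx_i+\sqrt{-1}\sum dq_j\wedge d\bar q_j$ and Hamiltonian vector fields $X_W=(W_y,-W_x,\sqrt{-1}\,W_{\bar q},-\sqrt{-1}\,W_q)$.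 A point is real if $x,y\in\mathbb R^n$ and $\bar q$ is the complex conjugate of $q$. A symplectic map is an analytic map preserving the symplectic form, mapping real points to real points and commuting with translations of $x$ by $2\pi\mathbb Z^n$. Parameters are fixed and suppressed. **Tame norm.** For $W=\sum_{k,\alpha,\beta}W^{\alpha\beta}_k e^{\sqrt{-1}\langle k,x\rangle}y^\alpha z^\beta$ put $\|W^\beta\|=\sum_{k,\alpha}|W_k^{\alpha\beta}|e^{|k|_1s}r^{2|\alpha|}$. For $W$ homogeneous of degree $m$ in $z$ let $\lfloor W\rceil$ be the symmetric $m$-linear form with diagonal $\sum_\beta\|W^\beta\|z^\beta$; for vectors of functions this is done componentwise. Put $\|(z^m)\|_{a,b}=\frac1m\sum_{i}\|z^{(i)}\|_a\prod_{l\ne i}\|z^{(l)}\|_b$ ($=1$ if $m=0$). For $W$ homogeneous of degree $h$ in $z$ let $|||W_v|||=\sup\|\lfloor W_v\rceil(z^{(1)},\dots,z^{(h)})\|/\|(z^h)\|_{d,d}$ for $v=x,y$, and let $|||W_z|||^T$ be the larger of $\sup\|\lfloor W_z\rceil(z^{(1)},\dots,z^{(h-1)})\|_{p+2}/\|(z^{h-1})\|_{p,d}$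 and $\sup\|\lfloor W_z\rceil(z^{(1)},\dots,z^{(h-1)})\|_{d}/\|(z^{h-1})\|_{d,d}$ ($0$ if $h=0$), with suprema over nonzero arguments in $\ell^2_d\times\ell^2_d$ or $\ell^2_p\times\ell^2_p$ respectively. Then $$|||X_W|||^T_{D(s,r)}=|||W_y|||r^h+r^{-2}|||W_x|||r^h+r^{-1}|||W_z|||^T r^{h-1},$$ and for general $W$ the tame norm is the sum over its homogeneous parts. **KAM torus.** Let $0<s_0,r_0\le1$, let $H$ be analytic on $D(s_0,r_0)$, and suppose that $H$ has a normal form of order two: there are a symplectic map $\Psi:D(s_0/2,r_0/2)\to D(s_0,r_0)$ and a $\kappa<1/4$ with $\|\Psi(w)-w\|_{(r_0)}\le\kappa$ and $\|(D\Psi(w)-\mathrm{Id})u\|_{(r_0)}\le\kappa\|u\|_{(r_0/2)}$, such that $$H\circ\Psi=\breve N+\breve R,\qquad \breve N=\sum_i\breve\omega_iy_i+\sum_j\breve\Omega_jq_j\bar q_j,$$ with $\breve\omega_i,\breve\Omega_j\in\mathbb R$, $\sup_j|\breve\Omega_j|\langle j\rangle^{-2}<\infty$, and $\breve R$ of finite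 tame norm on $D(s_0/2,r_0/2)$ containing only monomials $y^\alpha q^\beta\bar q^\gamma$ with $2|\alpha|+|\beta|+|\gamma|\ge3$. The KAM torus is $\mathcal T=\Psi(\mathcal T_0)$, $\mathcal T_0=\{x\in\mathbb R^n,\ y=0,\ z=0\}$. The $p$-distance to $\mathcal T$ is measured in the coordinates given by $\Psi$, with the scaling of $D(s,r)$: for $w=\Psi(v)$ with $v\in D(s_0/2,r_0/2)$ real, $$d_p(w,\mathcal T)=\inf_{u\in\mathcal T_0}\left(\|v_x-u_x\|+\|v_y-u_y\|^{1/2}+\|v_z-u_z\|_p\right),$$ and $d_p(w,\mathcal T)=\infty$ if $w$ is not of this form. **Partial normal form of order $\mathcal M+2$.** Let $\mathcal M\ge0$ and $N_0$ be integers, $0<\tilde\eta<1$, $c>0$. Suppose that for all integers $\mathcal N\ge\max(1,N_0)$ and all $\sigma>0$ with $c\,\mathcal N^{6(\mathcal M+7)^2}\sigma\le\tilde\eta^2$ there is a symplectic map $\Phi:D(s_0/4,4\sigma)\to D(s_0/2,5\sigma)$ with $$\|\Phi(w)-w\|_{(5\sigma)}\le\frac{c\,\mathcal N^{294}\sigma}{\tilde\eta^2},\qquad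 \|(D\Phi(w)-\mathrm{Id})u\|_{(5\sigma)}\le\frac{c\,\mathcal N^{294}}{\tilde\eta^2}\|u\|_{(4\sigma)},$$ such that $H\circ\Psi\circ\Phi=\breve N+Z+P+Q$ on $D(s_0/4,4\sigma)$. Here, calling the modes $q_j,\bar q_j$ with $|j|_2>\mathcal N$ high and letting $y$ count twice in the degree: $Z$ has real coefficients, contains only monomials in $y$ and the products $q_j\bar q_j$ of degree between $4$ and $\mathcal M+2$ and is of degree at most $2$ in the high modes; $P$ contains only monomials of degree at least $\mathcal M+3$, and of degree at most $2$ in the high modes; $Q$ contains only monomials of degree at least $3$ in the high modes; and on $D(s_0/4,4\sigma)$ $$|||X_Z|||^T\le c\sigma\,\frac{\mathcal N^{6(\mathcal M+6)^2}\sigma}{\tilde\eta^2},\qquad |||X_P|||^T\le c\sigma\left(\frac{\mathcal N^{6(\mathcal M+7)^2}\sigma}{\tilde\eta^2}\right)^{\mathcal M},\qquad |||X_Q|||^T\le c\sigma .$$ **Theorem 3.3 (long time stability of KAM tori).** Let $p\ge24(\mathcal M+7)^4+1$ and $p\ge12(\mathcal M+7)^4+d$ (the second condition follows from the first if $d\le12(\mathcal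 M+7)^4+1$). Then there is $\rho>0$, depending only on $d,n,p,\mathcal M,N_0,s_0,r_0,\tilde\eta,c$, such that for all $S,H,\Psi$ as above, which have a partial normal form of order $\mathcal M+2$ as above, and all $0<\delta<\rho$: if $w$ is a real solution of $\dot w=X_H(w)$ in $D(s_0,r_0)$ on a time interval containing $0$ (that is, a continuous curve in the phase space whose coordinates satisfy the equations) and $d_p(w(0),\mathcal T)\le\delta$, then $$d_p(w(t),\mathcal T)\le2\delta\qquad\text{for all } t \text{ in that interval with } |t|\le\delta^{-\mathcal M}.$$ -/

import Mathlib

open scoped ENNReal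

noncomputable section

namespace KamTori

/-! ### Sites and weighted sequence spaces -/

/-- The Euclidean length of a lattice point. -/
def latNorm {d : ℕ} (j : Fin d → ℤ) : ℝ := √(∑ i, (j i : ℝ) ^ 2)

/-- The weight of a lattice point: its Euclidean length, with the origin given weight `1`. -/
def wt {d : ℕ} (j : Fin d → ℤ) : ℝ := max 1 (latNorm j)

/-- The normal sites: the lattice points outside the finite set `S` of tangential sites. -/
abbrev Site {d : ℕ} (S : Finset (Fin d → ℤ)) : Type := {j : Fin d → ℤ // j ∉ S}

/-- The sequences `q` with `∑ |q j|² (wt j)^(2p) < ∞`, as a linear subspace of all sequences. -/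
def ellSubmodule {d : ℕ} (S : Finset (Fin d → ℤ)) (p : ℝ) : Submodule ℂ (Site S → ℂ) where
  carrier := {q | Memℓp (fun j => ((wt j.1 ^ p : ℝ) : ℂ) * q j) 2}
  zero_mem' := by
    have h : (fun j : Site S => ((wt j.1 ^ p : ℝ) : ℂ) * (0 : Site S → ℂ) j) = 0 := by
      funext j; simp
    simpa only [Set.mem_ofPred_eq, h] using
      (zero_memℓp : Memℓp (0 : Site S → ℂ) 2)
  add_mem' := by
    intro a b ha hb
    have h : (fun j : Site S => ((wt j.1 ^ p : ℝ) : ℂ) * (a + b) j) =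
        (fun j => ((wt j.1 ^ p : ℝ) : ℂ) * a j) + fun j => ((wt j.1 ^ p : ℝ) : ℂ) * b j := by
      funext j; simp [mul_add]
    simp only [Set.mem_ofPred_eq, h]
    exact Memℓp.add ha hb
  smul_mem' := by
    intro c a ha
    have h : (fun j : Site S => ((wt j.1 ^ p : ℝ) : ℂ) * (c • a) j) =
        c • fun j => ((wt j.1 ^ p : ℝ) : ℂ) * a j := by
      funext j; simp [mul_left_comm]
    simp only [Set.mem_ofPred_eq, h]
    exact Memℓp.const_smul ha c

/-- The weighted space of complex sequences on the normal sites. -/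
def Ell {d : ℕ} (S : Finset (Fin d → ℤ)) (p : ℝ) : Type := ↥(ellSubmodule S p)

instance {d : ℕ} (S : Finset (Fin d → ℤ)) (p : ℝ) : AddCommGroup (Ell S p) :=
  inferInstanceAs (AddCommGroup ↥(ellSubmodule S p))

instance {d : ℕ} (S : Finset (Fin d → ℤ)) (p : ℝ) : Module ℂ (Ell S p) :=
  inferInstanceAs (Module ℂ ↥(ellSubmodule S p))

/-- The coordinates of an element of the weighted space. -/
def Ell.coord {d : ℕ} {S : Finset (Fin d → ℤ)} {p : ℝ} (q : Ell S p) (j : Site S) : ℂ := q.1 j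

theorem wt_pos {d : ℕ} (j : Fin d → ℤ) : 0 < wt j := lt_of_lt_of_le one_pos (le_max_left _ _)

/-- Multiplication by the weights, as a linear map to the unweighted space. -/
def Ell.toLp {d : ℕ} (S : Finset (Fin d → ℤ)) (p : ℝ) :
    Ell S p →ₗ[ℂ] lp (fun _ : Site S => ℂ) 2 where
  toFun q := ⟨fun j => ((wt j.1 ^ p : ℝ) : ℂ) * q.coord j, q.2⟩
  map_add' a b := by
    ext j
    exact mul_add _ _ _
  map_smul' c a := by
    ext j
    exact mul_left_comm _ _ _

theorem Ell.toLp_injective {d : ℕ} (S : Finset (Fin d → ℤ)) (p : ℝ) :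
    Function.Injective (Ell.toLp S p) := by
  intro a b hab
  apply Subtype.ext
  funext j
  have h : ((wt j.1 ^ p : ℝ) : ℂ) * a.coord j = ((wt j.1 ^ p : ℝ) : ℂ) * b.coord j :=
    congrFun (congrArg Subtype.val hab) j
  have hw : ((wt j.1 ^ p : ℝ) : ℂ) ≠ 0 :=
    Complex.ofReal_ne_zero.mpr (Real.rpow_pos_of_pos (wt_pos _) _).ne'
  exact mul_left_cancel₀ hw h

instance {d : ℕ} (S : Finset (Fin d → ℤ)) (p : ℝ) : NormedAddCommGroup (Ell S p) :=
  NormedAddCommGroup.induced (Ell S p) (lp (fun _ : Site S => ℂ) 2) (Ell.toLp S p)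
    (Ell.toLp_injective S p)

instance {d : ℕ} (S : Finset (Fin d → ℤ)) (p : ℝ) : NormedSpace ℂ (Ell S p) :=
  NormedSpace.induced ℂ (Ell S p) (lp (fun _ : Site S => ℂ) 2) (Ell.toLp S p)

/-- The norm of the weighted space is the expected one. -/
theorem Ell.norm_sq {d : ℕ} {S : Finset (Fin d → ℤ)} {p : ℝ} (q : Ell S p) :
    ‖q‖ ^ 2 = ∑' j : Site S, ‖q.coord j‖ ^ 2 * wt j.1 ^ (2 * p) := by
  have h1 : ‖q‖ = ‖Ell.toLp S p q‖ := rfl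
  have h2 := lp.norm_rpow_eq_tsum (p := 2) (by norm_num) (Ell.toLp S p q)
  simp only [ENNReal.toReal_ofNat, Real.rpow_two] at h2
  rw [h1, h2]
  refine tsum_congr fun j => ?_
  have h3 : (Ell.toLp S p q) j = ((wt j.1 ^ p : ℝ) : ℂ) * q.coord j := rfl
  have h4 : (0 : ℝ) ≤ wt j.1 ^ p := (Real.rpow_pos_of_pos (wt_pos _) _).le
  rw [h3, norm_mul, Complex.norm_real, Real.norm_of_nonneg h4, mul_pow, mul_comm 2 p,
    Real.rpow_mul (wt_pos _).le, Real.rpow_two, mul_comm]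

/-- The sequence that is `1` at `j` and `0` elsewhere. -/
def Ell.unit {d : ℕ} {S : Finset (Fin d → ℤ)} (p : ℝ) (j : Site S) : Ell S p :=
  ⟨Pi.single j 1, by
    refine memℓp_gen (summable_of_ne_finset_zero (s := {j}) ?_)
    intro i hi
    have : i ≠ j := by simpa using hi
    simp [Pi.single_eq_of_ne this]⟩

/-! ### Phase space -/

/-- Points `(x, y, q, q̄)`; the torus variable `x` is lifted to its universal cover, and the
finite-dimensional factors carry the sup norm. -/
abbrev Phase (n : ℕ) {d : ℕ} (S : Finset (Fin d → ℤ)) (p : ℝ) : Type :=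
  (Fin n → ℂ) × (Fin n → ℂ) × Ell S p × Ell S p

section

variable {n d : ℕ} {S : Finset (Fin d → ℤ)} {p : ℝ}

/-- `‖z‖_p = ‖q‖_p + ‖q̄‖_p` for `z = (q, q̄)`. -/
def zNorm (z : Ell S p × Ell S p) : ℝ := ‖z.1‖ + ‖z.2‖

/-- The weighted norm `‖x‖ + ‖y‖ / r² + ‖z‖_p / r`. -/
def scaledNorm (r : ℝ) (w : Phase n S p) : ℝ :=
  ‖w.1‖ + ‖w.2.1‖ / r ^ 2 + zNorm w.2.2 / r

/-- The complex neighbourhood `‖Im x‖ < s`, `‖y‖ < r²`, `‖z‖_p < r` of the torus. -/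
def Dom (n : ℕ) (S : Finset (Fin d → ℤ)) (p s r : ℝ) : Set (Phase n S p) :=
  {w | ‖fun i => (w.1 i).im‖ < s ∧ ‖w.2.1‖ < r ^ 2 ∧ zNorm w.2.2 < r}

/-- Real points: `x` and `y` are real, and `q̄` is the complex conjugate of `q`. -/
def IsRealPt (w : Phase n S p) : Prop :=
  (∀ i, (w.1 i).im = 0) ∧ (∀ i, (w.2.1 i).im = 0) ∧
    ∀ j, w.2.2.2.coord j = star (w.2.2.1.coord j)

/-- The unit vector in the direction `x i`. -/
def eX (i : Fin n) : Phase n S p := (Pi.single i 1, 0, 0, 0)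

/-- The unit vector in the direction `y i`. -/
def eY (i : Fin n) : Phase n S p := (0, Pi.single i 1, 0, 0)

/-- The unit vector in the direction `q j`. -/
def eQ (j : Site S) : Phase n S p := (0, 0, Ell.unit p j, 0)

/-- The unit vector in the direction `q̄ j`. -/
def eQbar (j : Site S) : Phase n S p := (0, 0, 0, Ell.unit p j)

/-- The symplectic form `∑ dyᵢ ∧ dxᵢ + √-1 ∑ dqⱼ ∧ dq̄ⱼ`. -/
def sympl (u v : Phase n S p) : ℂ :=
  ∑ i, (u.2.1 i * v.1 i - u.1 i * v.2.1 i) +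
    Complex.I * ∑' j : Site S,
      (u.2.2.1.coord j * v.2.2.2.coord j - u.2.2.2.coord j * v.2.2.1.coord j)

/-- Real analytic symplectic maps from `D` to `D'` that are lifts of maps homotopic to the identity
in the torus variable. -/
structure IsSymplecticMap (F : Phase n S p → Phase n S p) (D D' : Set (Phase n S p)) : Prop where
  mapsTo : Set.MapsTo F D D'
  analytic : AnalyticOnNhd ℂ F D
  real : ∀ w ∈ D, IsRealPt w → IsRealPt (F w)
  periodic : ∀ w ∈ D, ∀ k : Fin n → ℤ,
    F (w + ((fun i => 2 * (Real.pi : ℂ) * (k i : ℂ)), 0)) =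
      F w + ((fun i => 2 * (Real.pi : ℂ) * (k i : ℂ)), 0)
  symplectic : ∀ w ∈ D, ∀ u v, sympl (fderiv ℂ F w u) (fderiv ℂ F w v) = sympl u v

/-- Real solutions in `D`, on the time interval `T`, of the Hamiltonian equations
`x' = H_y`, `y' = -H_x`, `q' = √-1 H_q̄`, `q̄' = -√-1 H_q`: continuous curves in phase space whose
coordinates satisfy the equations. -/
structure IsSolution (H : Phase n S p → ℂ) (D : Set (Phase n S p)) (T : Set ℝ)
    (w : ℝ → Phase n S p) : Prop where
  cont : ContinuousOn w T
  mem : ∀ t ∈ T, w t ∈ D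
  real : ∀ t ∈ T, IsRealPt (w t)
  eq_x : ∀ t ∈ T, ∀ i, HasDerivWithinAt (fun τ => (w τ).1 i) (fderiv ℂ H (w t) (eY i)) T t
  eq_y : ∀ t ∈ T, ∀ i, HasDerivWithinAt (fun τ => (w τ).2.1 i) (-fderiv ℂ H (w t) (eX i)) T t
  eq_q : ∀ t ∈ T, ∀ j, HasDerivWithinAt (fun τ => (w τ).2.2.1.coord j)
    (Complex.I * fderiv ℂ H (w t) (eQbar j)) T t
  eq_qbar : ∀ t ∈ T, ∀ j, HasDerivWithinAt (fun τ => (w τ).2.2.2.coord j)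
    (-Complex.I * fderiv ℂ H (w t) (eQ j)) T t

/-! ### Distance to the torus -/

/-- The straight torus `{x real, y = 0, z = 0}`. -/
def flatTorus (n : ℕ) (S : Finset (Fin d → ℤ)) (p : ℝ) : Set (Phase n S p) :=
  {u | (∀ i, (u.1 i).im = 0) ∧ u.2 = 0}

/-- The distance that gives `y` the weight it has in `Dom`: there a radius `r` means `‖y‖ < r²`
and `‖z‖_p < r`. -/
def phaseDist (v u : Phase n S p) : ℝ :=
  ‖v.1 - u.1‖ + √‖v.2.1 - u.2.1‖ + zNorm (v.2.2 - u.2.2)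

/-- The distance to the straight torus. -/
def flatDist (v : Phase n S p) : ℝ := ⨅ u : flatTorus n S p, phaseDist v u.1

/-- The distance of `w` to the torus `Ψ (flatTorus)`, measured in the coordinates `v` with
`w = Ψ v`, `v ∈ D`, in which that torus is straight; it is `∞` outside the range of `Ψ`. -/
def torusDist (Ψ : Phase n S p → Phase n S p) (D : Set (Phase n S p)) (w : Phase n S p) : ℝ≥0∞ :=
  ⨅ v : {v : Phase n S p // v ∈ D ∧ IsRealPt v ∧ Ψ v = w}, ENNReal.ofReal (flatDist v.1)

/-! ### Fourier-Taylor expansions -/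

/-- Indices of the variables `z = (q, q̄)`: `inl j` stands for `q j` and `inr j` for `q̄ j`. -/
abbrev Idx (S : Finset (Fin d → ℤ)) : Type := Site S ⊕ Site S

/-- The variables `z = (q, q̄)` of a phase point. -/
def zCoord (w : Phase n S p) : Idx S → ℂ := Sum.elim w.2.2.1.coord w.2.2.2.coord

/-- Coefficients of a series `∑ a k α b e^{√-1⟨k,x⟩} y^α z^b`. -/
abbrev Coeff (n : ℕ) (S : Finset (Fin d → ℤ)) : Type :=
  (Fin n → ℤ) → (Fin n → ℕ) → (Idx S →₀ ℕ) → ℂ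

/-- The function with the given coefficients. -/
def expand (a : Coeff n S) (w : Phase n S p) : ℂ :=
  ∑' m : (Fin n → ℤ) × (Fin n → ℕ) × (Idx S →₀ ℕ),
    a m.1 m.2.1 m.2.2 * Complex.exp (Complex.I * ∑ i, (m.1 i : ℂ) * w.1 i) *
      (∏ i, w.2.1 i ^ m.2.1 i) * m.2.2.prod fun j e => zCoord w j ^ e

/-- Coefficients of the partial derivative with respect to `x i`. -/
def Coeff.dx (a : Coeff n S) (i : Fin n) : Coeff n S := fun k α b => Complex.I * (k i : ℂ) * a k α b

/-- Coefficients of the partial derivative with respect to `y i`. -/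
def Coeff.dy (a : Coeff n S) (i : Fin n) : Coeff n S :=
  fun k α b => ((α i : ℂ) + 1) * a k (α + Pi.single i 1) b

/-- Coefficients of the partial derivative with respect to `z j`. -/
def Coeff.dz (a : Coeff n S) (j : Idx S) : Coeff n S :=
  fun k α b => ((b j : ℂ) + 1) * a k α (b + Finsupp.single j 1)

/-! ### The tame norm of a Hamiltonian vector field, at a fixed value of the parameters -/

/-- The norm on `‖Im x‖ < s`, `‖y‖ < r²` of the coefficient of `z^b`. (The symmetric multilinear
form of a monomial `y^α` has operator norm `1` with respect to the sup norm.) -/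
def Coeff.xyNorm (a : Coeff n S) (s r : ℝ) (b : Idx S →₀ ℕ) : ℝ≥0∞ :=
  ∑' α : Fin n → ℕ, (∑' k : Fin n → ℤ,
    ‖a k α b‖ₑ * ENNReal.ofReal (Real.exp ((∑ i, |(k i : ℝ)|) * s))) *
      ENNReal.ofReal (r ^ (2 * ∑ i, α i))

/-- The multi-index that counts the entries of a tuple. -/
def tupleCount {m : ℕ} (t : Fin m → Idx S) : Idx S →₀ ℕ := ∑ i, Finsupp.single (t i) 1

/-- The symmetric `m`-linear form whose restriction to the diagonal is
`∑_{|b| = m} ‖W^b‖ z^b`, evaluated at the moduli of the arguments (a multi-index `b` of degree `m`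
is the count of exactly `b.multinomial` tuples). As the coefficients are nonnegative, passing to
moduli does not change the suprema below. -/
def Coeff.modForm (a : Coeff n S) (s r : ℝ) {m : ℕ} (u : Fin m → Idx S → ℂ) : ℝ≥0∞ :=
  ∑' t : Fin m → Idx S, a.xyNorm s r (tupleCount t) / ((tupleCount t).multinomial : ℝ≥0∞) *
    ∏ i, ‖u i (t i)‖ₑ

/-- `‖q‖_p + ‖q̄‖_p` for a family of moduli, with values in `[0, ∞]`. -/
def bNorm (p : ℝ) (f : Idx S → ℝ≥0∞) : ℝ≥0∞ :=
  (∑' j : Site S, (ENNReal.ofReal (wt j.1 ^ p) * f (Sum.inl j)) ^ 2) ^ (1 / 2 : ℝ) +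
    (∑' j : Site S, (ENNReal.ofReal (wt j.1 ^ p) * f (Sum.inr j)) ^ 2) ^ (1 / 2 : ℝ)

/-- The same norm for a family of complex numbers. -/
def cNorm (p : ℝ) (u : Idx S → ℂ) : ℝ≥0∞ := bNorm p fun j => ‖u j‖ₑ

/-- `(1/h) ∑ᵢ ‖u i‖_p ∏_{l ≠ i} ‖u l‖_{p'}`, and `1` for `h = 0`. -/
def mixedNorm (p p' : ℝ) {h : ℕ} (u : Fin h → Idx S → ℂ) : ℝ≥0∞ :=
  if h = 0 then 1
  else (∑ i, cNorm p (u i) * ∏ l ∈ Finset.univ.erase i, cNorm p' (u l)) / (h : ℝ≥0∞)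

/-- The operator norm, on the part of degree `m + 1` in `z`, of the `z`-gradient, from the mixed
`(p, p')`-norm to the norm of exponent `p''`. The multiplication by `J` exchanges the two halves up
to sign and does not affect the norm. -/
def Coeff.gradZNorm (a : Coeff n S) (s r p p' p'' : ℝ) (m : ℕ) : ℝ≥0∞ :=
  ⨆ u : {u : Fin m → Idx S → ℂ // ∀ i, cNorm p (u i) ≠ 0 ∧ cNorm p (u i) ≠ ⊤},
    bNorm p'' (fun j => (a.dz j).modForm s r u.1) / mixedNorm p p' u.1

/-- The operator norm, on the part of degree `h` in `z`, of a vector of `n` series, with the sup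
norm of vectors and the norm of exponent `p'` on the arguments. -/
def gradVNorm (a : Fin n → Coeff n S) (s r p' : ℝ) (h : ℕ) : ℝ≥0∞ :=
  ⨆ u : {u : Fin h → Idx S → ℂ // ∀ i, cNorm p' (u i) ≠ 0 ∧ cNorm p' (u i) ≠ ⊤},
    (⨆ i, (a i).modForm s r u.1) / mixedNorm p' p' u.1

/-- The contribution of the `z`-gradient of the part of degree `h`: the larger of the `p`-tame
norm (which gains two derivatives) and the `d`-norm, times `r^(h-1)`. -/
def Coeff.tameZ (a : Coeff n S) (p s r : ℝ) : ℕ → ℝ≥0∞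
  | 0 => 0
  | m + 1 => max (a.gradZNorm s r p d (p + 2) m) (a.gradZNorm s r d d d m) * ENNReal.ofReal (r ^ m)

/-- The `p`-tame norm of the Hamiltonian vector field on `Dom n S p s r`: the sum over all degrees
`h` in `z` of `|||W_y||| + |||W_x||| / r² + |||W_z|||^T / r`. -/
def Coeff.tameNorm (a : Coeff n S) (p s r : ℝ) : ℝ≥0∞ :=
  ∑' h : ℕ,
    (gradVNorm a.dy s r d h * ENNReal.ofReal (r ^ h) +
      ENNReal.ofReal (1 / r ^ 2) * (gradVNorm a.dx s r d h * ENNReal.ofReal (r ^ h)) +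
      ENNReal.ofReal (1 / r) * a.tameZ p s r h)

/-! ### Normal forms -/

/-- The integrable Hamiltonian `∑ ωᵢ yᵢ + ∑ Ωⱼ qⱼ q̄ⱼ`. -/
def integrable (ω : Fin n → ℝ) (Ω : Site S → ℝ) (w : Phase n S p) : ℂ :=
  ∑ i, (ω i : ℂ) * w.2.1 i + ∑' j : Site S, (Ω j : ℂ) * w.2.2.1.coord j * w.2.2.2.coord j

/-- The degree of a monomial `y^α z^b`, where `y` counts twice. -/
def wDeg (α : Fin n → ℕ) (b : Idx S →₀ ℕ) : ℕ := 2 * ∑ i, α i + b.sum fun _ e => e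

/-- The degree of `z^b` in the high modes, those of length greater than `N`. -/
def highDeg (N : ℕ) (b : Idx S →₀ ℕ) : ℕ :=
  b.sum fun j e => if (N : ℝ) < latNorm (Sum.elim id id j : Site S).1 then e else 0

/-- `Ψ` brings the Hamiltonian `H` to a normal form of order two around the KAM torus
`Ψ (flatTorus)`: `H ∘ Ψ` is integrable up to a perturbation of degree at least three that has the
tame property. -/
structure IsNormalFormTwo (s₀ r₀ κ : ℝ) (H : Phase n S p → ℂ) (Ψ : Phase n S p → Phase n S p)
    (ω : Fin n → ℝ) (Ω : Site S → ℝ) : Prop where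
  analytic : AnalyticOnNhd ℂ H (Dom n S p s₀ r₀)
  freq : ∃ C : ℝ, ∀ j, |Ω j| ≤ C * wt j.1 ^ 2
  map : IsSymplecticMap Ψ (Dom n S p (s₀ / 2) (r₀ / 2)) (Dom n S p s₀ r₀)
  near_id : ∀ w ∈ Dom n S p (s₀ / 2) (r₀ / 2), scaledNorm r₀ (Ψ w - w) ≤ κ
  deriv_near_id : ∀ w ∈ Dom n S p (s₀ / 2) (r₀ / 2), ∀ u,
    scaledNorm r₀ (fderiv ℂ Ψ w u - u) ≤ κ * scaledNorm (r₀ / 2) u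
  form : ∃ R : Coeff n S, R.tameNorm p (s₀ / 2) (r₀ / 2) < ⊤ ∧
    (∀ k α b, R k α b ≠ 0 → 3 ≤ wDeg α b) ∧
    ∀ w ∈ Dom n S p (s₀ / 2) (r₀ / 2), H (Ψ w) = integrable ω Ω w + expand R w

/-- `Φ` brings `H` to a partial normal form of order `M + 2`, with cutoff `N`, on the domain of
radius `4ρ`: `H ∘ Φ` is integrable up to `Z + P + Q`, where `Z` is a real polynomial in `y` and the
products `qⱼ q̄ⱼ`, of degree at most two in the high modes, `P` is of degree at least `M + 3` and at
most quadratic in the high modes, and `Q` is at least cubic in the high modes. -/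
structure IsPartialNormalForm (s₀ η c : ℝ) (M N : ℕ) (ρ : ℝ) (H : Phase n S p → ℂ)
    (ω : Fin n → ℝ) (Ω : Site S → ℝ) (Φ : Phase n S p → Phase n S p) (Z P Q : Coeff n S) :
    Prop where
  map : IsSymplecticMap Φ (Dom n S p (s₀ / 4) (4 * ρ)) (Dom n S p (s₀ / 2) (5 * ρ))
  form : ∀ w ∈ Dom n S p (s₀ / 4) (4 * ρ),
    H (Φ w) = integrable ω Ω w + expand Z w + expand P w + expand Q w
  Z_real : ∀ k α b, (Z k α b).im = 0
  Z_form : ∀ k α b, Z k α b ≠ 0 → k = 0 ∧ (∀ j, b (Sum.inl j) = b (Sum.inr j)) ∧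
    4 ≤ wDeg α b ∧ wDeg α b ≤ M + 2 ∧ highDeg N b ≤ 2
  P_form : ∀ k α b, P k α b ≠ 0 → M + 3 ≤ wDeg α b ∧ highDeg N b ≤ 2
  Q_form : ∀ k α b, Q k α b ≠ 0 → 3 ≤ highDeg N b
  near_id : ∀ w ∈ Dom n S p (s₀ / 4) (4 * ρ),
    scaledNorm (5 * ρ) (Φ w - w) ≤ c * (N : ℝ) ^ 294 * ρ / η ^ 2
  deriv_near_id : ∀ w ∈ Dom n S p (s₀ / 4) (4 * ρ), ∀ u,
    scaledNorm (5 * ρ) (fderiv ℂ Φ w u - u) ≤ c * (N : ℝ) ^ 294 / η ^ 2 * scaledNorm (4 * ρ) u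
  Z_le : Z.tameNorm p (s₀ / 4) (4 * ρ) ≤
    ENNReal.ofReal (c * ρ * (1 / η ^ 2 * (N : ℝ) ^ (6 * (M + 6) ^ 2) * ρ))
  P_le : P.tameNorm p (s₀ / 4) (4 * ρ) ≤
    ENNReal.ofReal (c * ρ * (1 / η ^ 2 * (N : ℝ) ^ (6 * (M + 7) ^ 2) * ρ) ^ M)
  Q_le : Q.tameNorm p (s₀ / 4) (4 * ρ) ≤ ENNReal.ofReal (c * ρ)

end

end KamTori

end

noncomputable section

namespace KamTori

/-! ### The weighted sequence spaces -/

section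

variable {n d : ℕ} {S : Finset (Fin d → ℤ)} {p : ℝ}

/-! Take the partial normal form with `σ = δ` and a cutoff `N` comparable to a small negative power
of `δ`, and write the solution as `w = Ψ (Φ u)`. In the coordinates `u` the Hamiltonian is
integrable part plus `Z + P + Q`, and the first two are invariant under translation of each `x i`
and under rotation of each pair `q j`, `q̄ j`. Hence `y` and the `|q j|²` change only through `P`
and `Q`, and it is enough to bound the derivatives of `P` and `Q` along the generators of these
symmetries. Such a derivative is estimated from difference quotients: a symmetry multiplies every
monomial by a phase, so the series need not be differentiated term by term.

`P` is small by its tame norm. For `Q` the high modes are multiplied by `L = N ^ (p - d)`. The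
`d`-norm of the amplified sequence is at most the `p`-norm of the original, while the `p`-norm grows
at most by the factor `L`. The `z`-gradient of `Q` has degree at least two in the high modes and
gains `L ^ 2`; the tame estimate is linear in the `p`-norm and loses one `L`. So `Q` acts like a
term of size `c * δ / L` (`Coeff.mul_tsum_majorant_dz_le`, `Coeff.mul_majorant_dx_le`). With the
cutoff of `exists_cutoff` the rates of `‖y‖` and of `‖q‖_p²` are at most `(4δ)² ε δ ^ M`, so over
times up to `δ ^ (-M)` the size of `u` changes by a small fraction of `δ` (`normalSize_evolution`).

There is an analytic difficulty: a solution is differentiable only coordinate by coordinate, since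
the frequencies are unbounded, so the chain rule does not apply to `w = Ψ (Φ u)`. The equations are
therefore tested against the symplectic form. Because `dH` is locally bounded, the curve is
Lipschitz in the dual norm given by the form, and this together with symplecticity suffices to
transport the weak equations (`WeakSolution.pullback`). Finally, the coordinates `u` exist only as
long as the solution stays near the torus, which is what is to be shown; a continuity argument
(`bootstrap`) closes the circle, using that real points near `Ψ (Φ u)` lift to real points near `u`
(`IsNormalCoordinates.exists_cover`). -/

theorem one_le_wt (j : Fin d → ℤ) : 1 ≤ wt j := le_max_left _ _

theorem one_le_wt_rpow (hp : 0 ≤ p) (j : Fin d → ℤ) : 1 ≤ wt j ^ p :=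
  Real.one_le_rpow (one_le_wt j) hp

theorem Ell.norm_toLp (q : Ell S p) : ‖Ell.toLp S p q‖ = ‖q‖ := rfl

theorem Ell.toLp_apply (q : Ell S p) (j : Site S) :
    Ell.toLp S p q j = ((wt j.1 ^ p : ℝ) : ℂ) * q.coord j := rfl

@[simp] theorem Ell.coord_add (a b : Ell S p) (j : Site S) :
    (a + b).coord j = a.coord j + b.coord j := rfl

@[simp] theorem Ell.coord_sub (a b : Ell S p) (j : Site S) :
    (a - b).coord j = a.coord j - b.coord j := rfl

@[simp] theorem Ell.coord_neg (a : Ell S p) (j : Site S) : (-a).coord j = -a.coord j := rfl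

@[simp] theorem Ell.coord_zero (j : Site S) : (0 : Ell S p).coord j = 0 := rfl

@[simp] theorem Ell.coord_smul (c : ℂ) (a : Ell S p) (j : Site S) :
    (c • a).coord j = c * a.coord j := rfl

theorem Ell.coord_unit (j i : Site S) :
    (Ell.unit p j).coord i = (Pi.single j 1 : Site S → ℂ) i := rfl

theorem Ell.norm_toLp_apply (q : Ell S p) (j : Site S) :
    ‖Ell.toLp S p q j‖ = wt j.1 ^ p * ‖q.coord j‖ := by
  rw [Ell.toLp_apply, norm_mul, Complex.norm_real,
    Real.norm_of_nonneg (Real.rpow_pos_of_pos (wt_pos _) _).le]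

/-- Multiplication by the weights is onto the unweighted space. -/
theorem Ell.toLp_surjective : Function.Surjective (Ell.toLp S p) := by
  intro f
  have hw : ∀ j : Site S, ((wt j.1 ^ p : ℝ) : ℂ) ≠ 0 := fun j =>
    Complex.ofReal_ne_zero.mpr (Real.rpow_pos_of_pos (wt_pos _) _).ne'
  have h : (fun j : Site S => ((wt j.1 ^ p : ℝ) : ℂ) * (((wt j.1 ^ p : ℝ) : ℂ)⁻¹ * f j)) = f := by
    funext j
    rw [mul_inv_cancel_left₀ (hw j)]
  refine ⟨⟨fun j => ((wt j.1 ^ p : ℝ) : ℂ)⁻¹ * f j, ?_⟩, ?_⟩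
  · change Memℓp _ 2
    rw [h]
    exact f.2
  · ext j
    exact congrFun h j

/-- Multiplication by the weights is an isometry onto the unweighted space. -/
def Ell.isometryEquiv (S : Finset (Fin d → ℤ)) (p : ℝ) :
    Ell S p ≃ₗᵢ[ℂ] lp (fun _ : Site S => ℂ) 2 :=
  { LinearEquiv.ofBijective (Ell.toLp S p) ⟨Ell.toLp_injective S p, Ell.toLp_surjective⟩ with
    norm_map' := fun _ => rfl }

theorem Ell.isometryEquiv_apply (q : Ell S p) :
    Ell.isometryEquiv S p q = Ell.toLp S p q := rfl

instance : CompleteSpace (Ell S p) :=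
  (Ell.isometryEquiv S p).toIsometryEquiv.completeSpace

theorem Ell.norm_coord_le (hp : 0 ≤ p) (q : Ell S p) (j : Site S) : ‖q.coord j‖ ≤ ‖q‖ := by
  have h := lp.norm_apply_le_norm (two_ne_zero) (Ell.toLp S p q) j
  rw [Ell.norm_toLp_apply, Ell.norm_toLp] at h
  exact (le_mul_of_one_le_left (norm_nonneg _) (one_le_wt_rpow hp _)).trans h

/-- A coordinate as a continuous linear form. -/
def Ell.coordL (hp : 0 ≤ p) (j : Site S) : Ell S p →L[ℂ] ℂ :=
  LinearMap.mkContinuous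
    { toFun := fun q => q.coord j, map_add' := fun _ _ => rfl, map_smul' := fun _ _ => rfl } 1
    fun q => (Ell.norm_coord_le hp q j).trans_eq (one_mul _).symm

/-- Transported through the isometry from the expansion of an unweighted `ℓ²` sequence in the
`lp.single`. It is what makes the coordinate directions span a dense subspace. -/
theorem Ell.hasSum_unit (q : Ell S p) :
    HasSum (fun j => q.coord j • (Ell.unit p j : Ell S p)) q := by
  classical
  have h : HasSum (fun j => lp.single 2 j (Ell.toLp S p q j)) (Ell.isometryEquiv S p q) :=
    lp.hasSum_single (p := 2) (by norm_num) (Ell.toLp S p q)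
  have h2 := h.mapL (Ell.isometryEquiv S p).symm.toContinuousLinearEquiv.toContinuousLinearMap
  have h3 : ∀ j : Site S, Ell.isometryEquiv S p (q.coord j • Ell.unit p j) =
      lp.single 2 j (Ell.toLp S p q j) := by
    intro j
    ext i
    rw [Ell.isometryEquiv_apply, Ell.toLp_apply, lp.single_apply, Ell.coord_smul, Ell.coord_unit]
    by_cases hij : i = j
    · subst hij
      simp [Ell.toLp_apply]
    · simp [hij]
  have h4 : ∀ j : Site S, q.coord j • Ell.unit p j =
      (Ell.isometryEquiv S p).symm (lp.single 2 j (Ell.toLp S p q j)) := fun j => by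
    rw [← h3 j, LinearIsometryEquiv.symm_apply_apply]
  have h5 : (Ell.isometryEquiv S p).symm (Ell.isometryEquiv S p q) = q :=
    LinearIsometryEquiv.symm_apply_apply _ _
  rw [funext h4]
  exact (congrArg (fun y => HasSum (fun j => (Ell.isometryEquiv S p).symm
    (lp.single 2 j (Ell.toLp S p q j))) y) h5).mp h2

/-- The `ℓ²` pairing of two sequences. -/
theorem Ell.pairing (hp : 0 ≤ p) (a b : Ell S p) :
    (Summable fun j => a.coord j * b.coord j) ∧ ‖∑' j, a.coord j * b.coord j‖ ≤ ‖a‖ * ‖b‖ := by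
  have hc : (2 : ℝ≥0∞).toReal.HolderConjugate (2 : ℝ≥0∞).toReal := by
    simpa using Real.HolderConjugate.two_two
  have h := lp.tsum_mul_le_mul_norm hc (Ell.toLp S p a) (Ell.toLp S p b)
  have hle : ∀ j, ‖a.coord j * b.coord j‖ ≤ ‖Ell.toLp S p a j‖ * ‖Ell.toLp S p b j‖ := by
    intro j
    rw [norm_mul, Ell.norm_toLp_apply, Ell.norm_toLp_apply]
    have := one_le_wt_rpow hp j.1
    gcongr <;> exact le_mul_of_one_le_left (norm_nonneg _) this
  have hs : Summable fun j => ‖a.coord j * b.coord j‖ :=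
    h.1.of_nonneg_of_le (fun _ => norm_nonneg _) hle
  refine ⟨hs.of_norm, (norm_tsum_le_tsum_norm hs).trans ((hs.tsum_le_tsum hle h.1).trans h.2)⟩

/-! ### The symplectic form as a continuous bilinear form -/

/-- For `p ≥ 0` the weights are at least one, so both pairings converge and the series of
differences may be split. Linearity and antisymmetry then reduce to those of the pairings. -/
theorem sympl_eq (hp : 0 ≤ p) (u v : Phase n S p) :
    sympl u v = ∑ i, (u.2.1 i * v.1 i - u.1 i * v.2.1 i) +
      Complex.I * ((∑' j : Site S, u.2.2.1.coord j * v.2.2.2.coord j) -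
        ∑' j : Site S, u.2.2.2.coord j * v.2.2.1.coord j) := by
  rw [sympl, (Ell.pairing hp _ _).1.tsum_sub (Ell.pairing hp _ _).1]

theorem sympl_add_left (hp : 0 ≤ p) (u u' v : Phase n S p) :
    sympl (u + u') v = sympl u v + sympl u' v := by
  rw [sympl_eq hp, sympl_eq hp, sympl_eq hp]
  simp only [Prod.fst_add, Prod.snd_add, Pi.add_apply, Ell.coord_add, add_mul]
  rw [(Ell.pairing hp _ _).1.tsum_add (Ell.pairing hp _ _).1,
    (Ell.pairing hp _ _).1.tsum_add (Ell.pairing hp _ _).1]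
  simp only [Finset.sum_add_distrib, Finset.sum_sub_distrib]
  ring

theorem sympl_smul_left (hp : 0 ≤ p) (c : ℂ) (u v : Phase n S p) :
    sympl (c • u) v = c * sympl u v := by
  rw [sympl_eq hp, sympl_eq hp]
  simp only [Prod.smul_fst, Prod.smul_snd, Pi.smul_apply, Ell.coord_smul, smul_eq_mul, mul_assoc,
    tsum_mul_left]
  rw [mul_add, Finset.mul_sum]
  congr 1
  · exact Finset.sum_congr rfl fun i _ => by ring
  · ring

theorem sympl_swap (hp : 0 ≤ p) (u v : Phase n S p) : sympl u v = -sympl v u := by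
  rw [sympl_eq hp, sympl_eq hp, neg_add, ← Finset.sum_neg_distrib]
  congr 1
  · exact Finset.sum_congr rfl fun i _ => by ring
  · simp only [mul_comm (u.2.2.1.coord _), mul_comm (u.2.2.2.coord _)]
    ring

theorem norm_sympl_le (hp : 0 ≤ p) (u v : Phase n S p) :
    ‖sympl u v‖ ≤ (2 * n + 2) * ‖u‖ * ‖v‖ := by
  have h1 : ∀ w : Phase n S p, ‖w.1‖ ≤ ‖w‖ := fun w => norm_fst_le w
  have h2 : ∀ w : Phase n S p, ‖w.2.1‖ ≤ ‖w‖ := fun w => (norm_fst_le w.2).trans (norm_snd_le w)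
  have h3 : ∀ w : Phase n S p, ‖w.2.2.1‖ ≤ ‖w‖ := fun w =>
    ((norm_fst_le w.2.2).trans (norm_snd_le w.2)).trans (norm_snd_le w)
  have h4 : ∀ w : Phase n S p, ‖w.2.2.2‖ ≤ ‖w‖ := fun w =>
    ((norm_snd_le w.2.2).trans (norm_snd_le w.2)).trans (norm_snd_le w)
  have h5 : ‖∑ i, (u.2.1 i * v.1 i - u.1 i * v.2.1 i)‖ ≤ ∑ _i : Fin n, 2 * (‖u‖ * ‖v‖) := by
    refine (norm_sum_le _ _).trans (Finset.sum_le_sum fun i _ => ?_)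
    refine (norm_sub_le _ _).trans ?_
    rw [norm_mul, norm_mul, two_mul]
    gcongr
    · exact (norm_le_pi_norm _ i).trans (h2 u)
    · exact (norm_le_pi_norm _ i).trans (h1 v)
    · exact (norm_le_pi_norm _ i).trans (h1 u)
    · exact (norm_le_pi_norm _ i).trans (h2 v)
  have h6 : ∀ a b : Ell S p, ‖a‖ ≤ ‖u‖ → ‖b‖ ≤ ‖v‖ →
      ‖∑' j, a.coord j * b.coord j‖ ≤ ‖u‖ * ‖v‖ := fun a b ha hb =>
    (Ell.pairing hp a b).2.trans (by gcongr)
  rw [sympl_eq hp]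
  refine (norm_add_le _ _).trans ?_
  rw [norm_mul, Complex.norm_I, one_mul]
  have h7 := (norm_sub_le (∑' j : Site S, u.2.2.1.coord j * v.2.2.2.coord j)
    (∑' j : Site S, u.2.2.2.coord j * v.2.2.1.coord j)).trans
    (add_le_add (h6 _ _ (h3 u) (h4 v)) (h6 _ _ (h4 u) (h3 v)))
  rw [Finset.sum_const, Finset.card_univ, Fintype.card_fin, nsmul_eq_mul] at h5
  linarith

/-- The symplectic form as a continuous bilinear form. -/
def symplB (n : ℕ) (S : Finset (Fin d → ℤ)) (hp : 0 ≤ p) :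
    Phase n S p →L[ℂ] Phase n S p →L[ℂ] ℂ :=
  LinearMap.mkContinuous₂
    (LinearMap.mk₂ ℂ sympl (sympl_add_left hp) (fun c u v => sympl_smul_left hp c u v)
      (fun u v v' => by
        rw [sympl_swap hp, sympl_add_left hp, neg_add, ← sympl_swap hp, ← sympl_swap hp])
      (fun c u v => by
        rw [sympl_swap hp, sympl_smul_left hp, sympl_swap hp u v, smul_eq_mul, mul_neg]))
    (2 * n + 2) fun u v => norm_sympl_le hp u v

@[simp] theorem symplB_apply (hp : 0 ≤ p) (u v : Phase n S p) :
    symplB n S hp u v = sympl u v := rfl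

/-! ### The coordinate directions span a dense subspace -/

/-- The coordinate directions of phase space. -/
def coordDirs (n : ℕ) (S : Finset (Fin d → ℤ)) (p : ℝ) : Set (Phase n S p) :=
  Set.range eX ∪ Set.range eY ∪ Set.range eQ ∪ Set.range eQbar

theorem closure_span_coordDirs :
    (Submodule.span ℂ (coordDirs n S p)).topologicalClosure = ⊤ := by
  set V := (Submodule.span ℂ (coordDirs n S p)).topologicalClosure with hV
  have hsub : ∀ v ∈ coordDirs n S p, v ∈ V := fun v hv =>
    Submodule.le_topologicalClosure _ (Submodule.subset_span hv)
  have hclosed : IsClosed (V : Set (Phase n S p)) := Submodule.isClosed_topologicalClosure _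
  have hq : ∀ q : Ell S p, ((0, 0, q, 0) : Phase n S p) ∈ V := by
    intro q
    let ι : Ell S p →L[ℂ] Phase n S p :=
      (ContinuousLinearMap.inr ℂ _ _).comp ((ContinuousLinearMap.inr ℂ _ _).comp
        (ContinuousLinearMap.inl ℂ _ _))
    have h := (Ell.hasSum_unit q).mapL ι
    refine hclosed.mem_of_tendsto h (Filter.Eventually.of_forall fun s => ?_)
    refine Submodule.sum_mem _ fun j _ => ?_
    rw [map_smul]
    exact Submodule.smul_mem _ _ (hsub _ (Or.inl (Or.inr ⟨j, rfl⟩)))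
  have hq' : ∀ q : Ell S p, ((0, 0, 0, q) : Phase n S p) ∈ V := by
    intro q
    let ι : Ell S p →L[ℂ] Phase n S p :=
      (ContinuousLinearMap.inr ℂ _ _).comp ((ContinuousLinearMap.inr ℂ _ _).comp
        (ContinuousLinearMap.inr ℂ _ _))
    have h := (Ell.hasSum_unit q).mapL ι
    refine hclosed.mem_of_tendsto h (Filter.Eventually.of_forall fun s => ?_)
    refine Submodule.sum_mem _ fun j _ => ?_
    rw [map_smul]
    exact Submodule.smul_mem _ _ (hsub _ (Or.inr ⟨j, rfl⟩))
  have hx : ∀ x : Fin n → ℂ, ((x, 0, 0, 0) : Phase n S p) ∈ V := by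
    intro x
    have : ((x, 0, 0, 0) : Phase n S p) = ∑ i, x i • eX i := by
      have h := congrArg (ContinuousLinearMap.inl ℂ (Fin n → ℂ) ((Fin n → ℂ) × Ell S p × Ell S p))
        (pi_eq_sum_univ' x)
      simp only [map_sum, map_smul] at h
      refine h.trans (Finset.sum_congr rfl fun i _ => ?_)
      congr 2
    rw [this]
    exact Submodule.sum_mem _ fun i _ =>
      Submodule.smul_mem _ _ (hsub _ (Or.inl (Or.inl (Or.inl ⟨i, rfl⟩))))
  have hy : ∀ y : Fin n → ℂ, ((0, y, 0, 0) : Phase n S p) ∈ V := by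
    intro y
    have : ((0, y, 0, 0) : Phase n S p) = ∑ i, y i • eY i := by
      have h := congrArg ((ContinuousLinearMap.inr ℂ (Fin n → ℂ) _).comp
        (ContinuousLinearMap.inl ℂ (Fin n → ℂ) (Ell S p × Ell S p)))
        (pi_eq_sum_univ' y)
      simp only [map_sum, map_smul] at h
      refine h.trans (Finset.sum_congr rfl fun i _ => ?_)
      congr 3
    rw [this]
    exact Submodule.sum_mem _ fun i _ =>
      Submodule.smul_mem _ _ (hsub _ (Or.inl (Or.inl (Or.inr ⟨i, rfl⟩))))
  rw [eq_top_iff]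
  rintro ⟨x, y, q, q'⟩ -
  have : ((x, y, q, q') : Phase n S p) =
      (x, 0, 0, 0) + (0, y, 0, 0) + (0, 0, q, 0) + (0, 0, 0, q') := by simp
  rw [this]
  exact add_mem (add_mem (add_mem (hx x) (hy y)) (hq q)) (hq' q')

end

/-! ### Maps close to the identity, measured in an equivalent norm `‖Λ ·‖` -/

section

variable {E E' : Type*} [NormedAddCommGroup E] [NormedSpace ℂ E] [NormedAddCommGroup E']
  [NormedSpace ℂ E']

/-- The mean value inequality for `F - id` on the segment from `b` to `a`. Sizes are measured by `‖Λ
·‖` so that the contraction constant is the one available in the scaled norm. -/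
theorem norm_sub_sub_le_of_fderiv_near_id {Λ : E →L[ℂ] E'} {F : E → E} {U : Set E} {K : ℝ}
    (hU : Convex ℝ U) (hF : ∀ w ∈ U, DifferentiableAt ℂ F w)
    (hK : ∀ w ∈ U, ∀ u, ‖Λ (fderiv ℂ F w u - u)‖ ≤ K * ‖Λ u‖) {a b : E} (ha : a ∈ U)
    (hb : b ∈ U) : ‖Λ (F a - F b - (a - b))‖ ≤ K * ‖Λ (a - b)‖ := by
  have hmem : ∀ t ∈ Set.Icc (0 : ℝ) 1, b + (t : ℂ) • (a - b) ∈ U := by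
    intro t ht
    have := hU.add_smul_sub_mem hb ha ht
    rwa [RCLike.real_smul_eq_coe_smul (K := ℂ)] at this
  have hline : ∀ t : ℝ, HasDerivAt (fun t : ℝ => b + (t : ℂ) • (a - b)) (a - b) t := by
    intro t
    have h := (Complex.ofRealCLM.hasDerivAt (x := t)).smul_const (a - b)
    simpa using h.const_add b
  have hder : ∀ t ∈ Set.Icc (0 : ℝ) 1, HasDerivWithinAt
      (fun t : ℝ => Λ (F (b + (t : ℂ) • (a - b)) - (b + (t : ℂ) • (a - b))))
      (Λ (fderiv ℂ F (b + (t : ℂ) • (a - b)) (a - b) - (a - b))) (Set.Icc 0 1) t := by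
    intro t ht
    have h1 := ((hF _ (hmem t ht)).hasFDerivAt.restrictScalars ℝ).comp_hasDerivAt t (hline t)
    have h2 := h1.sub (hline t)
    exact ((Λ.restrictScalars ℝ).hasFDerivAt.comp_hasDerivAt t h2).hasDerivWithinAt
  have h := norm_image_sub_le_of_norm_deriv_le_segment_01' hder
    (fun t ht => hK _ (hmem t ⟨ht.1, ht.2.le⟩) _)
  rw [← map_sub] at h
  convert! h using 3
  simp
  abel

/-- For `K < 1` this lower Lipschitz bound gives injectivity of `F` and continuity of lifted curves.
-/
theorem norm_le_of_norm_sub_sub_le {Λ : E →L[ℂ] E'} {F : E → E} {K : ℝ} {a b : E}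
    (h : ‖Λ (F a - F b - (a - b))‖ ≤ K * ‖Λ (a - b)‖) :
    (1 - K) * ‖Λ (a - b)‖ ≤ ‖Λ (F a - F b)‖ := by
  have h1 : Λ (a - b) = Λ (F a - F b) - Λ (F a - F b - (a - b)) := by
    rw [← map_sub]; congr 1; abel
  have h2 := norm_sub_le (Λ (F a - F b)) (Λ (F a - F b - (a - b)))
  rw [← h1] at h2
  linarith

/-- A contraction argument that stays within a closed subgroup. -/
theorem exists_preimage_of_near_id [CompleteSpace E] {Λ : E →L[ℂ] E'} {C : ℝ}
    (hΛ : ∀ w, ‖w‖ ≤ C * ‖Λ w‖) {F : E → E} {G : AddSubgroup E} (hG : IsClosed (G : Set E))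
    {K R : ℝ} (hK0 : 0 ≤ K) (hK1 : K < 1) {u₀ : E} (hu₀ : u₀ ∈ G)
    (hlip : ∀ a b, ‖Λ (a - u₀)‖ ≤ R → ‖Λ (b - u₀)‖ ≤ R →
      ‖Λ (F a - F b - (a - b))‖ ≤ K * ‖Λ (a - b)‖)
    (hFG : ∀ a ∈ G, ‖Λ (a - u₀)‖ ≤ R → F a ∈ G) {w : E} (hw : w ∈ G)
    (hwR : ‖Λ (w - F u₀)‖ ≤ (1 - K) * R) :
    ∃ u ∈ G, ‖Λ (u - u₀)‖ ≤ R ∧ F u = w := by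
  have hR : 0 ≤ R := nonneg_of_mul_nonneg_right ((norm_nonneg _).trans hwR) (by linarith)
  -- A fixed point of `a ↦ a - F a + w` solves `F a = w`. The iteration uses only group operations
  -- and `F`, so it stays in `G`; with `G` the real points, the preimage is real.
  let u : ℕ → E := fun k => (fun a => a - F a + w)^[k] u₀
  have hsucc : ∀ k, u (k + 1) = u k - F (u k) + w := fun k => by
    simp only [u, Function.iterate_succ_apply']
  -- The steps are bounded by `K ^ k * ((1 - K) * R)`, whose partial sums are `(1 - K ^ k) * R`, so
  -- the iterates never leave the ball on which `hlip` and `hFG` hold.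
  have hinv : ∀ k, u k ∈ G ∧ ‖Λ (u k - u₀)‖ ≤ (1 - K ^ k) * R ∧
      ‖Λ (u (k + 1) - u k)‖ ≤ K ^ k * ((1 - K) * R) := by
    intro k
    induction k with
    | zero =>
      refine ⟨hu₀, by simp [u], ?_⟩
      rw [hsucc]
      have : u 0 - F (u 0) + w - u 0 = w - F u₀ := by simp only [u, Function.iterate_zero, id]; abel
      rw [this]
      simpa using hwR
    | succ k ih =>
      obtain ⟨h1, h2, h3⟩ := ih
      have hKk : 0 ≤ K ^ k := pow_nonneg hK0 k
      have h2' : ‖Λ (u k - u₀)‖ ≤ R := h2.trans (by nlinarith)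
      have h4 : ‖Λ (u (k + 1) - u₀)‖ ≤ (1 - K ^ (k + 1)) * R := by
        have : Λ (u (k + 1) - u₀) = Λ (u (k + 1) - u k) + Λ (u k - u₀) := by
          rw [← map_add]; congr 1; abel
        rw [this]
        refine (norm_add_le _ _).trans ((add_le_add h3 h2).trans_eq ?_)
        ring
      have h4' : ‖Λ (u (k + 1) - u₀)‖ ≤ R :=
        h4.trans (by nlinarith [pow_nonneg hK0 (k + 1)])
      refine ⟨?_, h4, ?_⟩
      · rw [hsucc]
        exact G.add_mem (G.sub_mem h1 (hFG _ h1 h2')) hw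
      · have h5 := hlip _ _ h4' h2'
        have : u (k + 1 + 1) - u (k + 1) =
            -(F (u (k + 1)) - F (u k) - (u (k + 1) - u k)) := by
          have e : w = u (k + 1) - u k + F (u k) := by rw [hsucc k]; abel
          rw [hsucc (k + 1), e]
          abel
        rw [this, map_neg, norm_neg]
        refine h5.trans ?_
        rw [pow_succ]
        nlinarith
  -- The sign of `C` is not assumed; a negative `C` in `hΛ` forces the space to be trivial.
  have hC : 0 ≤ C ∨ ∀ x : E, x = 0 := by
    by_contra! h
    obtain ⟨h1, x, hx⟩ := h
    have := hΛ x
    have h2 := norm_pos_iff.mpr hx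
    nlinarith [norm_nonneg (Λ x)]
  rcases hC with hC | hC
  swap
  · exact ⟨u₀, hu₀, by simpa using hR, by rw [hC (F u₀), hC w]⟩
  have hcau : CauchySeq u := by
    refine cauchySeq_of_le_geometric K (C * ((1 - K) * R)) hK1 fun k => ?_
    rw [dist_comm, dist_eq_norm]
    refine (hΛ _).trans ?_
    have := (hinv k).2.2
    calc C * ‖Λ (u (k + 1) - u k)‖ ≤ C * (K ^ k * ((1 - K) * R)) := by gcongr
      _ = _ := by ring
  obtain ⟨a, ha⟩ := cauchySeq_tendsto_of_complete hcau
  have haR : ‖Λ (a - u₀)‖ ≤ R := by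
    refine le_of_tendsto (((Λ.continuous.tendsto _).comp (ha.sub_const u₀)).norm)
      (Filter.Eventually.of_forall fun k => ?_)
    exact (hinv k).2.1.trans (by nlinarith [pow_nonneg hK0 k])
  refine ⟨a, hG.mem_of_tendsto ha (Filter.Eventually.of_forall fun k => (hinv k).1), haR, ?_⟩
  have hsub : Filter.Tendsto (fun k => u (k + 1) - u k) Filter.atTop (nhds 0) := by
    simpa using ((Filter.tendsto_add_atTop_iff_nat 1).mpr ha).sub ha
  have h1 : Filter.Tendsto (fun k => F (u k)) Filter.atTop (nhds w) := by
    have : (fun k => F (u k)) = fun k => w - (u (k + 1) - u k) := by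
      funext k; rw [hsucc]; abel
    rw [this]
    simpa using hsub.const_sub w
  have h2 : Filter.Tendsto (fun k => F (u k)) Filter.atTop (nhds (F a)) := by
    have hda : Filter.Tendsto (fun k => ‖Λ (u k - a)‖) Filter.atTop (nhds 0) := by
      have := ((Λ.continuous.tendsto _).comp (ha.sub_const a)).norm
      simpa using this
    rw [tendsto_iff_norm_sub_tendsto_zero]
    refine squeeze_zero (g := fun k => C * ((1 + K) * ‖Λ (u k - a)‖)) (fun _ => norm_nonneg _)
      (fun k => (hΛ _).trans ?_) ?_
    · gcongr
      have h3 := hlip (u k) a ((hinv k).2.1.trans (by nlinarith [pow_nonneg hK0 k])) haR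
      have h4 : Λ (F (u k) - F a) = Λ (F (u k) - F a - (u k - a)) + Λ (u k - a) := by
        rw [← map_add]; congr 1; abel
      rw [h4]
      exact (norm_add_le _ _).trans (by linarith)
    · simpa using (hda.const_mul (1 + K)).const_mul C
  exact tendsto_nhds_unique h2 h1

/-- A Cauchy estimate: a map uniformly close to the identity has derivative close to the identity
in the interior. -/
theorem fderiv_near_id_of_near_id {Λ : E →L[ℂ] E'} {C : ℝ} (hΛ : ∀ w, ‖w‖ ≤ C * ‖Λ w‖)
    {F : E → E} {U : Set E} (hF : ∀ w ∈ U, DifferentiableAt ℂ F w) {ε m : ℝ} (hm : 0 < m)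
    (hε : ∀ w ∈ U, ‖Λ (F w - w)‖ ≤ ε) {w : E} (hw : ∀ v, ‖Λ v‖ ≤ m → w + v ∈ U) (u : E) :
    ‖Λ (fderiv ℂ F w u - u)‖ ≤ ε / m * ‖Λ u‖ := by
  rcases eq_or_ne (Λ u) 0 with hu | hu
  · have : u = 0 := by
      have := hΛ u
      rw [hu, norm_zero, mul_zero] at this
      exact norm_le_zero_iff.mp this
    simp [this]
  have hu' : 0 < ‖Λ u‖ := norm_pos_iff.mpr hu
  -- The Cauchy estimate is applied to `F - id` on the complex line through `w` in the direction
  -- `u`; this is the radius of the disc that the margin `m` allows.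
  have hmem : ∀ ζ : ℂ, ‖ζ‖ ≤ m / ‖Λ u‖ → w + ζ • u ∈ U := fun ζ hζ => by
    refine hw _ ?_
    rw [map_smul, norm_smul]
    exact (le_div_iff₀ hu').mp hζ
  have hder : ∀ ζ : ℂ, ‖ζ‖ ≤ m / ‖Λ u‖ →
      HasDerivAt (fun ζ : ℂ => Λ (F (w + ζ • u) - (w + ζ • u)))
        (Λ (fderiv ℂ F (w + ζ • u) u - u)) ζ := by
    intro ζ hζ
    have hl : HasDerivAt (fun ζ : ℂ => w + ζ • u) u ζ := by
      simpa using ((hasDerivAt_id ζ).smul_const u).const_add w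
    exact Λ.hasFDerivAt.comp_hasDerivAt ζ
      (((hF _ (hmem ζ hζ)).hasFDerivAt.comp_hasDerivAt ζ hl).sub hl)
  have hd : DiffContOnCl ℂ (fun ζ : ℂ => Λ (F (w + ζ • u) - (w + ζ • u)))
      (Metric.ball 0 (m / ‖Λ u‖)) := by
    refine DifferentiableOn.diffContOnCl fun ζ hζ => ?_
    have := Metric.closure_ball_subset_closedBall hζ
    exact (hder ζ (by simpa using this)).differentiableAt.differentiableWithinAt
  have h := Complex.norm_deriv_le_of_forall_mem_sphere_norm_le (div_pos hm hu') hd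
    (C := ε) fun ζ hζ => hε _ (hmem ζ (by simpa using (mem_sphere_iff_norm.mp hζ).le))
  rw [(hder 0 (by simp; positivity)).deriv] at h
  simp only [zero_smul, add_zero] at h
  refine h.trans_eq ?_
  field_simp

end

/-! ### Weak solutions of Hamiltonian equations -/

section

variable {E : Type*} [NormedAddCommGroup E] [NormedSpace ℂ E]

/-- Weak solutions of the Hamiltonian equations for the form `B`: continuous curves `w` with
`B (a, w') = dH(w) a` for the directions `a` of the set `V`. -/
structure WeakSolution (B : E →L[ℂ] E →L[ℂ] ℂ) (H : E → ℂ) (V : Set E) (T : Set ℝ) (w : ℝ → E) :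
    Prop where
  cont : ContinuousOn w T
  deriv : ∀ a ∈ V, ∀ t ∈ T, HasDerivWithinAt (fun τ => B a (w τ)) (fderiv ℂ H (w t) a) T t

variable {B : E →L[ℂ] E →L[ℂ] ℂ} {H : E → ℂ} {V : Set E} {T : Set ℝ} {w : ℝ → E}

theorem WeakSolution.mono {T' : Set ℝ} (h : WeakSolution B H V T w) (hT : T' ⊆ T) :
    WeakSolution B H V T' w :=
  ⟨h.cont.mono hT, fun a ha t ht => (h.deriv a ha t (hT ht)).mono hT⟩

/-- The derivative of `B a (w τ)` is `dH (w τ) a`, and `dH` is bounded near `w t`. The constant is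
the same for all directions: the curve is Lipschitz in the dual norm defined by `B`, even where it
is not differentiable in `E`. -/
theorem WeakSolution.norm_le (h : WeakSolution B H V T w) (hT : T.OrdConnected) {t : ℝ}
    (ht : t ∈ T) (hH : ContinuousAt (fderiv ℂ H) (w t)) :
    ∃ C : ℝ, 0 ≤ C ∧ ∀ᶠ τ in nhdsWithin t T, ∀ a ∈ V,
      ‖B a (w τ - w t)‖ ≤ C * |τ - t| * ‖a‖ := by
  have hev : ∀ᶠ τ in nhdsWithin t T, ‖fderiv ℂ H (w τ)‖ < ‖fderiv ℂ H (w t)‖ + 1 :=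
    ((hH.comp_continuousWithinAt (h.cont t ht)).norm).eventually
      (gt_mem_nhds (lt_add_one _))
  obtain ⟨ε, hε, hsub⟩ := Metric.mem_nhdsWithin_iff.mp hev
  refine ⟨‖fderiv ℂ H (w t)‖ + 1, by positivity, ?_⟩
  have hmem : ∀ᶠ τ in nhdsWithin t T, τ ∈ Metric.ball t ε ∩ T :=
    Filter.inter_mem (mem_nhdsWithin_of_mem_nhds (Metric.ball_mem_nhds t hε)) self_mem_nhdsWithin
  filter_upwards [hmem] with τ hτ a ha
  have hconv : Convex ℝ (Metric.ball t ε ∩ T) := (convex_ball t ε).inter hT.convex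
  have := hconv.norm_image_sub_le_of_norm_hasDerivWithin_le (f := fun τ => B a (w τ))
    (f' := fun τ => fderiv ℂ H (w τ) a) (C := (‖fderiv ℂ H (w t)‖ + 1) * ‖a‖)
    (fun τ hτ => (h.deriv a ha τ hτ.2).mono Set.inter_subset_right)
    (fun τ hτ => ((fderiv ℂ H (w τ)).le_opNorm a).trans (by gcongr; exact (hsub hτ).le))
    ⟨Metric.mem_ball_self hε, ht⟩ hτ
  rw [map_sub]
  rw [Real.norm_eq_abs] at this
  linarith

/-- It suffices to test the weak equations on a dense set of directions. -/
theorem WeakSolution.of_dense (h : WeakSolution B H V T w) (hV : Dense V) (hT : T.OrdConnected)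
    (hH : ∀ t ∈ T, ContinuousAt (fderiv ℂ H) (w t)) : WeakSolution B H Set.univ T w := by
  refine ⟨h.cont, fun a _ t ht => ?_⟩
  obtain ⟨C, hC, hev⟩ := h.norm_le hT ht (hH t ht)
  set L := fderiv ℂ H (w t) with hL
  rw [hasDerivWithinAt_iff_isLittleO, Asymptotics.isLittleO_iff]
  intro η hη
  have hM : 0 < C + ‖L‖ + 1 := by positivity
  -- Replacing `a` by `b` costs at most `(C + ‖L‖) * ‖a - b‖ * |τ - t|`, which is half of the
  -- admissible error; the other half is the error of the equation for `b`.
  obtain ⟨b, hbV, hb⟩ := Metric.dense_iff.mp hV a (η / 2 / (C + ‖L‖ + 1)) (by positivity)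
  have hab : ‖a - b‖ ≤ η / 2 / (C + ‖L‖ + 1) := by
    rw [← dist_eq_norm, dist_comm]
    exact (Metric.mem_ball.mp hbV).le
  have h1 := (Asymptotics.isLittleO_iff.mp
    (hasDerivWithinAt_iff_isLittleO.mp (h.deriv b hb t ht))) (half_pos hη)
  filter_upwards [hev, h1] with τ h2 h3
  have h4 : ‖B (a - b) (w τ - w t)‖ ≤ C * |τ - t| * ‖a - b‖ := by
    -- The Lipschitz bound is a closed condition on the direction, so it extends to all of `E`, in
    -- particular to `a - b`.
    have hcl : IsClosed {x : E | ‖B x (w τ - w t)‖ ≤ C * |τ - t| * ‖x‖} :=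
      isClosed_le (by fun_prop) (by fun_prop)
    have : closure V ⊆ {x : E | ‖B x (w τ - w t)‖ ≤ C * |τ - t| * ‖x‖} :=
      hcl.closure_subset_iff.mpr h2
    exact this (hV (a - b))
  have h5 : B a (w τ) - B a (w t) - (τ - t) • L a =
      (B b (w τ) - B b (w t) - (τ - t) • L b) + B (a - b) (w τ - w t) - (τ - t) • L (a - b) := by
    simp only [map_sub, sub_apply, smul_sub]
    ring
  rw [h5]
  refine (norm_sub_le _ _).trans ((add_le_add_left (norm_add_le _ _) _).trans ?_)
  have h6 : ‖(τ - t) • L (a - b)‖ ≤ |τ - t| * (‖L‖ * ‖a - b‖) := by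
    rw [norm_smul, Real.norm_eq_abs]
    gcongr
    exact L.le_opNorm _
  rw [Real.norm_eq_abs] at h3 ⊢
  have h7 : (C + ‖L‖ + 1) * ‖a - b‖ ≤ η / 2 := by
    rw [le_div_iff₀ hM] at hab
    linarith
  have h8 : |τ - t| * ((C + ‖L‖ + 1) * ‖a - b‖) ≤ |τ - t| * (η / 2) := by gcongr
  nlinarith [norm_nonneg (a - b), abs_nonneg (τ - t), mul_nonneg (abs_nonneg (τ - t)) (norm_nonneg (a - b))]

variable {E' : Type*} [NormedAddCommGroup E'] [NormedSpace ℂ E']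

/-- A linear map close to the identity is onto, by the contraction argument with `F = A` started at
`0`; the lower Lipschitz bound controls the solution. -/
theorem exists_fderiv_eq_of_near_id [CompleteSpace E] {Λ : E →L[ℂ] E'} {C : ℝ}
    (hΛ : ∀ w, ‖w‖ ≤ C * ‖Λ w‖) {A : E →L[ℂ] E} {K : ℝ} (hK0 : 0 ≤ K) (hK1 : K < 1)
    (hA : ∀ u, ‖Λ (A u - u)‖ ≤ K * ‖Λ u‖) (v : E) :
    ∃ b, A b = v ∧ (1 - K) * ‖Λ b‖ ≤ ‖Λ v‖ := by
  obtain ⟨b, -, -, hb⟩ := exists_preimage_of_near_id hΛ (F := A) (G := ⊤) isClosed_univ hK0 hK1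
    (u₀ := 0) (R := ‖Λ v‖ / (1 - K)) trivial
    (fun a b _ _ => by
      have := hA (a - b)
      rwa [map_sub A] at this)
    (fun _ _ _ => trivial) (w := v) trivial
    (by
      rw [map_zero, sub_zero, mul_div_cancel₀]
      linarith)
  refine ⟨b, hb, ?_⟩
  have := norm_le_of_norm_sub_sub_le (Λ := Λ) (F := A) (K := K) (a := b) (b := 0)
    (by simpa using hA b)
  simpa [hb] using this

/-- Weak solutions are transported by symplectic maps close to the identity. -/
theorem WeakSolution.pullback [CompleteSpace E] {Λ : E →L[ℂ] E'} {C : ℝ}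
    (hΛ : ∀ w, ‖w‖ ≤ C * ‖Λ w‖) {F : E → E} {U : Set E} (hUo : IsOpen U)
    (hF : AnalyticOnNhd ℂ F U) {K : ℝ} (hK0 : 0 ≤ K) (hK1 : K < 1)
    (hK : ∀ x ∈ U, ∀ u, ‖Λ (fderiv ℂ F x u - u)‖ ≤ K * ‖Λ u‖)
    (hsym : ∀ x ∈ U, ∀ a b, B (fderiv ℂ F x a) (fderiv ℂ F x b) = B a b)
    (h : WeakSolution B H Set.univ T w) (hT : T.OrdConnected)
    (hH : ∀ t ∈ T, AnalyticAt ℂ H (w t)) {u : ℝ → E} (hu : ContinuousOn u T)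
    (huU : ∀ t ∈ T, u t ∈ U) (hFu : ∀ t ∈ T, F (u t) = w t) :
    WeakSolution B (H ∘ F) Set.univ T u := by
  refine ⟨hu, fun e _ t ht => ?_⟩
  obtain ⟨Cw, hCw, hev⟩ := h.norm_le hT ht (hH t ht).fderiv.continuousAt
  have hC : 0 ≤ C ∨ ∀ x : E, x = 0 := by
    by_contra! h
    obtain ⟨h1, x, hx⟩ := h
    have := hΛ x
    have h2 := norm_pos_iff.mpr hx
    nlinarith [norm_nonneg (Λ x)]
  rcases hC with hC | hC
  swap
  · have : ∀ a b : E, B a b = 0 := fun a b => by rw [hC a, map_zero]; rfl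
    simp only [this]
    rw [hC e, map_zero]
    exact hasDerivWithinAt_const _ _ _
  set A := fderiv ℂ F (u t) with hA
  set L := fderiv ℂ H (w t) with hL
  have hcomp : fderiv ℂ (H ∘ F) (u t) = L.comp A := by
    rw [fderiv_comp _ (by rw [hFu t ht]; exact (hH t ht).differentiableAt)
      (hF _ (huU t ht)).differentiableAt, hFu t ht]
  rw [hcomp, ContinuousLinearMap.comp_apply, hasDerivWithinAt_iff_isLittleO,
    Asymptotics.isLittleO_iff]
  intro η hη
  -- the closeness of the derivatives that is needed
  set M := ‖A‖ * Cw with hM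
  have hM0 : 0 ≤ M := by positivity
  -- The bound `1 / 2` allows an absorption in `hdual`; the last bound makes the error from `hkey`
  -- at most half of `η`.
  obtain ⟨η₀, hη₀, hη₁, hη₂⟩ : ∃ η₀ : ℝ, 0 < η₀ ∧ η₀ ≤ 1 / 2 ∧ η₀ * (‖e‖ * (2 * M)) ≤ η / 2 := by
    have hp : 0 < ‖e‖ * (2 * M) + 1 := by positivity
    refine ⟨min (1 / 2) (η / 2 / (‖e‖ * (2 * M) + 1)), by positivity, min_le_left _ _, ?_⟩
    calc _ ≤ η / 2 / (‖e‖ * (2 * M) + 1) * (‖e‖ * (2 * M) + 1) := by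
          gcongr
          · exact min_le_right _ _
          · linarith
      _ = η / 2 := by field_simp
  have hcont : ContinuousAt (fun x => C / (1 - K) * ‖Λ‖ * ‖A - fderiv ℂ F x‖) (u t) := by
    have := (hF _ (huU t ht)).fderiv.continuousAt
    fun_prop
  have hball : ∀ᶠ x in nhds (u t), x ∈ U ∧ C / (1 - K) * ‖Λ‖ * ‖A - fderiv ℂ F x‖ < η₀ := by
    have hU' : ∀ᶠ x in nhds (u t), x ∈ U := hUo.mem_nhds (huU t ht)
    refine hU'.and (hcont.eventually (gt_mem_nhds ?_))
    simpa [hA] using hη₀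
  obtain ⟨ε, hε, hsub⟩ := Metric.mem_nhds_iff.mp hball
  have hnear : ∀ᶠ τ in nhdsWithin t T, u τ ∈ Metric.ball (u t) ε :=
    (hu t ht) (Metric.ball_mem_nhds _ hε)
  have h1 := (Asymptotics.isLittleO_iff.mp
    (hasDerivWithinAt_iff_isLittleO.mp (h.deriv (A e) trivial t ht))) (half_pos hη)
  filter_upwards [hnear, hev, h1, self_mem_nhdsWithin] with τ h2 h3 h4 hτ
  set Δ := u τ - u t with hΔ
  have hseg : ∀ θ ∈ Set.Icc (0 : ℝ) 1, u t + (θ : ℂ) • Δ ∈ Metric.ball (u t) ε := by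
    intro θ hθ
    have := (convex_ball (u t) ε).add_smul_sub_mem (Metric.mem_ball_self hε) h2 hθ
    rwa [RCLike.real_smul_eq_coe_smul (K := ℂ)] at this
  -- On the segment from `u t` to `u τ` the integrand is `B (A v) (DF x Δ) - B v Δ`. By
  -- symplecticity it equals `B b Δ` with `DF x b = (A - DF x) v`, and `b` is small by continuity of
  -- `DF`. The error is thus bounded by the dual norm of `Δ`, not by its norm, for which no
  -- Lipschitz bound in time is available.
  have hkey : ∀ v : E, ‖B (A v) (w τ - w t) - B v Δ‖ ≤ η₀ * ‖v‖ * ‖B.flip Δ‖ := by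
    intro v
    have hline : ∀ θ : ℝ, HasDerivAt (fun θ : ℝ => u t + (θ : ℂ) • Δ) Δ θ := by
      intro θ
      have h := (Complex.ofRealCLM.hasDerivAt (x := θ)).smul_const Δ
      simpa using h.const_add (u t)
    have hder : ∀ θ ∈ Set.Icc (0 : ℝ) 1, HasDerivWithinAt
        (fun θ : ℝ => B (A v) (F (u t + (θ : ℂ) • Δ)) - (θ : ℂ) * B v Δ)
        (B (A v) (fderiv ℂ F (u t + (θ : ℂ) • Δ) Δ) - B v Δ) (Set.Icc 0 1) θ := by
      intro θ hθ
      have h5 := ((hF _ (hsub (hseg θ hθ)).1).differentiableAt.hasFDerivAt.restrictScalars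
        ℝ).comp_hasDerivAt θ (hline θ)
      have h6 := ((B (A v)).restrictScalars ℝ).hasFDerivAt.comp_hasDerivAt θ h5
      have h7 := (Complex.ofRealCLM.hasDerivAt (x := θ)).mul_const (B v Δ)
      have h8 := (h6.sub h7).hasDerivWithinAt (s := Set.Icc 0 1)
      simpa using! h8
    have hbound : ∀ θ ∈ Set.Ico (0 : ℝ) 1,
        ‖B (A v) (fderiv ℂ F (u t + (θ : ℂ) • Δ) Δ) - B v Δ‖ ≤ η₀ * ‖v‖ * ‖B.flip Δ‖ := by
      intro θ hθ
      have hx := hsub (hseg θ ⟨hθ.1, hθ.2.le⟩)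
      set x := u t + (θ : ℂ) • Δ
      obtain ⟨b, hb1, hb2⟩ := exists_fderiv_eq_of_near_id hΛ hK0 hK1 (hK x hx.1)
        ((A - fderiv ℂ F x) v)
      have h5 : B (A v) (fderiv ℂ F x Δ) - B v Δ = B.flip Δ b := by
        rw [← hsym x hx.1 v Δ, ContinuousLinearMap.flip_apply, ← hsym x hx.1 b Δ, hb1]
        simp
      have hb3 : ‖b‖ ≤ η₀ * ‖v‖ := by
        have hK' : 0 < 1 - K := by linarith
        calc ‖b‖ ≤ C * ‖Λ b‖ := hΛ b
          _ ≤ C * (‖Λ ((A - fderiv ℂ F x) v)‖ / (1 - K)) := by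
              gcongr
              rw [le_div_iff₀ hK']
              linarith
          _ ≤ C * ((‖Λ‖ * (‖A - fderiv ℂ F x‖ * ‖v‖)) / (1 - K)) := by
              gcongr
              exact (Λ.le_opNorm _).trans (by gcongr; exact ContinuousLinearMap.le_opNorm _ _)
          _ = C / (1 - K) * ‖Λ‖ * ‖A - fderiv ℂ F x‖ * ‖v‖ := by ring
          _ ≤ η₀ * ‖v‖ := by gcongr; exact hx.2.le
      rw [h5]
      refine ((B.flip Δ).le_opNorm b).trans ?_
      rw [mul_comm]
      gcongr
    have h9 := norm_image_sub_le_of_norm_deriv_le_segment_01' hder hbound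
    have h10 : u t + ((1 : ℝ) : ℂ) • Δ = u τ := by simp [hΔ]
    rw [h10, hFu τ hτ] at h9
    simp only [Complex.ofReal_zero, zero_smul, add_zero, Complex.ofReal_one, one_mul, zero_mul,
      sub_zero, hFu t ht] at h9
    refine le_trans (le_of_eq ?_) h9
    rw [map_sub]
    congr 1
    ring
  -- The Lipschitz bound of `w` in the dual norm passes to `u`: by `hkey` the dual norm of `Δ` is
  -- bounded by `M * |τ - t|` plus at most half of itself.
  have hdual : ‖B.flip Δ‖ ≤ 2 * M * |τ - t| := by
    have h5 : ‖B.flip Δ‖ ≤ M * |τ - t| + η₀ * ‖B.flip Δ‖ := by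
      refine ContinuousLinearMap.opNorm_le_bound _ (by positivity) fun v => ?_
      have h6 := hkey v
      have h7 : ‖B (A v) (w τ - w t)‖ ≤ Cw * |τ - t| * (‖A‖ * ‖v‖) :=
        (h3 (A v) trivial).trans (by gcongr; exact A.le_opNorm v)
      have h8 : B.flip Δ v = B (A v) (w τ - w t) - (B (A v) (w τ - w t) - B v Δ) := by simp
      rw [h8]
      refine (norm_sub_le _ _).trans ((add_le_add h7 h6).trans_eq ?_)
      rw [hM]; ring
    nlinarith [norm_nonneg (B.flip Δ)]
  have h5 : B e (u τ) - B e (u t) - (τ - t) • L (A e) =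
      (B (A e) (w τ) - B (A e) (w t) - (τ - t) • L (A e)) -
        (B (A e) (w τ - w t) - B e Δ) := by
    simp only [hΔ, map_sub]
    ring
  rw [h5]
  refine (norm_sub_le _ _).trans ((add_le_add h4 (hkey e)).trans ?_)
  rw [Real.norm_eq_abs]
  have h6 : η₀ * ‖e‖ * ‖B.flip Δ‖ ≤ η₀ * ‖e‖ * (2 * M * |τ - t|) := by gcongr
  have h7 : η₀ * (‖e‖ * (2 * M)) * |τ - t| ≤ η / 2 * |τ - t| := by gcongr
  linarith

end

/-! ### The scaled norm -/

section

variable {n d : ℕ} {S : Finset (Fin d → ℤ)} {p : ℝ}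

/-- Phase space with the `ℓ¹` combination of the norms of the four factors. -/
abbrev SumPhase (n : ℕ) {d : ℕ} (S : Finset (Fin d → ℤ)) (p : ℝ) : Type :=
  WithLp 1 ((Fin n → ℂ) × WithLp 1 ((Fin n → ℂ) × WithLp 1 (Ell S p × Ell S p)))

/-- The scaling of phase space whose norm is the weighted norm. -/
def scaling (n : ℕ) (S : Finset (Fin d → ℤ)) (p r : ℝ) : Phase n S p →L[ℂ] SumPhase n S p :=
  (WithLp.prodContinuousLinearEquiv 1 ℂ _ _).symm.toContinuousLinearMap.comp
    ((ContinuousLinearMap.fst ℂ _ _).prod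
      ((WithLp.prodContinuousLinearEquiv 1 ℂ _ _).symm.toContinuousLinearMap.comp
        ((((1 / r ^ 2 : ℝ) : ℂ) • ((ContinuousLinearMap.fst ℂ _ _).comp
            (ContinuousLinearMap.snd ℂ _ _))).prod
          ((WithLp.prodContinuousLinearEquiv 1 ℂ _ _).symm.toContinuousLinearMap.comp
            (((1 / r : ℝ) : ℂ) • ((ContinuousLinearMap.snd ℂ _ _).comp
              (ContinuousLinearMap.snd ℂ _ _)))))))

/-- This lets the abstract results on `‖Λ ·‖` be used with the scaled norm, for `Λ = scaling n S p
r`. -/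
theorem norm_scaling {r : ℝ} (hr : 0 < r) (w : Phase n S p) :
    ‖scaling n S p r w‖ = scaledNorm r w := by
  have h1 : ‖((1 / r ^ 2 : ℝ) : ℂ)‖ = 1 / r ^ 2 := by
    rw [Complex.norm_real, Real.norm_of_nonneg (by positivity)]
  have h2 : ‖((1 / r : ℝ) : ℂ)‖ = 1 / r := by
    rw [Complex.norm_real, Real.norm_of_nonneg (by positivity)]
  have h3 : scaling n S p r w = WithLp.toLp 1 (w.1, WithLp.toLp 1
    (((1 / r ^ 2 : ℝ) : ℂ) • w.2.1, WithLp.toLp 1 (((1 / r : ℝ) : ℂ) • w.2.2))) := rfl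
  rw [h3, WithLp.prod_norm_eq_of_L1, WithLp.prod_norm_eq_of_L1, WithLp.prod_norm_eq_of_L1]
  change ‖w.1‖ + (‖((1 / r ^ 2 : ℝ) : ℂ) • w.2.1‖ +
    (‖((1 / r : ℝ) : ℂ) • w.2.2.1‖ + ‖((1 / r : ℝ) : ℂ) • w.2.2.2‖)) = _
  rw [norm_smul, norm_smul, norm_smul, h1, h2, scaledNorm, zNorm]
  ring

theorem zNorm_nonneg (z : Ell S p × Ell S p) : 0 ≤ zNorm z := by
  unfold zNorm; positivity

theorem zNorm_add_le (z z' : Ell S p × Ell S p) : zNorm (z + z') ≤ zNorm z + zNorm z' := by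
  unfold zNorm
  have h1 := norm_add_le z.1 z'.1
  have h2 := norm_add_le z.2 z'.2
  simp only [Prod.fst_add, Prod.snd_add]
  linarith

theorem scaledNorm_nonneg {r : ℝ} (hr : 0 < r) (w : Phase n S p) : 0 ≤ scaledNorm r w := by
  rw [← norm_scaling hr]; exact norm_nonneg _

theorem norm_fst_le_scaledNorm {r : ℝ} (hr : 0 < r) (w : Phase n S p) :
    ‖w.1‖ ≤ scaledNorm r w := by
  have := zNorm_nonneg w.2.2
  have h1 : 0 ≤ ‖w.2.1‖ / r ^ 2 := by positivity
  have h2 : 0 ≤ zNorm w.2.2 / r := by positivity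
  unfold scaledNorm
  linarith

theorem norm_y_le_scaledNorm {r : ℝ} (hr : 0 < r) (w : Phase n S p) :
    ‖w.2.1‖ ≤ r ^ 2 * scaledNorm r w := by
  have := zNorm_nonneg w.2.2
  have h2 : 0 ≤ zNorm w.2.2 / r := by positivity
  have h3 : ‖w.2.1‖ / r ^ 2 ≤ scaledNorm r w := by
    unfold scaledNorm
    linarith [norm_nonneg w.1]
  rw [div_le_iff₀ (by positivity)] at h3
  linarith

theorem zNorm_le_scaledNorm {r : ℝ} (hr : 0 < r) (w : Phase n S p) :
    zNorm w.2.2 ≤ r * scaledNorm r w := by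
  have h1 : 0 ≤ ‖w.2.1‖ / r ^ 2 := by positivity
  have h3 : zNorm w.2.2 / r ≤ scaledNorm r w := by
    unfold scaledNorm
    linarith [norm_nonneg w.1]
  rw [div_le_iff₀ hr] at h3
  linarith

theorem norm_le_scaledNorm {r : ℝ} (hr : 0 < r) (hr1 : r ≤ 1) (w : Phase n S p) :
    ‖w‖ ≤ 1 * ‖scaling n S p r w‖ := by
  have h0 := scaledNorm_nonneg hr w
  have h1 := norm_fst_le_scaledNorm hr w
  have h2 := norm_y_le_scaledNorm hr w
  have h3 := zNorm_le_scaledNorm hr w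
  have h4 : r ^ 2 ≤ 1 := pow_le_one₀ hr.le hr1
  rw [norm_scaling hr, one_mul]
  unfold zNorm at h3
  refine norm_prod_le_iff.mpr ⟨h1, norm_prod_le_iff.mpr ⟨by nlinarith, norm_prod_le_iff.mpr
    ⟨?_, ?_⟩⟩⟩
  · nlinarith [norm_nonneg w.2.2.2]
  · nlinarith [norm_nonneg w.2.2.1]

/-! ### The neighbourhoods of the torus and the real points -/

theorem isOpen_Dom {s r : ℝ} : IsOpen (Dom n S p s r) := by
  have h1 : Continuous fun w : Phase n S p => ‖fun i => (w.1 i).im‖ := by fun_prop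
  have h2 : Continuous fun w : Phase n S p => ‖w.2.1‖ := by fun_prop
  have h3 : Continuous fun w : Phase n S p => zNorm w.2.2 := by unfold zNorm; fun_prop
  exact (isOpen_lt h1 continuous_const).inter
    ((isOpen_lt h2 continuous_const).inter (isOpen_lt h3 continuous_const))

theorem convex_Dom {s r : ℝ} : Convex ℝ (Dom n S p s r) := by
  intro u hu v hv a b ha hb hab
  have key : ∀ {x y x' c : ℝ}, x < c → y < c → x' ≤ a * x + b * y → x' < c := by
    intro x y x' c hx hy h
    refine h.trans_lt ?_
    rcases ha.eq_or_lt with rfl | ha'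
    · have : b = 1 := by linarith
      subst this; linarith
    · have h1 : a * c + b * c = c := by rw [← add_mul, hab, one_mul]
      have h2 := mul_lt_mul_of_pos_left hx ha'
      have h3 := mul_le_mul_of_nonneg_left hy.le hb
      linarith
  have hz : ∀ (c : ℝ), 0 ≤ c → ∀ z : Ell S p × Ell S p, zNorm (c • z) = c * zNorm z := by
    intro c hc z
    simp only [zNorm, Prod.smul_fst, Prod.smul_snd, norm_smul, Real.norm_of_nonneg hc]
    ring
  refine ⟨key hu.1 hv.1 ?_, key hu.2.1 hv.2.1 ?_,
    key hu.2.2 hv.2.2 ?_⟩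
  · have : (fun i => ((a • u + b • v).1 i).im) =
        a • (fun i => (u.1 i).im) + b • (fun i => (v.1 i).im) := by
      funext i; simp
    rw [this]
    refine (norm_add_le _ _).trans_eq ?_
    rw [norm_smul, norm_smul, Real.norm_of_nonneg ha, Real.norm_of_nonneg hb]
  · refine (norm_add_le _ _).trans_eq ?_
    simp only [Prod.smul_fst, Prod.smul_snd]
    rw [norm_smul, norm_smul, Real.norm_of_nonneg ha, Real.norm_of_nonneg hb]
  · refine (zNorm_add_le _ _).trans_eq ?_
    simp only [Prod.smul_snd]
    rw [hz a ha, hz b hb]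

/-- The real points form a subgroup. -/
def realPts (n : ℕ) (S : Finset (Fin d → ℤ)) (p : ℝ) : AddSubgroup (Phase n S p) where
  carrier := {w | IsRealPt w}
  zero_mem' := ⟨fun _ => rfl, fun _ => rfl, fun _ => by simp⟩
  add_mem' := by
    rintro a b ⟨h1, h2, h3⟩ ⟨h4, h5, h6⟩
    exact ⟨fun i => by simp [h1, h4], fun i => by simp [h2, h5], fun j => by simp [h3, h6]⟩
  neg_mem' := by
    rintro a ⟨h1, h2, h3⟩
    exact ⟨fun i => by simp [h1], fun i => by simp [h2], fun j => by simp [h3]⟩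

theorem isClosed_realPts (hp : 0 ≤ p) : IsClosed (realPts n S p : Set (Phase n S p)) := by
  have h1 : IsClosed {w : Phase n S p | ∀ i, (w.1 i).im = 0} := by
    simp only [Set.ofPred_forall]
    exact isClosed_iInter fun i => isClosed_eq (by fun_prop) continuous_const
  have h2 : IsClosed {w : Phase n S p | ∀ i, (w.2.1 i).im = 0} := by
    simp only [Set.ofPred_forall]
    exact isClosed_iInter fun i => isClosed_eq (by fun_prop) continuous_const
  have h3 : IsClosed {w : Phase n S p | ∀ j, w.2.2.2.coord j = star (w.2.2.1.coord j)} := by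
    simp only [Set.ofPred_forall]
    refine isClosed_iInter fun j => isClosed_eq ?_ ?_
    · exact (Ell.coordL hp j).continuous.comp (by fun_prop)
    · exact continuous_star.comp ((Ell.coordL hp j).continuous.comp (by fun_prop))
  exact h1.inter (h2.inter h3)

theorem IsRealPt.im_eq_zero {w : Phase n S p} (hw : IsRealPt w) :
    (fun i => (w.1 i).im) = 0 := funext hw.1

theorem IsRealPt.norm_eq {w : Phase n S p} (hw : IsRealPt w) : ‖w.2.2.2‖ = ‖w.2.2.1‖ := by
  rw [← sq_eq_sq₀ (norm_nonneg _) (norm_nonneg _), Ell.norm_sq, Ell.norm_sq]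
  simp only [hw.2.2, norm_star]

theorem mem_Dom_of_real {s r : ℝ} (hs : 0 < s) {w : Phase n S p} (hw : IsRealPt w)
    (hy : ‖w.2.1‖ < r ^ 2) (hz : zNorm w.2.2 < r) : w ∈ Dom n S p s r :=
  ⟨by rw [hw.im_eq_zero, norm_zero]; exact hs, hy, hz⟩

theorem Dom_mono {s s' r r' : ℝ} (hs : s ≤ s') (hr0 : 0 ≤ r) (hr : r ≤ r') :
    Dom n S p s r ⊆ Dom n S p s' r' := fun _ hw =>
  ⟨hw.1.trans_le hs, hw.2.1.trans_le (by gcongr), hw.2.2.trans_le hr⟩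

/-! ### Solutions as weak solutions -/

theorem dense_span_coordDirs :
    Dense (Submodule.span ℂ (coordDirs n S p) : Set (Phase n S p)) :=
  (Submodule.dense_iff_topologicalClosure_eq_top).mpr closure_span_coordDirs

theorem tsum_unit_mul (j : Site S) (f : Site S → ℂ) :
    ∑' i, (Ell.unit p j).coord i * f i = f j := by
  rw [tsum_eq_single j]
  · simp [Ell.coord_unit]
  · intro i hi
    simp [Ell.coord_unit, Pi.single_eq_of_ne hi]

theorem sympl_eX (i : Fin n) (w : Phase n S p) : sympl (eX i) w = -w.2.1 i := by
  simp [sympl, eX, Pi.single_apply]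

theorem sympl_eY (i : Fin n) (w : Phase n S p) : sympl (eY i) w = w.1 i := by
  simp [sympl, eY, Pi.single_apply]

theorem sympl_eQ (j : Site S) (w : Phase n S p) :
    sympl (eQ j) w = Complex.I * w.2.2.2.coord j := by
  simp [sympl, eQ, tsum_unit_mul]

theorem sympl_eQbar (j : Site S) (w : Phase n S p) :
    sympl (eQbar j) w = -Complex.I * w.2.2.1.coord j := by
  have := tsum_unit_mul (p := p) j fun i => w.2.2.1.coord i
  simp [sympl, eQbar, tsum_neg, this]

/-- A solution satisfies the weak equations. -/
theorem IsSolution.weakSolution (hp : 0 ≤ p) {H : Phase n S p → ℂ} {D : Set (Phase n S p)}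
    {T : Set ℝ} {w : ℝ → Phase n S p} (h : IsSolution H D T w) (hT : T.OrdConnected)
    (hH : AnalyticOnNhd ℂ H D) : WeakSolution (symplB n S hp) H Set.univ T w := by
  -- The coordinate equations are the weak equations in the coordinate directions; they hold on the
  -- span by linearity and everywhere by density.
  refine WeakSolution.of_dense (V := Submodule.span ℂ (coordDirs n S p)) ⟨h.cont, ?_⟩
    dense_span_coordDirs hT fun t ht => (hH _ (h.mem t ht)).fderiv.continuousAt
  intro a ha t ht
  induction ha using Submodule.span_induction with
  | mem a ha =>
    simp only [symplB_apply]
    rcases ha with ((⟨i, rfl⟩ | ⟨i, rfl⟩) | ⟨j, rfl⟩) | ⟨j, rfl⟩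
    · simp only [sympl_eX]
      have := (h.eq_y t ht i).neg
      rwa [neg_neg] at this
    · simp only [sympl_eY]
      exact h.eq_x t ht i
    · simp only [sympl_eQ]
      have := (h.eq_qbar t ht j).const_mul Complex.I
      rwa [← mul_assoc, mul_neg, Complex.I_mul_I, neg_neg, one_mul] at this
    · simp only [sympl_eQbar]
      have := (h.eq_q t ht j).const_mul (-Complex.I)
      rwa [← mul_assoc, neg_mul, Complex.I_mul_I, neg_neg, one_mul] at this
  | zero => simpa using hasDerivWithinAt_const t T (0 : ℂ)
  | add a b _ _ iha ihb =>
    simp only [map_add]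
    exact iha.add ihb
  | smul c a _ iha =>
    simp only [map_smul]
    exact iha.const_smul c

section

variable {K : Phase n S p → ℂ} {T : Set ℝ} {u : ℝ → Phase n S p}

theorem WeakSolution.hasDerivWithinAt_y (hp : 0 ≤ p)
    (h : WeakSolution (symplB n S hp) K Set.univ T u) {t : ℝ} (ht : t ∈ T) (i : Fin n) :
    HasDerivWithinAt (fun τ => (u τ).2.1 i) (-fderiv ℂ K (u t) (eX i)) T t := by
  have := (h.deriv (eX i) trivial t ht).const_mul (-1)
  simpa only [symplB_apply, sympl_eX, neg_mul, one_mul, neg_neg] using this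

theorem WeakSolution.hasDerivWithinAt_q (hp : 0 ≤ p)
    (h : WeakSolution (symplB n S hp) K Set.univ T u) {t : ℝ} (ht : t ∈ T) (j : Site S) :
    HasDerivWithinAt (fun τ => (u τ).2.2.1.coord j)
      (Complex.I * fderiv ℂ K (u t) (eQbar j)) T t := by
  have := (h.deriv (eQbar j) trivial t ht).const_mul Complex.I
  simp only [symplB_apply, sympl_eQbar, ← mul_assoc, mul_neg, Complex.I_mul_I, neg_neg,
    one_mul] at this
  exact this

theorem WeakSolution.hasDerivWithinAt_qbar (hp : 0 ≤ p)
    (h : WeakSolution (symplB n S hp) K Set.univ T u) {t : ℝ} (ht : t ∈ T) (j : Site S) :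
    HasDerivWithinAt (fun τ => (u τ).2.2.2.coord j)
      (-Complex.I * fderiv ℂ K (u t) (eQ j)) T t := by
  have := (h.deriv (eQ j) trivial t ht).const_mul (-Complex.I)
  simp only [symplB_apply, sympl_eQ, ← mul_assoc, neg_mul, Complex.I_mul_I, neg_neg,
    one_mul] at this
  simpa only [neg_mul] using this

end

end

/-! ### Tuples and multi-indices -/

section

variable {n d : ℕ} {S : Finset (Fin d → ℤ)} {p : ℝ}

theorem prod_tupleCount {M : Type*} [CommMonoid M] (f : Idx S → M) {m : ℕ} (t : Fin m → Idx S) :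
    (tupleCount t).prod (fun j e => f j ^ e) = ∏ i, f (t i) := by
  classical
  rw [tupleCount, ← Finsupp.prod_finsetSum_index (fun _ => pow_zero _) fun _ _ _ => pow_add _ _ _]
  exact Finset.prod_congr rfl fun i _ => by simp

/-- A multi-index is the count of as many tuples as its multinomial coefficient says. -/
theorem card_filter_tupleCount [DecidableEq (Idx S)] (b : Idx S →₀ ℕ) :
    ((Fintype.piFinset fun _ : Fin (b.sum fun _ e => e) => b.support).filter
      fun t => tupleCount t = b).card = b.multinomial := by
  have : DecidableEq (Idx S → ℕ) := Classical.decEq _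
  set m := b.sum fun _ e => e with hm
  have h1 := Finset.sum_pow' b.support (fun i => (MvPolynomial.X i : MvPolynomial (Idx S) ℕ)) m
  have h2 := Finset.sum_pow_eq_sum_piAntidiag b.support
    (fun i => (MvPolynomial.X i : MvPolynomial (Idx S) ℕ)) m
  -- The power `(∑ X i) ^ m` is expanded over tuples and over multi-indices. The coefficient of `X ^
  -- b` counts the tuples on one side and is the multinomial coefficient on the other.
  have h3 := congrArg (MvPolynomial.coeff b) (h1.symm.trans h2)
  rw [MvPolynomial.coeff_sum, MvPolynomial.coeff_sum] at h3
  have h4 : ∀ t : Fin m → Idx S, MvPolynomial.coeff b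
      (∏ i, (MvPolynomial.X (t i) : MvPolynomial (Idx S) ℕ)) =
        if tupleCount t = b then 1 else 0 := by
    intro t
    have : (∏ i, (MvPolynomial.X (t i) : MvPolynomial (Idx S) ℕ)) =
        MvPolynomial.monomial (tupleCount t) 1 := by
      rw [tupleCount, MvPolynomial.monomial_sum_one]
      rfl
    rw [this, MvPolynomial.coeff_monomial]
  have h5 : ∀ k ∈ b.support.piAntidiag m, MvPolynomial.coeff b
      (((Nat.multinomial b.support k : ℕ) : MvPolynomial (Idx S) ℕ) *
        ∏ i ∈ b.support, (MvPolynomial.X i : MvPolynomial (Idx S) ℕ) ^ k i) =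
        if k = b then b.multinomial else 0 := by
    intro k hk
    have hsupp : ∀ i, k i ≠ 0 → i ∈ b.support := (Finset.mem_piAntidiag.mp hk).2
    have h6 : (∏ i ∈ b.support, (MvPolynomial.X i : MvPolynomial (Idx S) ℕ) ^ k i) =
        MvPolynomial.monomial (Finsupp.onFinset b.support k hsupp) 1 := by
      rw [MvPolynomial.monomial_eq, MvPolynomial.C_1, one_mul,
        Finsupp.onFinset_prod _ fun _ => pow_zero _]
    rw [h6, ← map_natCast MvPolynomial.C, MvPolynomial.coeff_C_mul, MvPolynomial.coeff_monomial]
    by_cases hkb : k = b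
    · have : Finsupp.onFinset b.support k hsupp = b := by ext i; simp [hkb]
      rw [if_pos this, if_pos hkb, hkb, Finsupp.multinomial_eq]
      simp
    · rw [if_neg hkb, if_neg, mul_zero]
      intro h
      exact hkb (by rw [← h]; rfl)
  rw [Finset.sum_congr rfl fun t _ => h4 t, Finset.sum_congr rfl h5, Finset.sum_ite_eq',
    if_pos, Finset.sum_boole, Nat.cast_id] at h3
  · exact h3
  · rw [Finset.mem_piAntidiag]
    exact ⟨rfl, fun i hi => by simpa using hi⟩

/-- A power series in `z`, summed over multi-indices, is bounded by the sum over tuples. -/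
theorem tsum_multiIndex_le (A : (Idx S →₀ ℕ) → ℝ≥0∞) (f : Idx S → ℝ≥0∞) :
    ∑' b : Idx S →₀ ℕ, A b * b.prod (fun j e => f j ^ e) ≤
      ∑' m : ℕ, ∑' t : Fin m → Idx S,
        A (tupleCount t) / ((tupleCount t).multinomial : ℝ≥0∞) * ∏ i, f (t i) := by
  classical
  set g : (m : ℕ) → (Fin m → Idx S) → ℝ≥0∞ := fun m t =>
    A (tupleCount t) / ((tupleCount t).multinomial : ℝ≥0∞) * ∏ i, f (t i) with hg
  have h1 : ∑' m : ℕ, ∑' t : Fin m → Idx S, g m t =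
      ∑' b : Idx S →₀ ℕ, ∑' m : ℕ, ∑' t : Fin m → Idx S,
        if b = tupleCount t then g m t else 0 := by
    rw [ENNReal.tsum_comm]
    refine tsum_congr fun m => ?_
    rw [ENNReal.tsum_comm]
    exact tsum_congr fun t => (tsum_ite_eq (tupleCount t) fun _ => g m t).symm
  rw [h1]
  refine ENNReal.tsum_le_tsum fun b => ?_
  -- Only the tuples of length `|b|` with entries in the support of `b` are kept; those with count
  -- `b` already suffice to cancel the division by the multinomial coefficient.
  refine le_trans ?_ (ENNReal.le_tsum (b.sum fun _ e => e))
  refine le_trans ?_ (ENNReal.sum_le_tsum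
    ((Fintype.piFinset fun _ : Fin (b.sum fun _ e => e) => b.support).filter
      fun t => tupleCount t = b))
  have h2 : ∀ t ∈ (Fintype.piFinset fun _ : Fin (b.sum fun _ e => e) => b.support).filter
      (fun t => tupleCount t = b), (if b = tupleCount t then g _ t else 0) =
        A b / (b.multinomial : ℝ≥0∞) * b.prod fun j e => f j ^ e := by
    intro t ht
    have := (Finset.mem_filter.mp ht).2
    rw [if_pos this.symm, hg]
    simp only
    rw [← prod_tupleCount, this]
  rw [Finset.sum_congr rfl h2, Finset.sum_const, card_filter_tupleCount, nsmul_eq_mul, ← mul_assoc,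
    ENNReal.mul_div_cancel]
  · exact_mod_cast (Nat.multinomial_pos b.support b).ne'
  · exact ENNReal.natCast_ne_top _

/-! ### Majorants of series -/

/-- The sum of the moduli of the terms of a series on `‖Im x‖ < s`, `‖y‖ < r²`. -/
def Coeff.majorant (a : Coeff n S) (s r : ℝ) (F : Idx S → ℂ) : ℝ≥0∞ :=
  ∑' b : Idx S →₀ ℕ, a.xyNorm s r b * b.prod fun j e => ‖F j‖ₑ ^ e

theorem Coeff.majorant_le (a : Coeff n S) (s r : ℝ) (F : Idx S → ℂ) :
    a.majorant s r F ≤ ∑' m : ℕ, a.modForm s r fun _ : Fin m => F :=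
  tsum_multiIndex_le _ _

theorem Coeff.modForm_zero (a : Coeff n S) (s r : ℝ) {m : ℕ} (hm : m ≠ 0) {F : Idx S → ℂ}
    (hF : F = 0) : a.modForm s r (fun _ : Fin m => F) = 0 := by
  subst hF
  have : Nonempty (Fin m) := ⟨⟨0, Nat.pos_of_ne_zero hm⟩⟩
  simp only [Coeff.modForm, Pi.zero_apply, enorm_zero, Finset.prod_const, Finset.card_univ,
    Fintype.card_fin, zero_pow hm, mul_zero, tsum_zero]

/-! ### Weighted norms with values in `[0, ∞]` -/

theorem bNorm_mono {p p' : ℝ} (hp : p ≤ p') (f : Idx S → ℝ≥0∞) : bNorm p f ≤ bNorm p' f := by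
  unfold bNorm
  gcongr with j j <;> exact one_le_wt _

theorem eq_zero_of_cNorm_eq_zero {F : Idx S → ℂ} (h : cNorm p F = 0) : F = 0 := by
  have hw : ∀ j : Site S, ENNReal.ofReal (wt j.1 ^ p) ≠ 0 := fun j => by
    rw [Ne, ENNReal.ofReal_eq_zero, not_le]
    exact Real.rpow_pos_of_pos (wt_pos _) _
  rw [cNorm, bNorm, add_eq_zero, ENNReal.rpow_eq_zero_iff_of_pos (by norm_num),
    ENNReal.rpow_eq_zero_iff_of_pos (by norm_num), ENNReal.tsum_eq_zero, ENNReal.tsum_eq_zero] at h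
  funext j
  rcases j with j | j
  · simpa [hw j] using h.1 j
  · simpa [hw j] using h.2 j

theorem mixedNorm_const (p p' : ℝ) {m : ℕ} (F : Idx S → ℂ) :
    mixedNorm p p' (fun _ : Fin (m + 1) => F) = cNorm p F * cNorm p' F ^ m := by
  simp only [mixedNorm, Nat.succ_ne_zero, if_false, Finset.prod_const, Finset.card_erase_of_mem,
    Finset.mem_univ, Finset.card_univ, Fintype.card_fin, Finset.sum_const, nsmul_eq_mul,
    Nat.add_sub_cancel]
  rw [mul_comm, ENNReal.mul_div_cancel_right]
  · exact_mod_cast Nat.succ_ne_zero m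
  · exact ENNReal.natCast_ne_top _

/-- The gradient in `z` on the diagonal. -/
theorem Coeff.bNorm_modForm_dz_le (a : Coeff n S) {s r p' : ℝ} (p'' : ℝ)
    {F : Idx S → ℂ} {R L : ℝ≥0∞} (hR : R ≠ ⊤) (hL : 1 ≤ L) (hLtop : L ≠ ⊤)
    (hFp : cNorm p F ≤ L * R) (hFd : cNorm p' F ≤ R) (m : ℕ) :
    bNorm p'' (fun j => (a.dz j).modForm s r fun _ : Fin m => F) ≤
      a.gradZNorm s r p p' p'' m * (L * R ^ m) := by
  -- Without arguments the mixed norm is `1` and `1 ≤ L` is used. Otherwise the diagonal mixed norm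
  -- has exactly one factor in the `p`-norm, so `L` enters only once.
  rcases m with _ | m
  · have h := le_iSup (fun u : {u : Fin 0 → Idx S → ℂ //
        ∀ i, cNorm p (u i) ≠ 0 ∧ cNorm p (u i) ≠ ⊤} =>
      bNorm p'' (fun j => (a.dz j).modForm s r u.1) / mixedNorm p p' u.1)
      ⟨fun _ => F, fun i => i.elim0⟩
    have h1 : mixedNorm p p' (fun _ : Fin 0 => F) = 1 := by simp [mixedNorm]
    simp only [h1, div_one] at h
    refine h.trans ?_
    rw [pow_zero, mul_one]
    exact le_mul_of_one_le_right zero_le hL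
  · have htop : cNorm p F ≠ ⊤ := ne_top_of_le_ne_top (ENNReal.mul_ne_top hLtop hR) hFp
    rcases eq_or_ne (cNorm p F) 0 with h0 | h0
    · have hF := eq_zero_of_cNorm_eq_zero h0
      simp [Coeff.modForm_zero _ _ _ (Nat.succ_ne_zero m) hF, bNorm]
    have h := le_iSup (fun u : {u : Fin (m + 1) → Idx S → ℂ //
        ∀ i, cNorm p (u i) ≠ 0 ∧ cNorm p (u i) ≠ ⊤} =>
      bNorm p'' (fun j => (a.dz j).modForm s r u.1) / mixedNorm p p' u.1)
      ⟨fun _ => F, fun i => ⟨h0, htop⟩⟩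
    simp only [mixedNorm_const] at h
    have h0' : cNorm p' F ≠ 0 := fun h' => h0 (by
      rw [eq_zero_of_cNorm_eq_zero h']; simp [cNorm, bNorm])
    have htop' : cNorm p' F ≠ ⊤ := ne_top_of_le_ne_top hR hFd
    rw [ENNReal.div_le_iff_le_mul (Or.inl (mul_ne_zero h0 (pow_ne_zero _ h0')))
      (Or.inl (ENNReal.mul_ne_top htop (ENNReal.pow_ne_top htop')))] at h
    refine h.trans ?_
    rw [pow_succ', ← mul_assoc L]
    unfold Coeff.gradZNorm
    gcongr

theorem iSup_modForm_le (a : Fin n → Coeff n S) {s r : ℝ} {F : Idx S → ℂ} {R : ℝ≥0∞}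
    (hR : R ≠ ⊤) (hF : cNorm p F ≤ R) (h : ℕ) (i : Fin n) :
    (a i).modForm s r (fun _ : Fin h => F) ≤ gradVNorm a s r p h * R ^ h := by
  rcases h with _ | m
  · have h := le_iSup (fun u : {u : Fin 0 → Idx S → ℂ //
        ∀ i, cNorm p (u i) ≠ 0 ∧ cNorm p (u i) ≠ ⊤} =>
      (⨆ i, (a i).modForm s r u.1) / mixedNorm p p u.1) ⟨fun _ => F, fun i => i.elim0⟩
    have h1 : mixedNorm p p (fun _ : Fin 0 => F) = 1 := by simp [mixedNorm]
    simp only [h1, div_one] at h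
    rw [pow_zero, mul_one]
    exact (le_iSup (fun i => (a i).modForm s r (fun _ : Fin 0 => F)) i).trans h
  · have htop : cNorm p F ≠ ⊤ := ne_top_of_le_ne_top hR hF
    rcases eq_or_ne (cNorm p F) 0 with h0 | h0
    · have hF := eq_zero_of_cNorm_eq_zero h0
      simp [Coeff.modForm_zero _ _ _ (Nat.succ_ne_zero m) hF]
    have h := le_iSup (fun u : {u : Fin (m + 1) → Idx S → ℂ //
        ∀ i, cNorm p (u i) ≠ 0 ∧ cNorm p (u i) ≠ ⊤} =>
      (⨆ i, (a i).modForm s r u.1) / mixedNorm p p u.1) ⟨fun _ => F, fun i => ⟨h0, htop⟩⟩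
    simp only [mixedNorm_const] at h
    rw [← pow_succ', ENNReal.div_le_iff_le_mul (Or.inl (pow_ne_zero _ h0))
      (Or.inl (ENNReal.pow_ne_top htop))] at h
    refine (le_iSup (fun i => (a i).modForm s r (fun _ : Fin (m + 1) => F)) i).trans (h.trans ?_)
    unfold gradVNorm
    gcongr

/-- The index `m` of the gradient is the degree `m + 1` in `z`, and the tame norm carries a factor
`1 / r` in front of the `z`-part, which gives the `r` on the right. -/
theorem Coeff.tsum_gradZNorm_le (a : Coeff n S) (p s : ℝ) {r : ℝ} (hr : 0 < r) :
    ∑' m : ℕ, a.gradZNorm s r p d (p + 2) m * ENNReal.ofReal r ^ m ≤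
      ENNReal.ofReal r * a.tameNorm p s r := by
  have h1 : ∑' m : ℕ, a.gradZNorm s r p d (p + 2) m * ENNReal.ofReal r ^ m ≤
      ∑' h : ℕ, a.tameZ p s r h := by
    refine le_trans (ENNReal.tsum_le_tsum fun m => ?_)
      (ENNReal.tsum_comp_le_tsum_of_injective Nat.succ_injective (a.tameZ p s r))
    rw [Coeff.tameZ, ENNReal.ofReal_pow hr.le]
    gcongr
    exact le_max_left _ _
  have h2 : ENNReal.ofReal (1 / r) * ∑' h : ℕ, a.tameZ p s r h ≤ a.tameNorm p s r := by
    rw [← ENNReal.tsum_mul_left]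
    exact ENNReal.tsum_le_tsum fun h => self_le_add_left _ _
  refine h1.trans (le_trans (le_of_eq ?_) (mul_le_mul_right h2 (ENNReal.ofReal r)))
  rw [← mul_assoc, ← ENNReal.ofReal_mul hr.le, mul_one_div_cancel hr.ne', ENNReal.ofReal_one,
    one_mul]

theorem Coeff.tsum_gradVNorm_dx_le (a : Coeff n S) (p s : ℝ) {r : ℝ} (hr : 0 < r) :
    ∑' h : ℕ, gradVNorm a.dx s r d h * ENNReal.ofReal r ^ h ≤
      ENNReal.ofReal (r ^ 2) * a.tameNorm p s r := by
  have h2 : ENNReal.ofReal (1 / r ^ 2) * ∑' h : ℕ, gradVNorm a.dx s r d h * ENNReal.ofReal r ^ h ≤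
      a.tameNorm p s r := by
    rw [← ENNReal.tsum_mul_left]
    refine ENNReal.tsum_le_tsum fun h => ?_
    rw [← ENNReal.ofReal_pow hr.le]
    exact (self_le_add_left _ _).trans (self_le_add_right _ _)
  refine le_trans (le_of_eq ?_) (mul_le_mul_right h2 (ENNReal.ofReal (r ^ 2)))
  rw [← mul_assoc, ← ENNReal.ofReal_mul (by positivity), mul_one_div_cancel (by positivity),
    ENNReal.ofReal_one, one_mul]

/-- The derivatives in `x`. -/
theorem Coeff.majorant_dx_le (a : Coeff n S) (p s : ℝ) {r : ℝ} (hr : 0 < r) {F : Idx S → ℂ}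
    (hF : cNorm (d : ℝ) F ≤ ENNReal.ofReal r) (i : Fin n) :
    (a.dx i).majorant s r F ≤ ENNReal.ofReal (r ^ 2) * a.tameNorm p s r := by
  refine ((a.dx i).majorant_le s r F).trans (le_trans ?_ (a.tsum_gradVNorm_dx_le p s hr))
  exact ENNReal.tsum_le_tsum fun h => iSup_modForm_le a.dx ENNReal.ofReal_ne_top hF h i

theorem tsum_mul_le_l2 {ι : Type*} (f g : ι → ℝ≥0∞) :
    ∑' j, f j * g j ≤ (∑' j, f j ^ 2) ^ (1 / 2 : ℝ) * (∑' j, g j ^ 2) ^ (1 / 2 : ℝ) := by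
  rw [ENNReal.tsum_eq_iSup_sum]
  refine iSup_le fun s => ?_
  have h := ENNReal.inner_le_Lp_mul_Lq s f g Real.HolderConjugate.two_two
  simp only [ENNReal.rpow_two] at h
  refine h.trans ?_
  gcongr <;> exact ENNReal.sum_le_tsum s

/-- The pairing of the gradient in `z` with the weighted sequence itself. -/
theorem Coeff.tsum_majorant_dz_le (a : Coeff n S) (s : ℝ) {r : ℝ} (hr : 0 < r)
    {F : Idx S → ℂ} {L : ℝ≥0∞} (hL : 1 ≤ L) (hLtop : L ≠ ⊤)
    (hFp : cNorm p F ≤ L * ENNReal.ofReal r) (hFd : cNorm (d : ℝ) F ≤ ENNReal.ofReal r)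
    (g : Site S → ℝ≥0∞) :
    ∑' j : Site S, ENNReal.ofReal (wt j.1 ^ p) ^ 2 * g j *
        ((a.dz (Sum.inl j)).majorant s r F + (a.dz (Sum.inr j)).majorant s r F) ≤
      (∑' j : Site S, (ENNReal.ofReal (wt j.1 ^ p) * g j) ^ 2) ^ (1 / 2 : ℝ) *
        (L * (ENNReal.ofReal r * a.tameNorm p s r)) := by
  set w : Site S → ℝ≥0∞ := fun j => ENNReal.ofReal (wt j.1 ^ p) with hw
  set Q := (∑' j : Site S, (w j * g j) ^ 2) ^ (1 / 2 : ℝ) with hQ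
  set G : ℕ → Idx S → ℝ≥0∞ := fun m j => (a.dz j).modForm s r fun _ : Fin m => F with hG
  calc ∑' j : Site S, w j ^ 2 * g j *
        ((a.dz (Sum.inl j)).majorant s r F + (a.dz (Sum.inr j)).majorant s r F)
      ≤ ∑' j : Site S, ∑' m : ℕ, ((w j * g j) * (w j * G m (Sum.inl j)) +
          (w j * g j) * (w j * G m (Sum.inr j))) := by
        refine ENNReal.tsum_le_tsum fun j => ?_
        refine (mul_le_mul_right (add_le_add (Coeff.majorant_le _ s r F)
          (Coeff.majorant_le _ s r F)) _).trans_eq ?_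
        rw [← ENNReal.tsum_add, ← ENNReal.tsum_mul_left]
        exact tsum_congr fun m => by simp only [hG]; ring
    _ = ∑' m : ℕ, (∑' j : Site S, (w j * g j) * (w j * G m (Sum.inl j)) +
          ∑' j : Site S, (w j * g j) * (w j * G m (Sum.inr j))) := by
        rw [ENNReal.tsum_comm]
        exact tsum_congr fun m => ENNReal.tsum_add
    _ ≤ ∑' m : ℕ, Q * bNorm p (G m) := by
        refine ENNReal.tsum_le_tsum fun m => ?_
        rw [bNorm, mul_add]
        exact add_le_add (tsum_mul_le_l2 _ _) (tsum_mul_le_l2 _ _)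
    _ ≤ ∑' m : ℕ, Q * (L * (a.gradZNorm s r p d (p + 2) m * ENNReal.ofReal r ^ m)) := by
        refine ENNReal.tsum_le_tsum fun m => mul_le_mul_right ?_ _
        -- The gain of two derivatives in the tame norm is given up here; the energy estimate needs
        -- the gradient only in the `p`-norm.
        refine (bNorm_mono (by linarith) _).trans ((a.bNorm_modForm_dz_le (p + 2)
          ENNReal.ofReal_ne_top hL hLtop hFp hFd m).trans_eq ?_)
        ring
    _ ≤ Q * (L * (ENNReal.ofReal r * a.tameNorm p s r)) := by
        rw [ENNReal.tsum_mul_left, ENNReal.tsum_mul_left]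
        gcongr
        exact a.tsum_gradZNorm_le p s hr

end

/-! ### Terms of a series -/

section

variable {n d : ℕ} {S : Finset (Fin d → ℤ)} {p : ℝ}

/-- The indices of the terms of a series. -/
abbrev TermIdx (n : ℕ) (S : Finset (Fin d → ℤ)) : Type :=
  (Fin n → ℤ) × (Fin n → ℕ) × (Idx S →₀ ℕ)

/-- The terms of a series. -/
def Coeff.term (a : Coeff n S) (w : Phase n S p) (m : TermIdx n S) : ℂ :=
  a m.1 m.2.1 m.2.2 * Complex.exp (Complex.I * ∑ i, (m.1 i : ℂ) * w.1 i) *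
    (∏ i, w.2.1 i ^ m.2.1 i) * m.2.2.prod fun j e => zCoord w j ^ e

theorem enorm_finsuppProd (b : Idx S →₀ ℕ) (f : Idx S → ℂ) :
    ‖b.prod fun j e => f j ^ e‖ₑ = b.prod fun j e => ‖f j‖ₑ ^ e := by
  rw [Finsupp.prod, Finsupp.prod, ← Finset.prod_congr rfl fun j _ => enorm_pow (f j) (b j)]
  simp only [enorm_eq_nnnorm, nnnorm_prod, ENNReal.ofNNReal_finsetProd]

/-- The terms on a neighbourhood of the torus. -/
theorem Coeff.enorm_term_le (a : Coeff n S) {s r : ℝ} {w : Phase n S p} (hw : w ∈ Dom n S p s r)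
    (m : TermIdx n S) :
    ‖a.term w m‖ₑ ≤ ‖a m.1 m.2.1 m.2.2‖ₑ *
      ENNReal.ofReal (Real.exp ((∑ i, |(m.1 i : ℝ)|) * s)) *
        ENNReal.ofReal (r ^ (2 * ∑ i, m.2.1 i)) * m.2.2.prod fun j e => ‖zCoord w j‖ₑ ^ e := by
  rw [Coeff.term, enorm_mul, enorm_mul, enorm_mul, enorm_finsuppProd]
  have h1 : ‖Complex.exp (Complex.I * ∑ i, (m.1 i : ℂ) * w.1 i)‖ₑ ≤
      ENNReal.ofReal (Real.exp ((∑ i, |(m.1 i : ℝ)|) * s)) := by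
    rw [← ofReal_norm, Complex.norm_exp]
    refine ENNReal.ofReal_le_ofReal (Real.exp_le_exp.mpr ?_)
    have h2 : (Complex.I * ∑ i, (m.1 i : ℂ) * w.1 i).re = ∑ i, -((m.1 i : ℝ) * (w.1 i).im) := by
      rw [Complex.I_mul_re, Complex.im_sum, ← Finset.sum_neg_distrib]
      simp
    rw [h2, Finset.sum_mul]
    refine Finset.sum_le_sum fun i _ => ?_
    have h3 : |(w.1 i).im| ≤ s := (norm_le_pi_norm (fun i => (w.1 i).im) i).trans hw.1.le
    calc -((m.1 i : ℝ) * (w.1 i).im) ≤ |(m.1 i : ℝ) * (w.1 i).im| := neg_le_abs _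
      _ = |(m.1 i : ℝ)| * |(w.1 i).im| := abs_mul _ _
      _ ≤ _ := by gcongr
  have h4 : ‖∏ i, w.2.1 i ^ m.2.1 i‖ₑ ≤ ENNReal.ofReal (r ^ (2 * ∑ i, m.2.1 i)) := by
    rw [← ofReal_norm]
    refine ENNReal.ofReal_le_ofReal ?_
    rw [norm_prod, Finset.mul_sum, ← Finset.prod_pow_eq_pow_sum]
    refine Finset.prod_le_prod (fun _ _ => norm_nonneg _) fun i _ => ?_
    rw [norm_pow, pow_mul]
    gcongr
    exact (norm_le_pi_norm _ i).trans hw.2.1.le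
  gcongr

/-- A weighted sum of the terms of a series. -/
theorem Coeff.tsum_enorm_term_le (a : Coeff n S) {s r : ℝ} {w : Phase n S p}
    (hw : w ∈ Dom n S p s r) (c : TermIdx n S → ℝ≥0∞) (a' : Coeff n S)
    (hc : ∀ k α b, c (k, α, b) * ‖a k α b‖ₑ ≤ ‖a' k α b‖ₑ) :
    ∑' m, c m * ‖a.term w m‖ₑ ≤ a'.majorant s r (zCoord w) := by
  calc ∑' m, c m * ‖a.term w m‖ₑ
      ≤ ∑' m : TermIdx n S, ‖a' m.1 m.2.1 m.2.2‖ₑ *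
      ENNReal.ofReal (Real.exp ((∑ i, |(m.1 i : ℝ)|) * s)) *
        ENNReal.ofReal (r ^ (2 * ∑ i, m.2.1 i)) * m.2.2.prod fun j e => ‖zCoord w j‖ₑ ^ e := by
        refine ENNReal.tsum_le_tsum fun m => ?_
        refine (mul_le_mul_right (a.enorm_term_le hw m) (c m)).trans ?_
        rw [← mul_assoc, ← mul_assoc, ← mul_assoc]
        gcongr
        exact hc _ _ _
    _ = a'.majorant s r (zCoord w) := by
        rw [ENNReal.tsum_prod', ENNReal.tsum_comm, ENNReal.tsum_prod', ENNReal.tsum_comm,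
          Coeff.majorant]
        refine tsum_congr fun b => ?_
        rw [Coeff.xyNorm, ← ENNReal.tsum_mul_right]
        refine tsum_congr fun α => ?_
        rw [← ENNReal.tsum_mul_right, ← ENNReal.tsum_mul_right]

/-! ### Symmetries -/

/-- If the terms of a series are multiplied by phases, the sum changes at most by the weighted sum
of the moduli of the terms. -/
theorem enorm_tsum_phase_sub_le {ι : Type*} (f g : ι → ℂ) (l : ι → ℤ) (θ : ℝ)
    (h : ∀ m, g m = Complex.exp (Complex.I * θ * l m) * f m) :
    ‖∑' m, g m - ∑' m, f m‖ₑ ≤ ENNReal.ofReal |θ| * ∑' m, ‖(l m : ℂ)‖ₑ * ‖f m‖ₑ := by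
  have h1 : ∀ m, ‖g m‖ = ‖f m‖ := fun m => by
    have : Complex.I * θ * l m = ((θ * l m : ℝ) : ℂ) * Complex.I := by push_cast; ring
    rw [h, norm_mul, this, Complex.norm_exp_ofReal_mul_I, one_mul]
  have h2 : ∀ m, ‖g m - f m‖ₑ ≤ ENNReal.ofReal |θ| * (‖(l m : ℂ)‖ₑ * ‖f m‖ₑ) := fun m => by
    have h3 : g m - f m = (Complex.exp (Complex.I * ((θ * l m : ℝ) : ℂ)) - 1) * f m := by
      rw [h]; push_cast; ring_nf
    rw [h3, enorm_mul, ← mul_assoc]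
    gcongr
    rw [← ofReal_norm, ← ofReal_norm, ← ENNReal.ofReal_mul (abs_nonneg _)]
    refine ENNReal.ofReal_le_ofReal ((Real.norm_exp_I_mul_ofReal_sub_one_le).trans_eq ?_)
    rw [norm_mul, Complex.norm_intCast]
    rfl
  by_cases hf : Summable f
  · have hg : Summable g := by
      rw [← summable_norm_iff] at hf ⊢
      simpa only [h1] using hf
    rw [← hg.tsum_sub hf, ← ENNReal.tsum_mul_left]
    exact (enorm_tsum_le_tsum_enorm).trans (ENNReal.tsum_le_tsum h2)
  · have hg : ¬Summable g := by
      rw [← summable_norm_iff] at hf ⊢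
      simpa only [h1] using hf
    rw [tsum_eq_zero_of_not_summable hf, tsum_eq_zero_of_not_summable hg]
    simp

/-- Translation in the variable `x i`. -/
def shiftX (w : Phase n S p) (i : Fin n) (θ : ℝ) : Phase n S p := w + (θ : ℂ) • eX i

theorem zCoord_shiftX (w : Phase n S p) (i : Fin n) (θ : ℝ) :
    zCoord (shiftX w i θ) = zCoord w := by
  simp [zCoord, shiftX, eX]

theorem Coeff.term_shiftX (a : Coeff n S) (w : Phase n S p) (i : Fin n) (θ : ℝ)
    (m : TermIdx n S) :
    a.term (shiftX w i θ) m = Complex.exp (Complex.I * θ * (m.1 i : ℤ)) * a.term w m := by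
  have h1 : ∑ i', (m.1 i' : ℂ) * (shiftX w i θ).1 i' =
      (∑ i', (m.1 i' : ℂ) * w.1 i') + m.1 i * θ := by
    simp [shiftX, eX, mul_add, Finset.sum_add_distrib, Pi.single_apply]
  have h2 : (shiftX w i θ).2.1 = w.2.1 := by simp [shiftX, eX]
  rw [Coeff.term, Coeff.term, zCoord_shiftX, h1, h2, mul_add, Complex.exp_add]
  have h3 : Complex.I * (m.1 i * θ) = Complex.I * θ * (m.1 i : ℤ) := by ring
  rw [h3]
  ring

theorem integrable_shiftX (ω : Fin n → ℝ) (Ω : Site S → ℝ) (w : Phase n S p) (i : Fin n) (θ : ℝ) :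
    integrable ω Ω (shiftX w i θ) = integrable ω Ω w := by
  simp [integrable, shiftX, eX]

/-- Rotation of the variables `q j` and `q̄ j`. -/
def rotate (w : Phase n S p) (j : Site S) (θ : ℝ) : Phase n S p :=
  w + ((Complex.exp (-(θ * Complex.I)) - 1) * w.2.2.1.coord j) • eQ j +
    ((Complex.exp (θ * Complex.I) - 1) * w.2.2.2.coord j) • eQbar j

theorem zCoord_rotate (w : Phase n S p) (j : Site S) (θ : ℝ) [DecidableEq (Idx S)] (i : Idx S) :
    zCoord (rotate w j θ) i = (if i = Sum.inl j then Complex.exp (-(θ * Complex.I)) else 1) *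
      (if i = Sum.inr j then Complex.exp (θ * Complex.I) else 1) * zCoord w i := by
  rcases i with i | i
  · by_cases h : i = j
    · subst h
      simp [zCoord, rotate, eQ, eQbar, Ell.coord_unit]
      ring
    · simp [zCoord, rotate, eQ, eQbar, Ell.coord_unit, h]
  · by_cases h : i = j
    · subst h
      simp [zCoord, rotate, eQ, eQbar, Ell.coord_unit]
      ring
    · simp [zCoord, rotate, eQ, eQbar, Ell.coord_unit, h]

theorem Coeff.term_rotate (a : Coeff n S) (w : Phase n S p) (j : Site S) (θ : ℝ)
    (m : TermIdx n S) :
    a.term (rotate w j θ) m = Complex.exp (Complex.I * θ *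
      (((m.2.2 (Sum.inr j) : ℤ) - (m.2.2 (Sum.inl j) : ℤ) : ℤ) : ℂ)) * a.term w m := by
  classical
  have h1 : (rotate w j θ).1 = w.1 := by simp [rotate, eQ, eQbar]
  have h2 : (rotate w j θ).2.1 = w.2.1 := by simp [rotate, eQ, eQbar]
  have h3 : (m.2.2.prod fun i e => zCoord (rotate w j θ) i ^ e) =
      Complex.exp (Complex.I * θ *
        (((m.2.2 (Sum.inr j) : ℤ) - (m.2.2 (Sum.inl j) : ℤ) : ℤ) : ℂ)) *
        m.2.2.prod fun i e => zCoord w i ^ e := by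
    simp only [zCoord_rotate, mul_pow, ite_pow, one_pow, Finsupp.prod_mul]
    congr 1
    have h4 : ∀ (i₀ : Idx S) (c : ℂ),
        (m.2.2.prod fun i e => if i = i₀ then c ^ e else 1) = c ^ m.2.2 i₀ := by
      intro i₀ c
      rw [Finsupp.prod, Finset.prod_ite_eq']
      split_ifs with h
      · rfl
      · rw [Finsupp.notMem_support_iff.mp h, pow_zero]
    rw [h4, h4, ← Complex.exp_nat_mul, ← Complex.exp_nat_mul, ← Complex.exp_add]
    congr 1
    push_cast
    ring
  rw [Coeff.term, Coeff.term, h1, h2, h3]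
  ring

theorem integrable_rotate (ω : Fin n → ℝ) (Ω : Site S → ℝ) (w : Phase n S p) (j : Site S)
    (θ : ℝ) : integrable ω Ω (rotate w j θ) = integrable ω Ω w := by
  classical
  have h2 : (rotate w j θ).2.1 = w.2.1 := by simp [rotate, eQ, eQbar]
  rw [integrable, integrable, h2]
  congr 1
  refine tsum_congr fun i => ?_
  have h3 := zCoord_rotate w j θ (Sum.inl i)
  have h4 := zCoord_rotate w j θ (Sum.inr i)
  simp only [zCoord, Sum.elim_inl, Sum.elim_inr, reduceCtorEq, if_false, mul_one, one_mul,
    Sum.inl.injEq, Sum.inr.injEq] at h3 h4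
  rw [h3, h4]
  by_cases h : i = j
  · subst h
    have : Complex.exp (-(θ * Complex.I)) * Complex.exp (θ * Complex.I) = 1 := by
      rw [← Complex.exp_add, neg_add_cancel, Complex.exp_zero]
    simp only [if_true]
    linear_combination ((Ω i : ℂ) * w.2.2.1.coord i * w.2.2.2.coord i) * this
  · simp [h]

/-! ### Derivatives along symmetries -/

/-- A Lipschitz bound along a curve bounds the derivative in its direction at the starting point.
Applied to orbits of symmetries, it turns bounds for differences of series into bounds for `dK`. -/
theorem enorm_fderiv_le_of_curve {E : Type*} [NormedAddCommGroup E] [NormedSpace ℂ E] {K : E → ℂ}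
    {u ξ : E} {γ : ℝ → E} (hγ : HasDerivAt γ ξ 0) (hγ0 : γ 0 = u) (hK : DifferentiableAt ℂ K u)
    {C : ℝ≥0∞} (hC : ∀ᶠ θ in nhds (0 : ℝ), ‖K (γ θ) - K u‖ₑ ≤ ENNReal.ofReal |θ| * C) :
    ‖fderiv ℂ K u ξ‖ₑ ≤ C := by
  rcases eq_or_ne C ⊤ with rfl | hCtop
  · exact le_top
  subst hγ0
  have hd := (hK.hasFDerivAt.restrictScalars ℝ).comp_hasDerivAt (0 : ℝ) hγ
  have h := hd.le_of_lip' (C := C.toReal) ENNReal.toReal_nonneg (by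
    filter_upwards [hC] with θ hθ
    have h1 := ENNReal.toReal_mono (ENNReal.mul_ne_top ENNReal.ofReal_ne_top hCtop) hθ
    rw [ENNReal.toReal_mul, ENNReal.toReal_ofReal (abs_nonneg _), toReal_enorm] at h1
    rw [sub_zero, mul_comm]
    exact h1)
  rw [← ofReal_norm]
  exact (ENNReal.ofReal_le_ofReal h).trans (ENNReal.ofReal_toReal hCtop).le

theorem hasDerivAt_shiftX (w : Phase n S p) (i : Fin n) :
    HasDerivAt (fun θ : ℝ => shiftX w i θ) (eX i) 0 := by
  have h := (Complex.ofRealCLM.hasDerivAt (x := (0 : ℝ))).smul_const (eX i : Phase n S p)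
  simpa [shiftX] using h.const_add w

theorem hasDerivAt_rotate (w : Phase n S p) (j : Site S) :
    HasDerivAt (fun θ : ℝ => rotate w j θ)
      ((-Complex.I * w.2.2.1.coord j) • eQ j + (Complex.I * w.2.2.2.coord j) • eQbar j) 0 := by
  have h0 : HasDerivAt (fun θ : ℝ => (θ : ℂ) * Complex.I) Complex.I 0 := by
    simpa using (Complex.ofRealCLM.hasDerivAt (x := (0 : ℝ))).mul_const Complex.I
  have h1 := (((h0.fun_neg.cexp.sub_const 1).mul_const (w.2.2.1.coord j)).smul_const
    (eQ j : Phase n S p))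
  have h2 := (((h0.cexp.sub_const 1).mul_const (w.2.2.2.coord j)).smul_const
    (eQbar j : Phase n S p))
  have h3 := (h1.const_add w).add h2
  simpa [rotate] using! h3

/-- The translation multiplies the term of index `k` by the phase `exp (√-1 θ k i)`, and the weight
`|k i|` that appears is that of the coefficients of `a.dx i`. -/
theorem enorm_expand_shiftX_sub_le (a : Coeff n S) {s r : ℝ} {w : Phase n S p}
    (hw : w ∈ Dom n S p s r) (i : Fin n) (θ : ℝ) :
    ‖expand a (shiftX w i θ) - expand a w‖ₑ ≤
      ENNReal.ofReal |θ| * (a.dx i).majorant s r (zCoord w) := by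
  refine (enorm_tsum_phase_sub_le (a.term w) (a.term (shiftX w i θ)) (fun m => m.1 i) θ
    (a.term_shiftX w i θ)).trans ?_
  gcongr
  refine a.tsum_enorm_term_le hw (fun m => ‖((m.1 i : ℤ) : ℂ)‖ₑ) _ fun k α b => ?_
  rw [Coeff.dx, enorm_mul, enorm_mul, enorm_eq_nnnorm Complex.I, Complex.nnnorm_I]
  simp

/-- The coefficients of `z j` times the derivative with respect to `z j`. -/
def Coeff.euler (a : Coeff n S) (j : Idx S) : Coeff n S := fun k α b => (b j : ℂ) * a k α b

/-- Reindexing by `b ↦ b + single j 1`; the multi-indices that are missed have `b j = 0` and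
contribute nothing. -/
theorem Coeff.majorant_euler (a : Coeff n S) (s r : ℝ) (F : Idx S → ℂ) (j : Idx S) :
    (a.euler j).majorant s r F = ‖F j‖ₑ * (a.dz j).majorant s r F := by
  classical
  have hinj : Function.Injective fun b : Idx S →₀ ℕ => b + Finsupp.single j 1 :=
    add_left_injective _
  rw [Coeff.majorant, ← hinj.tsum_eq, Coeff.majorant, ← ENNReal.tsum_mul_left]
  · refine tsum_congr fun b => ?_
    have h1 : (a.euler j).xyNorm s r (b + Finsupp.single j 1) = (a.dz j).xyNorm s r b := by
      simp [Coeff.xyNorm, Coeff.euler, Coeff.dz]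
    have h2 : ((b + Finsupp.single j 1).prod fun i e => ‖F i‖ₑ ^ e) =
        (b.prod fun i e => ‖F i‖ₑ ^ e) * ‖F j‖ₑ := by
      rw [Finsupp.prod_add_index' (fun _ => pow_zero _) fun _ _ _ => pow_add _ _ _]
      simp
    simp only [h1, h2]
    ring
  · intro b hb
    have hbj : b j ≠ 0 := by
      intro h
      refine hb ?_
      have : (a.euler j).xyNorm s r b = 0 := by simp [Coeff.xyNorm, Coeff.euler, h]
      simp only [this, zero_mul]
    exact ⟨b - Finsupp.single j 1, tsub_add_cancel_of_le
      (Finsupp.single_le_iff.mpr (Nat.one_le_iff_ne_zero.mpr hbj))⟩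

/-- The rotation multiplies a monomial by a phase whose frequency is the difference of its exponents
in `q̄ j` and `q j`. The triangle inequality splits the weight into the two Euler operators. -/
theorem enorm_expand_rotate_sub_le (a : Coeff n S) {s r : ℝ} {w : Phase n S p}
    (hw : w ∈ Dom n S p s r) (j : Site S) (θ : ℝ) :
    ‖expand a (rotate w j θ) - expand a w‖ₑ ≤
      ENNReal.ofReal |θ| *
        (‖w.2.2.1.coord j‖ₑ * (a.dz (Sum.inl j)).majorant s r (zCoord w) +
          ‖w.2.2.2.coord j‖ₑ * (a.dz (Sum.inr j)).majorant s r (zCoord w)) := by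
  refine (enorm_tsum_phase_sub_le (a.term w) (a.term (rotate w j θ))
    (fun m => (m.2.2 (Sum.inr j) : ℤ) - (m.2.2 (Sum.inl j) : ℤ)) θ
    (a.term_rotate w j θ)).trans ?_
  gcongr
  have h1 : ∀ i : Idx S, ∑' m : TermIdx n S, ‖((m.2.2 i : ℕ) : ℂ)‖ₑ * ‖a.term w m‖ₑ ≤
      ‖zCoord w i‖ₑ * (a.dz i).majorant s r (zCoord w) := by
    intro i
    rw [← a.majorant_euler]
    refine a.tsum_enorm_term_le hw (fun m => ‖((m.2.2 i : ℕ) : ℂ)‖ₑ) _ fun k α b => ?_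
    rw [Coeff.euler, enorm_mul]
  refine le_trans ?_ (add_le_add (h1 (Sum.inl j)) (h1 (Sum.inr j)))
  rw [← ENNReal.tsum_add]
  refine ENNReal.tsum_le_tsum fun m => ?_
  rw [← add_mul, add_comm]
  gcongr
  push_cast
  exact enorm_sub_le

/-- The part of the Hamiltonian that depends only on `y` and the products `q j * q̄ j` is invariant
under the symmetries. -/
theorem expand_eq_of_resonant {Z : Coeff n S}
    (hZ : ∀ k α b, Z k α b ≠ 0 → k = 0 ∧ ∀ j, b (Sum.inl j) = b (Sum.inr j)) (w : Phase n S p) :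
    (∀ i θ, expand Z (shiftX w i θ) = expand Z w) ∧
      ∀ j θ, expand Z (rotate w j θ) = expand Z w := by
  have h0 : ∀ m : TermIdx n S, Z m.1 m.2.1 m.2.2 = 0 → Z.term w m = 0 := fun m h => by
    simp [Coeff.term, h]
  refine ⟨fun i θ => tsum_congr fun m => ?_, fun j θ => tsum_congr fun m => ?_⟩
  · change Z.term _ m = Z.term _ m
    rw [Z.term_shiftX]
    by_cases h : Z m.1 m.2.1 m.2.2 = 0
    · rw [h0 m h, mul_zero]
    · simp [(hZ _ _ _ h).1]
  · change Z.term _ m = Z.term _ m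
    rw [Z.term_rotate]
    by_cases h : Z m.1 m.2.1 m.2.2 = 0
    · rw [h0 m h, mul_zero]
    · simp [(hZ _ _ _ h).2 j]

section

variable {K : Phase n S p → ℂ} {s r : ℝ} {ω : Fin n → ℝ} {Ω : Site S → ℝ} {Z P Q : Coeff n S}

/-- Along the translation orbit only `P` and `Q` vary, since the integrable part and `Z` are
constant on it. -/
theorem enorm_fderiv_eX_le
    (hK : ∀ w ∈ Dom n S p s r, K w = integrable ω Ω w + expand Z w + expand P w + expand Q w)
    (hZ : ∀ k α b, Z k α b ≠ 0 → k = 0 ∧ ∀ j, b (Sum.inl j) = b (Sum.inr j)) {u : Phase n S p}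
    (hu : u ∈ Dom n S p s r) (hd : DifferentiableAt ℂ K u) (i : Fin n) :
    ‖fderiv ℂ K u (eX i)‖ₑ ≤ (P.dx i).majorant s r (zCoord u) +
      (Q.dx i).majorant s r (zCoord u) := by
  have h0 : shiftX u i 0 = u := by simp [shiftX]
  refine enorm_fderiv_le_of_curve (hasDerivAt_shiftX u i) h0 hd ?_
  have hev : ∀ᶠ θ in nhds (0 : ℝ), shiftX u i θ ∈ Dom n S p s r :=
    (hasDerivAt_shiftX u i).continuousAt.eventually_mem (isOpen_Dom.mem_nhds (by rwa [h0]))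
  filter_upwards [hev] with θ hθ
  rw [hK _ hθ, hK _ hu, integrable_shiftX, (expand_eq_of_resonant hZ u).1]
  have : integrable ω Ω u + expand Z u + expand P (shiftX u i θ) + expand Q (shiftX u i θ) -
      (integrable ω Ω u + expand Z u + expand P u + expand Q u) =
      (expand P (shiftX u i θ) - expand P u) + (expand Q (shiftX u i θ) - expand Q u) := by ring
  rw [this, mul_add]
  exact (enorm_add_le _ _).trans (add_le_add (enorm_expand_shiftX_sub_le P hu i θ)
    (enorm_expand_shiftX_sub_le Q hu i θ))

/-- The direction is the velocity of the rotation orbit, along which again only `P` and `Q` vary. At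
a real point `|q̄ j| = |q j|`, so this factor can be taken out. -/
theorem enorm_fderiv_rotate_le
    (hK : ∀ w ∈ Dom n S p s r, K w = integrable ω Ω w + expand Z w + expand P w + expand Q w)
    (hZ : ∀ k α b, Z k α b ≠ 0 → k = 0 ∧ ∀ j, b (Sum.inl j) = b (Sum.inr j)) {u : Phase n S p}
    (hu : u ∈ Dom n S p s r) (hur : IsRealPt u) (hd : DifferentiableAt ℂ K u) (j : Site S) :
    ‖fderiv ℂ K u ((-Complex.I * u.2.2.1.coord j) • eQ j +
        (Complex.I * u.2.2.2.coord j) • eQbar j)‖ₑ ≤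
      ‖u.2.2.1.coord j‖ₑ * ((P.dz (Sum.inl j)).majorant s r (zCoord u) +
          (P.dz (Sum.inr j)).majorant s r (zCoord u)) +
        ‖u.2.2.1.coord j‖ₑ * ((Q.dz (Sum.inl j)).majorant s r (zCoord u) +
          (Q.dz (Sum.inr j)).majorant s r (zCoord u)) := by
  have h0 : rotate u j 0 = u := by simp [rotate]
  refine enorm_fderiv_le_of_curve (hasDerivAt_rotate u j) h0 hd ?_
  have hev : ∀ᶠ θ in nhds (0 : ℝ), rotate u j θ ∈ Dom n S p s r :=
    (hasDerivAt_rotate u j).continuousAt.eventually_mem (isOpen_Dom.mem_nhds (by rwa [h0]))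
  filter_upwards [hev] with θ hθ
  rw [hK _ hθ, hK _ hu, integrable_rotate, (expand_eq_of_resonant hZ u).2]
  have : integrable ω Ω u + expand Z u + expand P (rotate u j θ) + expand Q (rotate u j θ) -
      (integrable ω Ω u + expand Z u + expand P u + expand Q u) =
      (expand P (rotate u j θ) - expand P u) + (expand Q (rotate u j θ) - expand Q u) := by ring
  have hn : ‖u.2.2.2.coord j‖ₑ = ‖u.2.2.1.coord j‖ₑ := by
    rw [hur.2.2 j, ← ofReal_norm, ← ofReal_norm, norm_star]
  have h1 := enorm_expand_rotate_sub_le P hu j θ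
  have h2 := enorm_expand_rotate_sub_le Q hu j θ
  rw [hn, ← mul_add] at h1 h2
  rw [this, mul_add]
  exact (enorm_add_le _ _).trans (add_le_add h1 h2)

end

end

section

variable {n d : ℕ} {S : Finset (Fin d → ℤ)} {p : ℝ}

/-! ### The gain from the high modes -/

theorem Ell.l2_eq (q : Ell S p) :
    (∑' j : Site S, (ENNReal.ofReal (wt j.1 ^ p) * ‖q.coord j‖ₑ) ^ 2) ^ (1 / 2 : ℝ) =
      ENNReal.ofReal ‖q‖ := by
  have hmem : Summable fun j : Site S => ‖q.coord j‖ ^ 2 * wt j.1 ^ (2 * p) := by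
    have h := (memℓp_gen_iff (p := 2) (by norm_num)).mp (lp.memℓp (Ell.toLp S p q))
    refine h.congr fun j => ?_
    rw [Ell.norm_toLp_apply, ENNReal.toReal_ofNat, Real.rpow_two, mul_pow, mul_comm 2 p,
      Real.rpow_mul (wt_pos _).le, Real.rpow_two, mul_comm]
  have h1 : ∀ j : Site S, (ENNReal.ofReal (wt j.1 ^ p) * ‖q.coord j‖ₑ) ^ 2 =
      ENNReal.ofReal (‖q.coord j‖ ^ 2 * wt j.1 ^ (2 * p)) := by
    intro j
    have hw : 0 ≤ wt j.1 ^ p := (Real.rpow_pos_of_pos (wt_pos _) _).le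
    rw [← ofReal_norm, ← ENNReal.ofReal_mul hw, ← ENNReal.ofReal_pow (by positivity), mul_pow,
      mul_comm 2 p, Real.rpow_mul (wt_pos _).le, Real.rpow_two, mul_comm]
  rw [tsum_congr h1, ← ENNReal.ofReal_tsum_of_nonneg (fun j => by
    have := (Real.rpow_pos_of_pos (wt_pos j.1) (2 * p)).le
    positivity) hmem, ← Ell.norm_sq, ENNReal.ofReal_rpow_of_nonneg (by positivity) (by norm_num),
    ← Real.sqrt_eq_rpow, Real.sqrt_sq (norm_nonneg _)]

theorem cNorm_zCoord (u : Phase n S p) : cNorm p (zCoord u) = ENNReal.ofReal (zNorm u.2.2) := by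
  rw [zNorm, ENNReal.ofReal_add (norm_nonneg _) (norm_nonneg _), ← Ell.l2_eq, ← Ell.l2_eq]
  rfl

theorem bNorm_le_bNorm {p' : ℝ} {f g : Idx S → ℝ≥0∞}
    (h : ∀ j : Idx S, ENNReal.ofReal (wt (Sum.elim id id j : Site S).1 ^ p) * f j ≤
      ENNReal.ofReal (wt (Sum.elim id id j : Site S).1 ^ p') * g j) : bNorm p f ≤ bNorm p' g :=
  add_le_add
    (ENNReal.rpow_le_rpow (ENNReal.tsum_le_tsum fun j => pow_le_pow_left' (h (Sum.inl j)) 2)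
      (by norm_num))
    (ENNReal.rpow_le_rpow (ENNReal.tsum_le_tsum fun j => pow_le_pow_left' (h (Sum.inr j)) 2)
      (by norm_num))

/-- Multiplication of the high modes by `L`. -/
def amplify (N : ℕ) (L : ℝ) (F : Idx S → ℂ) : Idx S → ℂ := fun j =>
  if (N : ℝ) < latNorm (Sum.elim id id j : Site S).1 then (L : ℂ) * F j else F j

theorem enorm_amplify (N : ℕ) {L : ℝ} (hL : 0 ≤ L) (F : Idx S → ℂ) (j : Idx S) :
    ‖amplify N L F j‖ₑ =
      (if (N : ℝ) < latNorm (Sum.elim id id j : Site S).1 then ENNReal.ofReal L else 1) *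
        ‖F j‖ₑ := by
  rw [amplify]
  split_ifs with h
  · rw [enorm_mul, ← ofReal_norm, Complex.norm_real, Real.norm_of_nonneg hL]
  · rw [one_mul]

theorem cNorm_amplify_le (N : ℕ) {L : ℝ} (hL : 1 ≤ L) (F : Idx S → ℂ) :
    cNorm p (amplify N L F) ≤ ENNReal.ofReal L * cNorm p F := by
  have h1 : ∀ j, ‖amplify N L F j‖ₑ ≤ ENNReal.ofReal L * ‖F j‖ₑ := fun j => by
    rw [enorm_amplify N (zero_le_one.trans hL)]
    gcongr
    split_ifs
    · exact le_rfl
    · exact ENNReal.one_le_ofReal.mpr hL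
  have h2 : ∀ f : Site S → ℝ≥0∞, (∑' j : Site S, (ENNReal.ofReal L * f j) ^ 2) ^ (1 / 2 : ℝ) =
      ENNReal.ofReal L * (∑' j : Site S, f j ^ 2) ^ (1 / 2 : ℝ) := by
    intro f
    simp only [mul_pow]
    rw [ENNReal.tsum_mul_left, ENNReal.mul_rpow_of_nonneg _ _ (by norm_num), ← ENNReal.rpow_two,
      ← ENNReal.rpow_mul]
    norm_num
  have h3 : ENNReal.ofReal L * cNorm p F = bNorm p fun j => ENNReal.ofReal L * ‖F j‖ₑ := by
    rw [cNorm, bNorm, bNorm, mul_add, ← h2, ← h2]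
    simp only [mul_left_comm]
  rw [h3]
  exact bNorm_le_bNorm fun j => mul_le_mul_right (h1 j) _

/-- A high mode has weight at least `N`, so passing from exponent `p` to `p'` gains `N ^ (p - p')`,
enough to pay for the factor `L`. -/
theorem cNorm_amplify_le_of_le (N : ℕ) {L p' : ℝ} (hL : 1 ≤ L) (hp : p' ≤ p)
    (hLN : L ≤ (N : ℝ) ^ (p - p')) (F : Idx S → ℂ) :
    cNorm p' (amplify N L F) ≤ cNorm p F := by
  have h1 : ∀ j : Idx S, ENNReal.ofReal (wt (Sum.elim id id j : Site S).1 ^ p') *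
      ‖amplify N L F j‖ₑ ≤ ENNReal.ofReal (wt (Sum.elim id id j : Site S).1 ^ p) * ‖F j‖ₑ := by
    intro j
    set i : Fin d → ℤ := (Sum.elim id id j : Site S).1
    rw [enorm_amplify N (zero_le_one.trans hL), ← mul_assoc]
    gcongr
    split_ifs with h
    · rw [← ENNReal.ofReal_mul (Real.rpow_pos_of_pos (wt_pos _) _).le]
      refine ENNReal.ofReal_le_ofReal ?_
      have h2 : (N : ℝ) ≤ wt i := h.le.trans (le_max_right _ _)
      calc wt i ^ p' * L ≤ wt i ^ p' * wt i ^ (p - p') := by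
            have := (Real.rpow_pos_of_pos (wt_pos i) p').le
            gcongr
            exact hLN.trans (Real.rpow_le_rpow (Nat.cast_nonneg _) h2 (by linarith))
        _ = wt i ^ p := by rw [← Real.rpow_add (wt_pos _)]; ring_nf
    · rw [mul_one]
      exact ENNReal.ofReal_le_ofReal (Real.rpow_le_rpow_of_exponent_le (one_le_wt _) hp)
  exact bNorm_le_bNorm h1

/-- Amplification multiplies the monomial `z ^ b` by `L ^ highDeg N b`, and every monomial present
has high degree at least `h`. -/
theorem Coeff.majorant_amplify (a : Coeff n S) (s r : ℝ) (N h : ℕ) {L : ℝ} (hL : 1 ≤ L)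
    (F : Idx S → ℂ) (ha : ∀ k α b, a k α b ≠ 0 → h ≤ highDeg N b) :
    ENNReal.ofReal L ^ h * a.majorant s r F ≤ a.majorant s r (amplify N L F) := by
  rw [Coeff.majorant, ← ENNReal.tsum_mul_left]
  refine ENNReal.tsum_le_tsum fun b => ?_
  by_cases hb : ∀ k α, a k α b = 0
  · have : a.xyNorm s r b = 0 := by simp [Coeff.xyNorm, hb]
    simp [this]
  · push Not at hb
    obtain ⟨k, α, hb⟩ := hb
    have h1 : (b.prod fun j e => ‖amplify N L F j‖ₑ ^ e) =
        ENNReal.ofReal L ^ highDeg N b * b.prod fun j e => ‖F j‖ₑ ^ e := by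
      simp only [enorm_amplify N (zero_le_one.trans hL), mul_pow, Finsupp.prod_mul]
      congr 1
      rw [highDeg, Finsupp.sum, ← Finset.prod_pow_eq_pow_sum]
      refine Finset.prod_congr rfl fun j _ => ?_
      beta_reduce
      by_cases h : (N : ℝ) < latNorm (Sum.elim id id j : Site S).1
      · rw [if_pos h, if_pos h]
      · rw [if_neg h, if_neg h, one_pow, pow_zero]
    rw [h1, mul_left_comm]
    gcongr
    · exact ENNReal.one_le_ofReal.mpr hL
    · exact ha k α b hb

theorem highDeg_add_single_le (N : ℕ) (b : Idx S →₀ ℕ) (j : Idx S) :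
    highDeg N (b + Finsupp.single j 1) ≤ highDeg N b + 1 := by
  classical
  let g : Idx S → ℕ → ℕ := fun j e =>
    if (N : ℝ) < latNorm (Sum.elim id id j : Site S).1 then e else 0
  have h0 : ∀ i, g i 0 = 0 := fun i => by simp [g]
  have h1 : ∀ i, g i 1 ≤ 1 := fun i => by simp only [g]; split_ifs <;> simp
  change (b + Finsupp.single j 1).sum g ≤ b.sum g + 1
  rw [Finsupp.sum_add_index' h0 (fun i e e' => by simp only [g]; split_ifs <;> simp),
    Finsupp.sum_single_index (h0 j)]
  exact Nat.add_le_add_left (h1 j) _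

/-- The derivatives in `x` of a series of degree at least three in the high modes. -/
theorem Coeff.mul_majorant_dx_le (a : Coeff n S) (s : ℝ) {r : ℝ} (hr : 0 < r) {N : ℕ} {L : ℝ}
    (hL : 1 ≤ L) (hpd : (d : ℝ) ≤ p) (hLN : L ≤ (N : ℝ) ^ (p - d)) {F : Idx S → ℂ}
    (hF : cNorm p F ≤ ENNReal.ofReal r) (ha : ∀ k α b, a k α b ≠ 0 → 3 ≤ highDeg N b)
    (i : Fin n) :
    ENNReal.ofReal L * (a.dx i).majorant s r F ≤ ENNReal.ofReal (r ^ 2) * a.tameNorm p s r := by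
  have h1 := a.majorant_dx_le p s hr ((cNorm_amplify_le_of_le N hL hpd hLN F).trans hF) i
  have h2 := (a.dx i).majorant_amplify s r N 1 hL F fun k α b h => by
    have := ha k α b fun h0 => h (by simp [Coeff.dx, h0])
    -- The derivative in `x` keeps the high degree, and a gain of one power of `L` is all that is
    -- needed.
    omega
  rw [pow_one] at h2
  exact h2.trans h1

/-- The derivatives in `z` of a series of degree at least three in the high modes. -/
theorem Coeff.mul_tsum_majorant_dz_le (a : Coeff n S) (s : ℝ) {r : ℝ} (hr : 0 < r) {N : ℕ}
    {L : ℝ} (hL : 1 ≤ L) (hpd : (d : ℝ) ≤ p) (hLN : L ≤ (N : ℝ) ^ (p - d)) {F : Idx S → ℂ}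
    (hF : cNorm p F ≤ ENNReal.ofReal r) (ha : ∀ k α b, a k α b ≠ 0 → 3 ≤ highDeg N b)
    (g : Site S → ℝ≥0∞) :
    ENNReal.ofReal L * ∑' j : Site S, ENNReal.ofReal (wt j.1 ^ p) ^ 2 * g j *
        ((a.dz (Sum.inl j)).majorant s r F + (a.dz (Sum.inr j)).majorant s r F) ≤
      (∑' j : Site S, (ENNReal.ofReal (wt j.1 ^ p) * g j) ^ 2) ^ (1 / 2 : ℝ) *
        (ENNReal.ofReal r * a.tameNorm p s r) := by
  have hL0 : ENNReal.ofReal L ≠ 0 := by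
    rw [Ne, ENNReal.ofReal_eq_zero]; linarith
  have h1 := a.tsum_majorant_dz_le s hr (ENNReal.one_le_ofReal.mpr hL) ENNReal.ofReal_ne_top
    ((cNorm_amplify_le N hL F).trans (by gcongr))
    ((cNorm_amplify_le_of_le N hL hpd hLN F).trans hF) g
  have h2 : ∀ j : Idx S, ENNReal.ofReal L ^ 2 * (a.dz j).majorant s r F ≤
      (a.dz j).majorant s r (amplify N L F) := fun j =>
    (a.dz j).majorant_amplify s r N 2 hL F fun k α b h => by
      have := ha k α (b + Finsupp.single j 1) fun h0 => h (by simp [Coeff.dz, h0])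
      have := highDeg_add_single_le N b j
      omega
  -- After one derivative the high degree is still at least two, so amplification gains `L ^ 2`; the
  -- estimate `h1` costs one `L`, which is cancelled.
  have h3 : ENNReal.ofReal L * (ENNReal.ofReal L *
      ∑' j : Site S, ENNReal.ofReal (wt j.1 ^ p) ^ 2 * g j *
        ((a.dz (Sum.inl j)).majorant s r F + (a.dz (Sum.inr j)).majorant s r F)) ≤
      ENNReal.ofReal L * ((∑' j : Site S, (ENNReal.ofReal (wt j.1 ^ p) * g j) ^ 2) ^ (1 / 2 : ℝ) *
        (ENNReal.ofReal r * a.tameNorm p s r)) := by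
    rw [mul_left_comm (ENNReal.ofReal L) (_ ^ (1 / 2 : ℝ)), ← mul_assoc, ← sq,
      ← ENNReal.tsum_mul_left]
    refine le_trans (ENNReal.tsum_le_tsum fun j => ?_) h1
    rw [mul_left_comm, mul_add]
    gcongr <;> exact h2 _
  exact (ENNReal.mul_le_mul_iff_right hL0 ENNReal.ofReal_ne_top).mp h3

/-! ### The change of the actions -/

section

variable {K : Phase n S p → ℂ} {s r : ℝ} {ω : Fin n → ℝ} {Ω : Site S → ℝ} {Z P Q : Coeff n S}

theorem ENNReal_le_ofReal_div {L τ c : ℝ} (hL : 1 ≤ L) (hc : 0 ≤ c) {X t : ℝ≥0∞}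
    (ht : t ≤ ENNReal.ofReal τ) (h : ENNReal.ofReal L * X ≤ ENNReal.ofReal c * t) :
    X ≤ ENNReal.ofReal (c * (τ / L)) := by
  have hL' : 0 < L := by linarith
  rw [← mul_div_assoc, ENNReal.ofReal_div_of_pos hL', ENNReal.ofReal_mul hc,
    ENNReal.le_div_iff_mul_le (Or.inl (by simpa using hL')) (Or.inl ENNReal.ofReal_ne_top),
    mul_comm]
  exact h.trans (by gcongr)

theorem norm_fderiv_eX_le
    (hK : ∀ w ∈ Dom n S p s r, K w = integrable ω Ω w + expand Z w + expand P w + expand Q w)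
    (hZ : ∀ k α b, Z k α b ≠ 0 → k = 0 ∧ ∀ j, b (Sum.inl j) = b (Sum.inr j))
    {N : ℕ} (hQ : ∀ k α b, Q k α b ≠ 0 → 3 ≤ highDeg N b) {L τP τQ : ℝ} (hL : 1 ≤ L)
    (hpd : (d : ℝ) ≤ p) (hLN : L ≤ (N : ℝ) ^ (p - d)) (hr : 0 < r) (hτP : 0 ≤ τP) (hτQ : 0 ≤ τQ)
    (hP : P.tameNorm p s r ≤ ENNReal.ofReal τP) (hQ' : Q.tameNorm p s r ≤ ENNReal.ofReal τQ)
    {u : Phase n S p} (hu : u ∈ Dom n S p s r) (hd : DifferentiableAt ℂ K u) (i : Fin n) :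
    ‖fderiv ℂ K u (eX i)‖ ≤ r ^ 2 * (τP + τQ / L) := by
  have hF : cNorm p (zCoord u) ≤ ENNReal.ofReal r := by
    rw [cNorm_zCoord]; exact ENNReal.ofReal_le_ofReal hu.2.2.le
  have hF1 : cNorm (d : ℝ) (zCoord u) ≤ ENNReal.ofReal r := (bNorm_mono hpd _).trans hF
  have h1 := (P.majorant_dx_le p s hr hF1 i).trans (mul_le_mul_right hP _)
  rw [← ENNReal.ofReal_mul (by positivity)] at h1
  have h2 := ENNReal_le_ofReal_div hL (by positivity) hQ'
    (Q.mul_majorant_dx_le s hr hL hpd hLN hF hQ i)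
  have h3 := (enorm_fderiv_eX_le hK hZ hu hd i).trans (add_le_add h1 h2)
  have hL0 : 0 < L := by linarith
  rw [← ENNReal.ofReal_add (by positivity) (by positivity), ← ofReal_norm,
    ENNReal.ofReal_le_ofReal_iff (by positivity)] at h3
  rwa [mul_add]

/-- The tame estimate for `P` and the amplified one for `Q` are paired with the weighted sequence
`q` by Cauchy-Schwarz. The bound does not depend on the finite set `A`. -/
theorem sum_norm_fderiv_rotate_le
    (hK : ∀ w ∈ Dom n S p s r, K w = integrable ω Ω w + expand Z w + expand P w + expand Q w)
    (hZ : ∀ k α b, Z k α b ≠ 0 → k = 0 ∧ ∀ j, b (Sum.inl j) = b (Sum.inr j))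
    {N : ℕ} (hQ : ∀ k α b, Q k α b ≠ 0 → 3 ≤ highDeg N b) {L τP τQ : ℝ} (hL : 1 ≤ L)
    (hpd : (d : ℝ) ≤ p) (hLN : L ≤ (N : ℝ) ^ (p - d)) (hr : 0 < r) (hτP : 0 ≤ τP) (hτQ : 0 ≤ τQ)
    (hP : P.tameNorm p s r ≤ ENNReal.ofReal τP) (hQ' : Q.tameNorm p s r ≤ ENNReal.ofReal τQ)
    {u : Phase n S p} (hu : u ∈ Dom n S p s r) (hur : IsRealPt u) (hd : DifferentiableAt ℂ K u)
    (A : Finset (Site S)) :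
    ∑ j ∈ A, wt j.1 ^ (2 * p) * ‖fderiv ℂ K u ((-Complex.I * u.2.2.1.coord j) • eQ j +
        (Complex.I * u.2.2.2.coord j) • eQbar j)‖ ≤ ‖u.2.2.1‖ * r * (τP + τQ / L) := by
  have hL0 : 0 < L := by linarith
  have hF : cNorm p (zCoord u) ≤ ENNReal.ofReal r := by
    rw [cNorm_zCoord]; exact ENNReal.ofReal_le_ofReal hu.2.2.le
  have hF1 : cNorm (d : ℝ) (zCoord u) ≤ ENNReal.ofReal r := (bNorm_mono hpd _).trans hF
  have h1 := P.tsum_majorant_dz_le (p := p) s hr (L := 1) le_rfl ENNReal.one_ne_top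
    (by rwa [one_mul]) hF1 fun j => ‖u.2.2.1.coord j‖ₑ
  rw [Ell.l2_eq, one_mul, ← mul_assoc, ← ENNReal.ofReal_mul (norm_nonneg _)] at h1
  have h1' := h1.trans (mul_le_mul_right hP _)
  rw [← ENNReal.ofReal_mul (by positivity)] at h1'
  have h2 := Q.mul_tsum_majorant_dz_le s hr hL hpd hLN hF hQ fun j => ‖u.2.2.1.coord j‖ₑ
  rw [Ell.l2_eq, ← mul_assoc, ← ENNReal.ofReal_mul (norm_nonneg _)] at h2
  have h2' := ENNReal_le_ofReal_div hL (by positivity) hQ' h2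
  have h3 : ∀ j : Site S, ENNReal.ofReal (wt j.1 ^ (2 * p) *
      ‖fderiv ℂ K u ((-Complex.I * u.2.2.1.coord j) • eQ j +
        (Complex.I * u.2.2.2.coord j) • eQbar j)‖) ≤
      ENNReal.ofReal (wt j.1 ^ p) ^ 2 * ‖u.2.2.1.coord j‖ₑ *
        ((P.dz (Sum.inl j)).majorant s r (zCoord u) +
          (P.dz (Sum.inr j)).majorant s r (zCoord u)) +
      ENNReal.ofReal (wt j.1 ^ p) ^ 2 * ‖u.2.2.1.coord j‖ₑ *
        ((Q.dz (Sum.inl j)).majorant s r (zCoord u) +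
          (Q.dz (Sum.inr j)).majorant s r (zCoord u)) := by
    intro j
    have hw : 0 ≤ wt j.1 ^ p := (Real.rpow_pos_of_pos (wt_pos _) _).le
    rw [mul_comm 2 p, Real.rpow_mul (wt_pos _).le, Real.rpow_two,
      ENNReal.ofReal_mul (by positivity), ENNReal.ofReal_pow hw, ofReal_norm, mul_assoc, mul_assoc,
      ← mul_add]
    gcongr
    exact enorm_fderiv_rotate_le hK hZ hu hur hd j
  have h4 := ENNReal.sum_le_tsum (f := fun j : Site S => ENNReal.ofReal (wt j.1 ^ (2 * p) *
      ‖fderiv ℂ K u ((-Complex.I * u.2.2.1.coord j) • eQ j +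
        (Complex.I * u.2.2.2.coord j) • eQbar j)‖)) A
  have h5 := h4.trans (ENNReal.tsum_le_tsum h3)
  rw [ENNReal.tsum_add] at h5
  have h6 := h5.trans (add_le_add h1' h2')
  have hnn : ∀ j ∈ A, 0 ≤ wt j.1 ^ (2 * p) *
      ‖fderiv ℂ K u ((-Complex.I * u.2.2.1.coord j) • eQ j +
        (Complex.I * u.2.2.2.coord j) • eQbar j)‖ := fun j _ => by
    have := (Real.rpow_pos_of_pos (wt_pos j.1) (2 * p)).le
    positivity
  rw [← ENNReal.ofReal_sum_of_nonneg hnn, ← ENNReal.ofReal_add (by positivity) (by positivity),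
    ENNReal.ofReal_le_ofReal_iff (by positivity)] at h6
  rwa [mul_add]

end

end

section

variable {n d : ℕ} {S : Finset (Fin d → ℤ)} {p : ℝ}

/-! ### Slow evolution in the normal form coordinates -/

section

variable {K : Phase n S p → ℂ} {T : Set ℝ} {u : ℝ → Phase n S p} {D : Set (Phase n S p)}

theorem WeakSolution.norm_y_le (hp : 0 ≤ p) (h : WeakSolution (symplB n S hp) K Set.univ T u)
    (hT : T.OrdConnected) (h0 : (0 : ℝ) ∈ T) {C : ℝ} (hC : 0 ≤ C)
    (hbound : ∀ t ∈ T, ∀ i, ‖fderiv ℂ K (u t) (eX i)‖ ≤ C) {t : ℝ} (ht : t ∈ T) :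
    ‖(u t).2.1‖ ≤ ‖(u 0).2.1‖ + C * |t| := by
  refine (pi_norm_le_iff_of_nonneg (by positivity)).mpr fun i => ?_
  have h1 := hT.convex.norm_image_sub_le_of_norm_hasDerivWithin_le
    (fun τ hτ => h.hasDerivWithinAt_y hp hτ i) (fun τ hτ => by rw [norm_neg]; exact hbound τ hτ i)
    h0 ht
  rw [sub_zero, Real.norm_eq_abs] at h1
  have h2 := norm_le_pi_norm (u 0).2.1 i
  have h3 := norm_le_norm_add_norm_sub' ((u t).2.1 i) ((u 0).2.1 i)
  linarith

/-- The derivative of `q j * q̄ j` is `dK` in the direction of the rotation of the mode `j`. Only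
finite weighted sums are differentiated; the uniform bound then passes to the full norm. -/
theorem WeakSolution.norm_q_sq_le (hp : 0 ≤ p)
    (h : WeakSolution (symplB n S hp) K Set.univ T u)
    (hT : T.OrdConnected) (h0 : (0 : ℝ) ∈ T) (hreal : ∀ t ∈ T, IsRealPt (u t)) {C : ℝ} (hC : 0 ≤ C)
    (hbound : ∀ t ∈ T, ∀ A : Finset (Site S), ∑ j ∈ A, wt j.1 ^ (2 * p) *
      ‖fderiv ℂ K (u t) ((-Complex.I * (u t).2.2.1.coord j) • eQ j +
        (Complex.I * (u t).2.2.2.coord j) • eQbar j)‖ ≤ C) {t : ℝ} (ht : t ∈ T) :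
    ‖(u t).2.2.1‖ ^ 2 ≤ ‖(u 0).2.2.1‖ ^ 2 + C * |t| := by
  have hw : ∀ j : Site S, 0 ≤ wt j.1 ^ (2 * p) := fun j =>
    (Real.rpow_pos_of_pos (wt_pos _) _).le
  have hsum : Summable fun j : Site S => ‖(u 0).2.2.1.coord j‖ ^ 2 * wt j.1 ^ (2 * p) := by
    have h := (memℓp_gen_iff (p := 2) (by norm_num)).mp (lp.memℓp (Ell.toLp S p (u 0).2.2.1))
    refine h.congr fun j => ?_
    rw [Ell.norm_toLp_apply, ENNReal.toReal_ofNat, Real.rpow_two, mul_pow, mul_comm 2 p,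
      Real.rpow_mul (wt_pos _).le, Real.rpow_two, mul_comm]
  rw [Ell.norm_sq (u t).2.2.1]
  refine tsum_le_of_sum_le' (by positivity) fun A => ?_
  set f : ℝ → ℂ := fun τ => ∑ j ∈ A, ((wt j.1 ^ (2 * p) : ℝ) : ℂ) *
    ((u τ).2.2.1.coord j * (u τ).2.2.2.coord j) with hf
  have hfd : ∀ τ ∈ T, HasDerivWithinAt f (∑ j ∈ A, ((wt j.1 ^ (2 * p) : ℝ) : ℂ) *
      fderiv ℂ K (u τ) ((-Complex.I * (u τ).2.2.1.coord j) • eQ j +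
        (Complex.I * (u τ).2.2.2.coord j) • eQbar j)) T τ := by
    intro τ hτ
    refine HasDerivWithinAt.fun_sum fun j _ => ?_
    have h1 := ((h.hasDerivWithinAt_q hp hτ j).mul (h.hasDerivWithinAt_qbar hp hτ j)).const_mul
      ((wt j.1 ^ (2 * p) : ℝ) : ℂ)
    refine h1.congr_deriv ?_
    rw [map_add, map_smul, map_smul, smul_eq_mul, smul_eq_mul]
    ring
  have hfr : ∀ τ ∈ T, f τ =
      ((∑ j ∈ A, ‖(u τ).2.2.1.coord j‖ ^ 2 * wt j.1 ^ (2 * p) : ℝ) : ℂ) := by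
    intro τ hτ
    rw [hf, Complex.ofReal_sum]
    refine Finset.sum_congr rfl fun j _ => ?_
    rw [(hreal τ hτ).2.2 j]
    have : (u τ).2.2.1.coord j * star ((u τ).2.2.1.coord j) =
        ((‖(u τ).2.2.1.coord j‖ ^ 2 : ℝ) : ℂ) := by
      rw [Complex.ofReal_pow]
      exact Complex.mul_conj' _
    rw [this]
    push_cast
    ring
  have h1 := hT.convex.norm_image_sub_le_of_norm_hasDerivWithin_le hfd (C := C) (fun τ hτ => by
    refine (norm_sum_le _ _).trans (le_trans (le_of_eq ?_) (hbound τ hτ A))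
    refine Finset.sum_congr rfl fun j _ => ?_
    rw [norm_mul, Complex.norm_real, Real.norm_of_nonneg (hw j)]) h0 ht
  rw [hfr t ht, hfr 0 h0, ← Complex.ofReal_sub, Complex.norm_real, sub_zero, Real.norm_eq_abs,
    Real.norm_eq_abs] at h1
  have h2 := (abs_le.mp h1).2
  have h3 : ∑ j ∈ A, ‖(u 0).2.2.1.coord j‖ ^ 2 * wt j.1 ^ (2 * p) ≤ ‖(u 0).2.2.1‖ ^ 2 := by
    rw [Ell.norm_sq]
    exact hsum.sum_le_tsum A fun j _ => mul_nonneg (by positivity) (hw j)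
  linarith

end

/-! ### The distance to the torus -/

/-- The distance of a real point to the straight torus. -/
def normalSize (v : Phase n S p) : ℝ := √‖v.2.1‖ + zNorm v.2.2

theorem normalSize_nonneg (v : Phase n S p) : 0 ≤ normalSize v :=
  add_nonneg (Real.sqrt_nonneg _) (zNorm_nonneg _)

theorem zero_mem_flatTorus : (0 : Phase n S p) ∈ flatTorus n S p := ⟨fun _ => rfl, rfl⟩

theorem phaseDist_flatTorus (v : Phase n S p) {u : Phase n S p} (hu : u ∈ flatTorus n S p) :
    phaseDist v u = ‖v.1 - u.1‖ + normalSize v := by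
  rw [phaseDist, normalSize, hu.2]
  simp [add_assoc]

theorem normalSize_le_flatDist (v : Phase n S p) : normalSize v ≤ flatDist v := by
  have : Nonempty (flatTorus n S p) := ⟨⟨0, zero_mem_flatTorus⟩⟩
  refine le_ciInf fun u => ?_
  rw [phaseDist_flatTorus v u.2]
  linarith [norm_nonneg (v.1 - u.1.1)]

/-- The torus point with the same angles is admissible because these are real. -/
theorem flatDist_le_normalSize {v : Phase n S p} (hv : IsRealPt v) :
    flatDist v ≤ normalSize v := by
  have hu : ((v.1, 0) : Phase n S p) ∈ flatTorus n S p := ⟨hv.1, rfl⟩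
  refine (ciInf_le ⟨0, ?_⟩ (⟨_, hu⟩ : flatTorus n S p)).trans_eq ?_
  · rintro _ ⟨u, rfl⟩
    simp only [phaseDist_flatTorus v u.2]
    exact add_nonneg (norm_nonneg _) (normalSize_nonneg v)
  · rw [phaseDist_flatTorus v hu]
    simp

/-- The distance to the torus changes little under small displacements. -/
theorem normalSize_le_of_scaledNorm_le {r ε : ℝ} (hr : 0 < r) {v u : Phase n S p}
    (h : scaledNorm r (v - u) ≤ ε ^ 2) (hε : 0 ≤ ε) (hε1 : ε ≤ 1) :
    normalSize v ≤ normalSize u + 2 * r * ε := by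
  have h1 := norm_y_le_scaledNorm hr (v - u)
  have h2 := zNorm_le_scaledNorm hr (v - u)
  have h3 : ‖v.2.1‖ ≤ ‖u.2.1‖ + (r * ε) ^ 2 := by
    have := norm_le_norm_add_norm_sub' v.2.1 u.2.1
    have h4 : ‖(v - u).2.1‖ ≤ r ^ 2 * ε ^ 2 := h1.trans (by gcongr)
    rw [mul_pow]
    exact this.trans (by gcongr; exact h4)
  have h5 : √‖v.2.1‖ ≤ √‖u.2.1‖ + r * ε := by
    refine Real.sqrt_le_iff.mpr ⟨by positivity, h3.trans ?_⟩
    have := Real.sq_sqrt (norm_nonneg u.2.1)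
    nlinarith [mul_nonneg (Real.sqrt_nonneg ‖u.2.1‖) (mul_nonneg hr.le hε)]
  have h6 : zNorm v.2.2 ≤ zNorm u.2.2 + r * ε := by
    have h7 : v.2.2 = u.2.2 + (v - u).2.2 := by simp
    have h8 := zNorm_add_le u.2.2 (v - u).2.2
    rw [← h7] at h8
    have : r * scaledNorm r (v - u) ≤ r * ε := by
      gcongr
      exact h.trans (by nlinarith)
    linarith
  unfold normalSize
  linarith

theorem mem_Dom_of_normalSize_lt {s r : ℝ} (hs : 0 < s) {v : Phase n S p} (hv : IsRealPt v)
    (h : normalSize v < r) : v ∈ Dom n S p s r := by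
  have h1 := Real.sqrt_nonneg ‖v.2.1‖
  have h2 := zNorm_nonneg v.2.2
  unfold normalSize at h
  refine mem_Dom_of_real hs hv ?_ (by linarith)
  exact (Real.sqrt_lt' (by linarith)).mp (by linarith)

theorem torusDist_le {Ψ : Phase n S p → Phase n S p} {D : Set (Phase n S p)} {v w : Phase n S p}
    (hv : v ∈ D) (hr : IsRealPt v) (hw : Ψ v = w) {δ : ℝ} (h : normalSize v ≤ δ) :
    torusDist Ψ D w ≤ ENNReal.ofReal δ :=
  (iInf_le _ (⟨v, hv, hr, hw⟩ : {v : Phase n S p // v ∈ D ∧ IsRealPt v ∧ Ψ v = w})).trans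
    (ENNReal.ofReal_le_ofReal ((flatDist_le_normalSize hr).trans h))

theorem exists_of_torusDist_lt {Ψ : Phase n S p → Phase n S p} {D : Set (Phase n S p)}
    {w : Phase n S p} {δ : ℝ} (h : torusDist Ψ D w < ENNReal.ofReal δ) :
    ∃ v ∈ D, IsRealPt v ∧ Ψ v = w ∧ normalSize v < δ := by
  obtain ⟨⟨v, hv, hr, hw⟩, hlt⟩ := iInf_lt_iff.mp h
  refine ⟨v, hv, hr, hw, (normalSize_le_flatDist v).trans_lt ?_⟩
  by_contra! hle
  exact absurd hlt (not_lt.mpr (ENNReal.ofReal_le_ofReal hle))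

/-! ### The coordinate changes are close to the identity -/

/-- The `y`-part produces the factor `4`; for this reason `κ < 1 / 4` makes `Ψ` a contraction away
from the identity in a single norm. -/
theorem scaledNorm_half_le {r : ℝ} (hr : 0 < r) (w : Phase n S p) :
    scaledNorm (r / 2) w ≤ 4 * scaledNorm r w := by
  have h0 := zNorm_nonneg w.2.2
  have h1 : ‖w.2.1‖ / (r / 2) ^ 2 = 4 * (‖w.2.1‖ / r ^ 2) := by field_simp; norm_num
  have h2 : zNorm w.2.2 / (r / 2) = 2 * (zNorm w.2.2 / r) := by field_simp
  have h3 : 0 ≤ zNorm w.2.2 / r := by positivity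
  unfold scaledNorm
  rw [h1, h2]
  linarith [norm_nonneg w.1]

theorem IsNormalFormTwo.fderiv_near_id {s₀ r₀ κ : ℝ} {H : Phase n S p → ℂ}
    {Ψ : Phase n S p → Phase n S p} {ω : Fin n → ℝ} {Ω : Site S → ℝ} (hr₀ : 0 < r₀)
    (h : IsNormalFormTwo s₀ r₀ κ H Ψ ω Ω) {w : Phase n S p}
    (hw : w ∈ Dom n S p (s₀ / 2) (r₀ / 2)) (u : Phase n S p) :
    ‖scaling n S p r₀ (fderiv ℂ Ψ w u - u)‖ ≤ 4 * κ * ‖scaling n S p r₀ u‖ := by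
  have hκ : 0 ≤ κ := (scaledNorm_nonneg hr₀ _).trans (h.near_id w hw)
  rw [norm_scaling hr₀, norm_scaling hr₀]
  have h1 := h.deriv_near_id w hw u
  have h2 := mul_le_mul_of_nonneg_left (scaledNorm_half_le hr₀ u) hκ
  linarith

/-- Interior points of the domain of the partial normal form. -/
theorem add_mem_Dom_of_scaledNorm_le {s₀ σ : ℝ} (hs₀' : s₀ ≤ 1) (hσ : 0 < σ)
    {w v : Phase n S p} (hw : w ∈ Dom n S p (s₀ / 8) (3 * σ))
    (hv : ‖scaling n S p (5 * σ) v‖ ≤ s₀ / 8) : w + v ∈ Dom n S p (s₀ / 4) (4 * σ) := by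
  have h5 : 0 < 5 * σ := by linarith
  rw [norm_scaling h5] at hv
  have h1 := norm_fst_le_scaledNorm h5 v
  have h2 := norm_y_le_scaledNorm h5 v
  have h3 := zNorm_le_scaledNorm h5 v
  refine ⟨?_, ?_, ?_⟩
  · have h4 : (fun i => ((w + v).1 i).im) = (fun i => (w.1 i).im) + fun i => (v.1 i).im := by
      funext i; simp
    have h6 : ‖fun i => (v.1 i).im‖ ≤ ‖v.1‖ :=
      (pi_norm_le_iff_of_nonneg (norm_nonneg _)).mpr fun i =>
        (Complex.abs_im_le_norm _).trans (norm_le_pi_norm v.1 i)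
    rw [h4]
    refine (norm_add_le _ _).trans_lt ?_
    have := hw.1
    linarith
  · refine (norm_add_le w.2.1 v.2.1).trans_lt ?_
    have := hw.2.1
    nlinarith [sq_nonneg σ, sq_pos_of_pos hσ]
  · refine (zNorm_add_le w.2.2 v.2.2).trans_lt ?_
    have := hw.2.2
    nlinarith

/-- The bound on `Φ - id` carries a factor `σ` and is small, so the Cauchy estimate with the margin
`s₀ / 8` gives a small derivative on the inner domain. -/
theorem IsPartialNormalForm.fderiv_near_id {s₀ η c σ : ℝ} {M N : ℕ} {H : Phase n S p → ℂ}
    {ω : Fin n → ℝ} {Ω : Site S → ℝ} {Φ : Phase n S p → Phase n S p} {Z P Q : Coeff n S}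
    (hs₀ : 0 < s₀) (hs₀' : s₀ ≤ 1) (hσ : 0 < σ) (hσ1 : 5 * σ ≤ 1)
    (h : IsPartialNormalForm s₀ η c M N σ H ω Ω Φ Z P Q) {ε : ℝ}
    (hε : c * (N : ℝ) ^ 294 * σ / η ^ 2 ≤ ε) {w : Phase n S p}
    (hw : w ∈ Dom n S p (s₀ / 8) (3 * σ)) (u : Phase n S p) :
    ‖scaling n S p (5 * σ) (fderiv ℂ Φ w u - u)‖ ≤
      ε / (s₀ / 8) * ‖scaling n S p (5 * σ) u‖ := by
  have h5 : 0 < 5 * σ := by linarith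
  refine fderiv_near_id_of_near_id (norm_le_scaledNorm h5 hσ1)
    (fun w hw => (h.map.analytic w hw).differentiableAt) (by linarith)
    (fun w hw => ?_) (fun v hv => add_mem_Dom_of_scaledNorm_le hs₀' hσ hw hv) u
  rw [norm_scaling h5]
  exact (h.near_id w hw).trans hε

end

/-! ### Continuation and the choice of the cutoff -/

section

/-- A continuity argument: a property that improves itself on intervals, and whose improvement is
stable, is preserved along a curve. -/
theorem bootstrap {X : Type*} [PseudoMetricSpace X] {T : Set ℝ} (hT : T.OrdConnected)
    (h0 : (0 : ℝ) ∈ T) {w : ℝ → X} (hw : ContinuousOn w T) {Good Better : X → Prop}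
    (hinit : Good (w 0)) {t₁ : ℝ} (ht₁ : t₁ ∈ T)
    (himp : ∀ J ⊆ T, J.OrdConnected → (0 : ℝ) ∈ J → (∀ t ∈ J, |t| ≤ |t₁|) →
      (∀ t ∈ J, Good (w t)) → ∀ t ∈ J, Better (w t))
    {h : ℝ} (hh : 0 < h)
    (hstep : ∀ t ∈ T, ∀ t' ∈ T, Better (w t) → dist (w t') (w t) < h → Good (w t')) :
    Better (w t₁) := by
  have hmem : ∀ s ∈ Set.Icc (0 : ℝ) 1, s * t₁ ∈ T := fun s hs => by
    have := hT.convex.add_smul_sub_mem h0 ht₁ hs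
    simpa using this
  have hcont : ContinuousOn (fun s : ℝ => w (s * t₁)) (Set.Icc 0 1) :=
    hw.comp (by fun_prop) hmem
  have huc := isCompact_Icc.uniformContinuousOn_of_continuous hcont
  obtain ⟨ε, hε, hε'⟩ := Metric.uniformContinuousOn_iff.mp huc h hh
  -- The segment from `0` to `t₁` is divided into `m + 1` pieces on each of which the curve moves by
  -- less than `h`. On `J k` the property improves, and the stability of the improvement carries it
  -- to `J (k + 1)`.
  obtain ⟨m, hm⟩ := exists_nat_one_div_lt hε
  set l : ℝ := 1 / ((m : ℝ) + 1) with hl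
  have hl0 : 0 < l := by positivity
  have hml : ((m : ℝ) + 1) * l = 1 := by rw [hl]; field_simp
  let J : ℕ → Set ℝ := fun k => (fun s => s * t₁) '' Set.Icc 0 (k * l)
  have hk : ∀ k ≤ m + 1, (k : ℝ) * l ≤ 1 := fun k hk => by
    have : (k : ℝ) ≤ m + 1 := by exact_mod_cast hk
    rw [← hml]
    gcongr
  have hJbetter : ∀ k ≤ m + 1, (∀ t ∈ J k, Good (w t)) → ∀ t ∈ J k, Better (w t) := by
    intro k hkm hg
    refine himp (J k) ?_ ?_ ⟨0, ⟨le_rfl, by positivity⟩, by simp⟩ ?_ hg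
    · rintro _ ⟨s, hs, rfl⟩
      exact hmem s ⟨hs.1, hs.2.trans (hk k hkm)⟩
    · refine Convex.ordConnected ?_
      exact (convex_Icc (0 : ℝ) (k * l)).is_linear_image (f := fun s => s * t₁)
        ⟨fun x y => add_mul x y t₁, fun c x => by simp [mul_assoc]⟩
    · rintro _ ⟨s, hs, rfl⟩
      rw [abs_mul, abs_of_nonneg hs.1]
      exact mul_le_of_le_one_left (abs_nonneg _) (hs.2.trans (hk k hkm))
  have hgood : ∀ k ≤ m + 1, ∀ t ∈ J k, Good (w t) := by
    intro k
    induction k with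
    | zero =>
      rintro - _ ⟨s, hs, rfl⟩
      have : s = 0 := le_antisymm (by simpa using hs.2) hs.1
      simpa [this] using hinit
    | succ k ih =>
      rintro hkm _ ⟨s, hs, rfl⟩
      have hkm' : k ≤ m + 1 := by omega
      have hs1 : s ≤ 1 := hs.2.trans (hk _ hkm)
      by_cases hsk : s ≤ k * l
      · exact ih hkm' _ ⟨s, ⟨hs.1, hsk⟩, rfl⟩
      · have hb := hJbetter k hkm' (ih hkm') (k * l * t₁) ⟨k * l, ⟨by positivity, le_rfl⟩, rfl⟩
        have hkl : (k : ℝ) * l ∈ Set.Icc (0 : ℝ) 1 := ⟨by positivity, hk k hkm'⟩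
        refine hstep _ (hmem _ hkl) _ (hmem s ⟨hs.1, hs1⟩) hb ?_
        refine hε' s ⟨hs.1, hs1⟩ _ hkl ?_
        rw [Real.dist_eq, abs_of_nonneg (by linarith)]
        have := hs.2
        push_cast at this
        linarith
  refine hJbetter (m + 1) le_rfl (hgood _ le_rfl) t₁ ⟨1, ⟨zero_le_one, ?_⟩, one_mul _⟩
  push_cast
  exact hml.ge

/-- The inverse of `F` is Lipschitz, so a pointwise choice of preimages within `U` along a
continuous curve is continuous. -/
theorem continuousOn_of_near_id {E E' : Type*} [NormedAddCommGroup E] [NormedSpace ℂ E]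
    [NormedAddCommGroup E'] [NormedSpace ℂ E'] {Λ : E →L[ℂ] E'}
    (hΛ : ∀ w, ‖w‖ ≤ 1 * ‖Λ w‖) {F : E → E} {U : Set E} {K : ℝ} (hK : K < 1)
    (hlip : ∀ a ∈ U, ∀ b ∈ U, ‖Λ (F a - F b - (a - b))‖ ≤ K * ‖Λ (a - b)‖)
    {T : Set ℝ} {u w : ℝ → E} (hu : ∀ t ∈ T, u t ∈ U) (hFu : ∀ t ∈ T, F (u t) = w t)
    (hw : ContinuousOn w T) : ContinuousOn u T := by
  intro t ht
  have h1 : Filter.Tendsto (fun τ => (1 - K)⁻¹ * ‖Λ (w τ - w t)‖) (nhdsWithin t T) (nhds 0) := by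
    have h2 : ContinuousWithinAt (fun τ => (1 - K)⁻¹ * ‖Λ (w τ - w t)‖) T t := by
      have := hw t ht
      fun_prop
    simpa [ContinuousWithinAt] using h2
  rw [ContinuousWithinAt, tendsto_iff_norm_sub_tendsto_zero]
  refine squeeze_zero' (Filter.Eventually.of_forall fun _ => norm_nonneg _) ?_ h1
  filter_upwards [self_mem_nhdsWithin] with τ hτ
  have h3 := norm_le_of_norm_sub_sub_le (hlip _ (hu τ hτ) _ (hu t ht))
  rw [hFu τ hτ, hFu t ht] at h3
  refine (hΛ _).trans ?_
  rw [one_mul, ← div_eq_inv_mul, le_div_iff₀ (by linarith)]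
  linarith

/-- The cutoff, as a power of the distance to the torus. -/
theorem exists_cutoff_pow {A : ℕ} (hA : A ≠ 0) (N₀ : ℕ) {δ : ℝ} (hδ : 0 < δ)
    (hδN : δ * ((N₀ : ℝ) + 1) ^ A ≤ 1) :
    ∃ N : ℕ, N₀ < N ∧ δ * (N : ℝ) ^ A ≤ 1 ∧ 1 ≤ δ * (2 * (N : ℝ)) ^ A := by
  have hex : ∃ m : ℕ, 1 < δ * (m : ℝ) ^ A := by
    obtain ⟨m, hm⟩ := exists_nat_gt (1 / δ)
    refine ⟨m, ?_⟩
    have hm1 : (1 : ℝ) ≤ m := by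
      have : (0 : ℝ) < m := (by positivity : (0 : ℝ) < 1 / δ).trans hm
      exact_mod_cast this
    have h1 : (m : ℝ) ≤ (m : ℝ) ^ A := le_self_pow₀ hm1 hA
    rw [div_lt_iff₀ hδ] at hm
    nlinarith
  classical
  -- The cutoff is the last integer before `δ * m ^ A` exceeds one; since `m ≥ 2`, it is at least `m
  -- / 2`.
  set m := Nat.find hex with hm
  have hm1 : 1 < δ * (m : ℝ) ^ A := Nat.find_spec hex
  have hlt : N₀ + 1 < m := by
    by_contra! hle
    have : (m : ℝ) ≤ (N₀ : ℝ) + 1 := by exact_mod_cast hle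
    have h2 : δ * (m : ℝ) ^ A ≤ δ * ((N₀ : ℝ) + 1) ^ A := by gcongr
    linarith
  have hmin := Nat.find_min hex (m := m - 1) (by omega)
  refine ⟨m - 1, by omega, not_lt.mp hmin, hm1.le.trans ?_⟩
  gcongr
  have : m ≤ 2 * (m - 1) := by omega
  exact_mod_cast this

/-- The choice of the cutoff. -/
theorem exists_cutoff (d M N₀ : ℕ) {p η c ε : ℝ} (hpd : 12 * ((M : ℝ) + 7) ^ 4 + (d : ℝ) ≤ p)
    (hη : 0 < η) (hc : 0 < c) (hε : 0 < ε) :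
    ∃ ρ : ℝ, 0 < ρ ∧ ∀ δ : ℝ, 0 < δ → δ < ρ → ∃ N : ℕ, 1 ≤ N ∧ N₀ ≤ N ∧ δ ≤ ε ∧
      c * (N : ℝ) ^ (6 * (M + 7) ^ 2) * δ / η ^ 2 ≤ ε ∧ 1 ≤ (N : ℝ) ^ (p - d) ∧
      c * δ * (1 / η ^ 2 * (N : ℝ) ^ (6 * (M + 7) ^ 2) * δ) ^ M +
        c * δ / (N : ℝ) ^ (p - d) ≤ ε * δ ^ M := by
  set B := 6 * (M + 7) ^ 2 with hB
  set C := 1 + c / η ^ 2 + c * (1 / η ^ 2) ^ M + c * 2 ^ (B * (M + 7) * M) with hC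
  have hC1 : 0 < C := by positivity
  obtain ⟨N₁, hN₁⟩ := exists_nat_gt (C / ε)
  have hA : B * (M + 7) ≠ 0 := by positivity
  -- The cutoff is comparable to `δ ^ (-1 / (B * (M + 7)))`, and `ρ` is so small that `N` exceeds `C
  -- / ε`. A spare factor `1 / N` then absorbs every constant.
  refine ⟨1 / (((max N₀ N₁ : ℕ) : ℝ) + 1) ^ (B * (M + 7)), by positivity, fun δ hδ hδρ => ?_⟩
  obtain ⟨N, hN, h1, h2⟩ := exists_cutoff_pow hA (max N₀ N₁) hδ (by
    rw [lt_div_iff₀ (by positivity)] at hδρ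
    exact hδρ.le)
  have hN0 : N₀ < N := (le_max_left _ _).trans_lt hN
  have hNN1 : N₁ < N := (le_max_right _ _).trans_lt hN
  have hNpos : (1 : ℝ) ≤ N := by exact_mod_cast (by omega : 1 ≤ N)
  have hCN : C / N ≤ ε := by
    have : (N₁ : ℝ) < N := by exact_mod_cast hNN1
    rw [div_le_iff₀ (by linarith)]
    rw [div_lt_iff₀ hε] at hN₁
    nlinarith
  set x : ℝ := (N : ℝ) ^ B with hx
  have hxN : (N : ℝ) ≤ x := le_self_pow₀ hNpos (by positivity)
  have hx1 : 1 ≤ x := hNpos.trans hxN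
  have h1' : δ * x ^ (M + 7) ≤ 1 := by rw [hx, ← pow_mul]; exact h1
  have hδx : ∀ k, k + 1 ≤ M + 7 → δ * x ^ k ≤ 1 / N := by
    intro k hk
    rw [le_div_iff₀ (by linarith)]
    calc δ * x ^ k * N ≤ δ * x ^ k * x := by gcongr
      _ = δ * x ^ (k + 1) := by ring
      _ ≤ δ * x ^ (M + 7) := by gcongr
      _ ≤ 1 := h1'
  have hδN : δ ≤ 1 / N := by simpa using hδx 0 (by omega)
  -- This is where the size of `p` enters: `p - d` must dominate `6 * (M + 7) ^ 3 * M`, so that the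
  -- gain from the high modes beats `δ ^ (-M)`.
  have hNp : x ^ ((M + 7) * M) ≤ (N : ℝ) ^ (p - d) := by
    rw [hx, ← pow_mul, ← Real.rpow_natCast]
    refine Real.rpow_le_rpow_of_exponent_le hNpos ?_
    have h3 : ((B * ((M + 7) * M) : ℕ) : ℝ) ≤ 12 * ((M : ℝ) + 7) ^ 4 := by
      have : B * ((M + 7) * M) ≤ 12 * (M + 7) ^ 4 := by
        rw [hB]
        calc 6 * (M + 7) ^ 2 * ((M + 7) * M) ≤ 12 * (M + 7) ^ 2 * ((M + 7) * (M + 7)) := by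
              gcongr <;> omega
          _ = 12 * (M + 7) ^ 4 := by ring
      exact_mod_cast this
    linarith
  have hNp1 : 1 ≤ (N : ℝ) ^ (p - d) := (one_le_pow₀ hx1).trans hNp
  have hterm : ∀ q : ℝ, 0 ≤ q → q ≤ C → q / N ≤ ε := fun q _ hq =>
    (div_le_div_of_nonneg_right hq (by linarith)).trans hCN
  have hp1 : 0 < c / η ^ 2 := by positivity
  have hp2 : 0 < c * (1 / η ^ 2) ^ M := by positivity
  have hp3 : 0 < c * (2 : ℝ) ^ (B * (M + 7) * M) := by positivity
  refine ⟨N, by omega, hN0.le, ?_, ?_, hNp1, ?_⟩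
  · exact hδN.trans (hterm 1 zero_le_one (by linarith))
  · have h3 := hδx 1 (by omega)
    rw [pow_one] at h3
    calc c * x * δ / η ^ 2 = c / η ^ 2 * (δ * x) := by ring
      _ ≤ c / η ^ 2 * (1 / N) := by gcongr
      _ = c / η ^ 2 / N := by ring
      _ ≤ ε := hterm _ hp1.le (by linarith)
  · have h4 : c * δ * (1 / η ^ 2 * x * δ) ^ M ≤ c * (1 / η ^ 2) ^ M / N * δ ^ M := by
      have h3 := hδx M (by omega)
      calc c * δ * (1 / η ^ 2 * x * δ) ^ M
          = c * (1 / η ^ 2) ^ M * δ ^ M * (δ * x ^ M) := by rw [mul_pow, mul_pow]; ring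
        _ ≤ c * (1 / η ^ 2) ^ M * δ ^ M * (1 / N) := by gcongr
        _ = _ := by ring
    have h5 : c * δ / (N : ℝ) ^ (p - d) ≤ c * 2 ^ (B * (M + 7) * M) / N * δ ^ M := by
      rw [div_le_iff₀ (by linarith)]
      have h6 : 1 ≤ δ ^ M * (2 ^ (B * (M + 7) * M) * x ^ ((M + 7) * M)) := by
        calc 1 ≤ (δ * (2 * (N : ℝ)) ^ (B * (M + 7))) ^ M := one_le_pow₀ h2
          _ = _ := by rw [hx, mul_pow, mul_pow, mul_pow, ← pow_mul, ← pow_mul, ← pow_mul]; ring_nf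
      calc c * δ ≤ c * (1 / N) * 1 := by rw [mul_one]; gcongr
        _ ≤ c * (1 / N) * (δ ^ M * (2 ^ (B * (M + 7) * M) * x ^ ((M + 7) * M))) := by gcongr
        _ ≤ c * (1 / N) * (δ ^ M * (2 ^ (B * (M + 7) * M) * (N : ℝ) ^ (p - d))) := by gcongr
        _ = _ := by ring
    calc _ ≤ c * (1 / η ^ 2) ^ M / N * δ ^ M + c * 2 ^ (B * (M + 7) * M) / N * δ ^ M :=
          add_le_add h4 h5
      _ = (c * (1 / η ^ 2) ^ M + c * 2 ^ (B * (M + 7) * M)) / N * δ ^ M := by ring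
      _ ≤ ε * δ ^ M := by
          gcongr
          exact hterm _ (by linarith) (by linarith)

end

section

variable {n d : ℕ} {S : Finset (Fin d → ℤ)} {p : ℝ}

/-! ### Long time stability -/

/-- The points close to a real point that is close to the torus. -/
theorem mem_Dom_of_near_real {s₀ σ : ℝ} (hs₀ : 0 < s₀) (hs₀' : s₀ ≤ 1) (hσ : 0 < σ)
    {v a : Phase n S p} (hv : IsRealPt v) (hsize : normalSize v ≤ 2 * σ)
    (ha : ‖scaling n S p (5 * σ) (a - v)‖ ≤ s₀ / 100) : a ∈ Dom n S p (s₀ / 8) (3 * σ) := by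
  have h5 : 0 < 5 * σ := by linarith
  rw [norm_scaling h5] at ha
  have h1 := norm_fst_le_scaledNorm h5 (a - v)
  have h2 := norm_y_le_scaledNorm h5 (a - v)
  have h3 := zNorm_le_scaledNorm h5 (a - v)
  have hz := zNorm_nonneg v.2.2
  have hy := Real.sqrt_nonneg ‖v.2.1‖
  have hsum : a = v + (a - v) := by abel
  unfold normalSize at hsize
  refine ⟨?_, ?_, ?_⟩
  · have h4 : (fun i => (a.1 i).im) = fun i => ((a - v).1 i).im := by
      funext i; simp [hv.1 i]
    have h6 : ‖fun i => ((a - v).1 i).im‖ ≤ ‖(a - v).1‖ :=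
      (pi_norm_le_iff_of_nonneg (norm_nonneg _)).mpr fun i =>
        (Complex.abs_im_le_norm _).trans (norm_le_pi_norm (a - v).1 i)
    rw [h4]
    linarith
  · have h4 : ‖v.2.1‖ ≤ (2 * σ) ^ 2 := Real.sqrt_le_left (by linarith) |>.mp (by linarith)
    have h6 : ‖a.2.1‖ ≤ ‖v.2.1‖ + ‖(a - v).2.1‖ := by
      conv_lhs => rw [hsum]
      exact norm_add_le v.2.1 (a - v).2.1
    have h7 : (5 * σ) ^ 2 * scaledNorm (5 * σ) (a - v) ≤ (5 * σ) ^ 2 * (1 / 100) := by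
      gcongr; linarith
    have h8 : 0 < σ ^ 2 := by positivity
    calc ‖a.2.1‖ ≤ (2 * σ) ^ 2 + (5 * σ) ^ 2 * (1 / 100) := by linarith
      _ < (3 * σ) ^ 2 := by ring_nf; linarith
  · have h6 : zNorm a.2.2 ≤ zNorm v.2.2 + zNorm (a - v).2.2 := by
      conv_lhs => rw [hsum]
      exact zNorm_add_le v.2.2 (a - v).2.2
    have h7 : 5 * σ * scaledNorm (5 * σ) (a - v) ≤ 5 * σ * (1 / 100) := by
      gcongr; linarith
    linarith

/-- A bound for the growth of a square root. -/
theorem sqrt_le_add_of_le_add_sq {a b c : ℝ} (ha : 0 ≤ a) (hc : 0 ≤ c) (h : b ≤ a + c ^ 2) :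
    √b ≤ √a + c := by
  refine Real.sqrt_le_iff.mpr ⟨by positivity, h.trans ?_⟩
  have := Real.sq_sqrt ha
  nlinarith [mul_nonneg (Real.sqrt_nonneg a) hc]

/-- Both `‖y‖` and `‖q‖²` grow by at most `(4σe)²`, so `√‖y‖`, `‖q‖` and `‖q̄‖` each grow by at most
`4σe`. -/
theorem normalSize_evolution (hp : 0 ≤ p) {K : Phase n S p → ℂ} {T : Set ℝ}
    {u : ℝ → Phase n S p} (h : WeakSolution (symplB n S hp) K Set.univ T u) (hT : T.OrdConnected)
    (h0 : (0 : ℝ) ∈ T) (hreal : ∀ t ∈ T, IsRealPt (u t)) {σ E e : ℝ} (hσ : 0 < σ) (hE : 0 ≤ E)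
    (he : 0 ≤ e)
    (hy : ∀ t ∈ T, ∀ i, ‖fderiv ℂ K (u t) (eX i)‖ ≤ (4 * σ) ^ 2 * E)
    (hz : ∀ t ∈ T, ∀ A : Finset (Site S), ∑ j ∈ A, wt j.1 ^ (2 * p) *
      ‖fderiv ℂ K (u t) ((-Complex.I * (u t).2.2.1.coord j) • eQ j +
        (Complex.I * (u t).2.2.2.coord j) • eQbar j)‖ ≤ (4 * σ) ^ 2 * E) {t : ℝ} (ht : t ∈ T)
    (hEt : E * |t| ≤ e ^ 2) : normalSize (u t) ≤ normalSize (u 0) + 12 * σ * e := by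
  have hC : 0 ≤ (4 * σ) ^ 2 * E := by positivity
  have h1 := h.norm_y_le hp hT h0 hC hy ht
  have h2 := h.norm_q_sq_le hp hT h0 hreal hC hz ht
  have h3 : (4 * σ) ^ 2 * E * |t| ≤ (4 * σ * e) ^ 2 := by
    rw [mul_assoc, mul_pow (4 * σ) e]
    gcongr
  have h4 := sqrt_le_add_of_le_add_sq (norm_nonneg _) (by positivity)
    (h1.trans (add_le_add_right h3 _))
  have h5 := sqrt_le_add_of_le_add_sq (sq_nonneg ‖(u 0).2.2.1‖)
    (c := 4 * σ * e) (by positivity) (h2.trans (add_le_add_right h3 _))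
  rw [Real.sqrt_sq (norm_nonneg _), Real.sqrt_sq (norm_nonneg _)] at h5
  unfold normalSize zNorm
  rw [(hreal t ht).norm_eq, (hreal 0 h0).norm_eq]
  linarith

/-! ### Symplectic maps close to the identity -/

/-- Real symplectic maps whose derivative is close to the identity in the weighted norm. -/
structure IsNearIdMap (r k : ℝ) (F : Phase n S p → Phase n S p) (U : Set (Phase n S p)) :
    Prop where
  r_pos : 0 < r
  r_le : r ≤ 1
  k_nonneg : 0 ≤ k
  k_lt : k < 1
  isOpen : IsOpen U
  convex : Convex ℝ U
  analytic : AnalyticOnNhd ℂ F U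
  real : ∀ a ∈ U, IsRealPt a → IsRealPt (F a)
  symplectic : ∀ a ∈ U, ∀ u v, sympl (fderiv ℂ F a u) (fderiv ℂ F a v) = sympl u v
  deriv : ∀ a ∈ U, ∀ u, ‖scaling n S p r (fderiv ℂ F a u - u)‖ ≤ k * ‖scaling n S p r u‖

namespace IsNearIdMap

variable {r k : ℝ} {F : Phase n S p → Phase n S p} {U : Set (Phase n S p)}

theorem lipschitz (h : IsNearIdMap r k F U) {a b : Phase n S p} (ha : a ∈ U) (hb : b ∈ U) :
    ‖scaling n S p r (F a - F b - (a - b))‖ ≤ k * ‖scaling n S p r (a - b)‖ :=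
  norm_sub_sub_le_of_fderiv_near_id h.convex
    (fun x hx => (h.analytic x hx).differentiableAt) h.deriv ha hb

theorem injOn (h : IsNearIdMap r k F U) : Set.InjOn F U := by
  intro a ha b hb hab
  have h1 := norm_le_of_norm_sub_sub_le (h.lipschitz ha hb)
  rw [hab, sub_self, map_zero, norm_zero] at h1
  have h2 := norm_le_scaledNorm h.r_pos h.r_le (a - b)
  have h3 : ‖scaling n S p r (a - b)‖ ≤ 0 :=
    nonpos_of_mul_nonpos_right h1 (by linarith [h.k_lt])
  exact sub_eq_zero.mp (norm_le_zero_iff.mp (by linarith))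

theorem continuousOn (h : IsNearIdMap r k F U) {T : Set ℝ} {u w : ℝ → Phase n S p}
    (hu : ∀ t ∈ T, u t ∈ U) (hFu : ∀ t ∈ T, F (u t) = w t) (hw : ContinuousOn w T) :
    ContinuousOn u T :=
  continuousOn_of_near_id (norm_le_scaledNorm h.r_pos h.r_le) h.k_lt
    (fun _ ha _ hb => h.lipschitz ha hb) hu hFu hw

theorem pullback (h : IsNearIdMap r k F U) (hp : 0 ≤ p) {H : Phase n S p → ℂ} {T : Set ℝ}
    {u w : ℝ → Phase n S p} (hweak : WeakSolution (symplB n S hp) H Set.univ T w)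
    (hT : T.OrdConnected) (hH : ∀ t ∈ T, AnalyticAt ℂ H (w t)) (hu : ∀ t ∈ T, u t ∈ U)
    (hFu : ∀ t ∈ T, F (u t) = w t) : WeakSolution (symplB n S hp) (H ∘ F) Set.univ T u :=
  hweak.pullback (norm_le_scaledNorm h.r_pos h.r_le) h.isOpen h.analytic h.k_nonneg h.k_lt h.deriv
    h.symplectic hT hH (h.continuousOn hu hFu hweak.cont) hu hFu

theorem exists_real_preimage (h : IsNearIdMap r k F U) (hp : 0 ≤ p) {u₀ w : Phase n S p} {R : ℝ}
    (hu₀ : IsRealPt u₀) (hball : ∀ a, ‖scaling n S p r (a - u₀)‖ ≤ R → a ∈ U) (hw : IsRealPt w)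
    (hwR : ‖scaling n S p r (w - F u₀)‖ ≤ (1 - k) * R) :
    ∃ u, IsRealPt u ∧ ‖scaling n S p r (u - u₀)‖ ≤ R ∧ F u = w :=
  exists_preimage_of_near_id (norm_le_scaledNorm h.r_pos h.r_le) (G := realPts n S p)
    (isClosed_realPts hp) h.k_nonneg h.k_lt hu₀
    (fun a b ha hb => h.lipschitz (hball a ha) (hball b hb))
    (fun a ha ha' => h.real a (hball a ha') ha) hw hwR

end IsNearIdMap

theorem IsNormalFormTwo.isNearIdMap {s₀ r₀ κ : ℝ} {H : Phase n S p → ℂ}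
    {Ψ : Phase n S p → Phase n S p} {ω : Fin n → ℝ} {Ω : Site S → ℝ} (hs₀ : 0 < s₀) (hr₀ : 0 < r₀)
    (hr₀' : r₀ ≤ 1) (hκ : κ < 1 / 4) (h : IsNormalFormTwo s₀ r₀ κ H Ψ ω Ω) :
    IsNearIdMap r₀ (4 * κ) Ψ (Dom n S p (s₀ / 2) (r₀ / 2)) where
  r_pos := hr₀
  r_le := hr₀'
  k_nonneg := by
    have h0 : (0 : Phase n S p) ∈ Dom n S p (s₀ / 2) (r₀ / 2) :=
      mem_Dom_of_normalSize_lt (by linarith) (realPts n S p).zero_mem (by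
        simpa [normalSize, zNorm] using hr₀)
    have := (scaledNorm_nonneg hr₀ _).trans (h.near_id 0 h0)
    linarith
  k_lt := by linarith
  isOpen := isOpen_Dom
  convex := convex_Dom
  analytic := h.map.analytic
  real := h.map.real
  symplectic := h.map.symplectic
  deriv _ ha := h.fderiv_near_id hr₀ ha

/-- The constant `1 / 2` is `s₀ / 16` divided by the margin `s₀ / 8` of the Cauchy estimate. -/
theorem IsPartialNormalForm.isNearIdMap {s₀ η c σ : ℝ} {M N : ℕ} {H : Phase n S p → ℂ}
    {ω : Fin n → ℝ} {Ω : Site S → ℝ} {Φ : Phase n S p → Phase n S p} {Z P Q : Coeff n S}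
    (hs₀ : 0 < s₀) (hs₀' : s₀ ≤ 1) (hσ : 0 < σ) (hσ1 : 5 * σ ≤ 1)
    (h : IsPartialNormalForm s₀ η c M N σ H ω Ω Φ Z P Q)
    (hε : c * (N : ℝ) ^ 294 * σ / η ^ 2 ≤ s₀ / 16) :
    IsNearIdMap (5 * σ) (1 / 2) Φ (Dom n S p (s₀ / 8) (3 * σ)) where
  r_pos := by linarith
  r_le := hσ1
  k_nonneg := by norm_num
  k_lt := by norm_num
  isOpen := isOpen_Dom
  convex := convex_Dom
  analytic a ha := h.map.analytic a (Dom_mono (by linarith) (by linarith) (by linarith) ha)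
  real a ha := h.map.real a (Dom_mono (by linarith) (by linarith) (by linarith) ha)
  symplectic a ha := h.map.symplectic a (Dom_mono (by linarith) (by linarith) (by linarith) ha)
  deriv a ha u := by
    refine (h.fderiv_near_id hs₀ hs₀' hσ hσ1 hε ha u).trans_eq ?_
    congr 1
    field_simp
    norm_num

/-- The coordinates of the partial normal form move slowly. -/
theorem IsPartialNormalForm.normalSize_le (hp : 0 ≤ p) (hpd : (d : ℝ) ≤ p) {s₀ η c σ : ℝ}
    {M N : ℕ} {H : Phase n S p → ℂ} {ω : Fin n → ℝ} {Ω : Site S → ℝ}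
    {Φ : Phase n S p → Phase n S p} {Z P Q : Coeff n S} (hσ : 0 < σ) (hc : 0 < c)
    (h : IsPartialNormalForm s₀ η c M N σ H ω Ω Φ Z P Q) (hN : 1 ≤ (N : ℝ) ^ (p - d))
    {T : Set ℝ} (hT : T.OrdConnected) (h0 : (0 : ℝ) ∈ T) {u : ℝ → Phase n S p}
    (hu : WeakSolution (symplB n S hp) (H ∘ Φ) Set.univ T u) (hur : ∀ t ∈ T, IsRealPt (u t))
    (huD : ∀ t ∈ T, u t ∈ Dom n S p (s₀ / 4) (4 * σ))
    (hd : ∀ t ∈ T, DifferentiableAt ℂ (H ∘ Φ) (u t)) {e : ℝ} (he : 0 ≤ e) {t : ℝ} (ht : t ∈ T)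
    (hE : (c * σ * (1 / η ^ 2 * (N : ℝ) ^ (6 * (M + 7) ^ 2) * σ) ^ M +
      c * σ / (N : ℝ) ^ (p - d)) * |t| ≤ e ^ 2) :
    normalSize (u t) ≤ normalSize (u 0) + 12 * σ * e := by
  have hZ : ∀ k α b, Z k α b ≠ 0 → k = 0 ∧ ∀ j, b (Sum.inl j) = b (Sum.inr j) :=
    fun k α b hb => ⟨(h.Z_form k α b hb).1, (h.Z_form k α b hb).2.1⟩
  have hτP : 0 ≤ c * σ * (1 / η ^ 2 * (N : ℝ) ^ (6 * (M + 7) ^ 2) * σ) ^ M := by positivity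
  have hτQ : 0 ≤ c * σ := by positivity
  have hE0 : 0 ≤ c * σ * (1 / η ^ 2 * (N : ℝ) ^ (6 * (M + 7) ^ 2) * σ) ^ M +
      c * σ / (N : ℝ) ^ (p - d) := by positivity
  have h4 : 0 < 4 * σ := by linarith
  have hK : ∀ w ∈ Dom n S p (s₀ / 4) (4 * σ),
      (H ∘ Φ) w = integrable ω Ω w + expand Z w + expand P w + expand Q w := h.form
  refine normalSize_evolution hp hu hT h0 hur hσ hE0 he (fun τ hτ i => ?_) (fun τ hτ A => ?_) ht hE
  · exact norm_fderiv_eX_le hK hZ h.Q_form hN hpd le_rfl h4 hτP hτQ h.P_le h.Q_le (huD τ hτ)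
      (hd τ hτ) i
  · refine (sum_norm_fderiv_rotate_le hK hZ h.Q_form hN hpd le_rfl h4 hτP hτQ h.P_le h.Q_le
      (huD τ hτ) (hur τ hτ) (hd τ hτ) A).trans ?_
    have h1 : ‖(u τ).2.2.1‖ ≤ 4 * σ :=
      (le_add_of_nonneg_right (norm_nonneg _)).trans (huD τ hτ).2.2.le
    have h2 : ‖(u τ).2.2.1‖ * (4 * σ) ≤ (4 * σ) ^ 2 := by
      rw [sq (4 * σ)]
      exact mul_le_mul_of_nonneg_right h1 h4.le
    exact mul_le_mul_of_nonneg_right h2 hE0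

theorem exists_scaling_bound {r r' : ℝ} (hr : 0 < r) (hr1 : r ≤ 1) :
    ∃ C : ℝ, 0 < C ∧ (∀ x : Phase n S p, ‖scaling n S p r x‖ ≤ C * ‖x‖) ∧
      ∀ x : Phase n S p, ‖scaling n S p r' x‖ ≤ C * ‖scaling n S p r x‖ := by
  refine ⟨max ‖scaling n S p r‖ ‖scaling n S p r'‖ + 1, by positivity, fun x => ?_, fun x => ?_⟩
  · refine ((scaling n S p r).le_opNorm x).trans ?_
    gcongr
    exact (le_max_left _ _).trans (by linarith)
  · refine ((scaling n S p r').le_opNorm x).trans ?_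
    have h1 := norm_le_scaledNorm hr hr1 x
    rw [one_mul] at h1
    gcongr
    exact (le_max_right _ _).trans (by linarith)

/-! ### Lifting real points through both coordinate changes -/

/-- The coordinates in which the Hamiltonian has a partial normal form, on a neighbourhood of the
torus of size comparable to `δ`. -/
structure IsNormalCoordinates (r₀ κ s₀ δ : ℝ) (Ψ Φ : Phase n S p → Phase n S p)
    (U : Set (Phase n S p)) : Prop where
  hΨ : IsNearIdMap r₀ κ Ψ U
  hΦ : IsNearIdMap (5 * δ) (1 / 2) Φ (Dom n S p (s₀ / 8) (3 * δ))
  mapsTo : Set.MapsTo Φ (Dom n S p (s₀ / 8) (3 * δ)) U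
  subset : Dom n S p (s₀ / 8) (3 * δ) ⊆ U
  near : ∀ a ∈ Dom n S p (s₀ / 8) (3 * δ), ‖scaling n S p (5 * δ) (Φ a - a)‖ ≤ s₀ / 1000000

namespace IsNormalCoordinates

variable {r₀ κ s₀ δ : ℝ} {Ψ Φ : Phase n S p → Phase n S p} {U : Set (Phase n S p)}

theorem mem_of_near (hs₀ : 0 < s₀) (hs₀' : s₀ ≤ 1) (hδ : 0 < δ) {v : Phase n S p}
    (hv : IsRealPt v) (hsize : normalSize v ≤ 2 * δ) {a : Phase n S p}
    (ha : ‖scaling n S p (5 * δ) (a - v)‖ ≤ 2 * (s₀ / 1000000)) :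
    a ∈ Dom n S p (s₀ / 8) (3 * δ) :=
  mem_Dom_of_near_real hs₀ hs₀' hδ hv hsize (ha.trans (by linarith))

theorem mem_of_real (hs₀ : 0 < s₀) (hδ : 0 < δ) {v : Phase n S p}
    (hv : IsRealPt v) (hsize : normalSize v ≤ 2 * δ) : v ∈ Dom n S p (s₀ / 8) (3 * δ) :=
  mem_Dom_of_normalSize_lt (by linarith) hv (by linarith)

theorem normalSize_le (hs₀' : s₀ ≤ 1) (hδ : 0 < δ) {u v : Phase n S p}
    (h : ‖scaling n S p (5 * δ) (v - u)‖ ≤ 2 * (s₀ / 1000000)) :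
    normalSize v ≤ normalSize u + δ / 50 := by
  have h5 : 0 < 5 * δ := by linarith
  rw [norm_scaling h5] at h
  -- A displacement of `2 / 1000000` is at most `(1 / 500) ^ 2`; the square root is lost in `y`, and
  -- `2 * (5 * δ) / 500 = δ / 50`.
  have := normalSize_le_of_scaledNorm_le h5 (ε := 1 / 500) (h.trans (by linarith)) (by norm_num)
    (by norm_num)
  linarith

theorem size_image_le (h : IsNormalCoordinates r₀ κ s₀ δ Ψ Φ U) (hs₀ : 0 < s₀) (hs₀' : s₀ ≤ 1)
    (hδ : 0 < δ) {u : Phase n S p} (hu : u ∈ Dom n S p (s₀ / 8) (3 * δ)) :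
    normalSize (Φ u) ≤ normalSize u + δ / 50 :=
  normalSize_le hs₀' hδ ((h.near u hu).trans (by linarith))

theorem exists_preimage (h : IsNormalCoordinates r₀ κ s₀ δ Ψ Φ U) (hp : 0 ≤ p) (hs₀ : 0 < s₀)
    (hs₀' : s₀ ≤ 1) (hδ : 0 < δ) {u₀ v : Phase n S p} (hu₀ : IsRealPt u₀)
    (hs : normalSize u₀ ≤ 2 * δ) (hv : IsRealPt v)
    (hvu : ‖scaling n S p (5 * δ) (v - Φ u₀)‖ ≤ s₀ / 1000000) :
    ∃ u, IsRealPt u ∧ normalSize u ≤ normalSize u₀ + δ / 50 ∧ Φ u = v := by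
  obtain ⟨u, hu, hu1, hu2⟩ := h.hΦ.exists_real_preimage hp (R := 2 * (s₀ / 1000000)) hu₀
    (fun a ha => mem_of_near hs₀ hs₀' hδ hu₀ hs ha) hv (hvu.trans (by linarith))
  exact ⟨u, hu, normalSize_le hs₀' hδ hu1, hu2⟩

/-- The real points near the image of a real point are images of real points. -/
theorem exists_cover (h : IsNormalCoordinates r₀ κ s₀ δ Ψ Φ U) (hp : 0 ≤ p) (hs₀ : 0 < s₀)
    (hs₀' : s₀ ≤ 1) (hδ : 0 < δ) :
    ∃ ε : ℝ, 0 < ε ∧ ∀ u w : Phase n S p, IsRealPt u → normalSize u ≤ 1.5 * δ → IsRealPt w →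
      dist w (Ψ (Φ u)) < ε →
      ∃ u', IsRealPt u' ∧ normalSize u' ≤ normalSize u + δ / 50 ∧ Ψ (Φ u') = w := by
  obtain ⟨C, hC, hC1, hC2⟩ := exists_scaling_bound (n := n) (S := S) (p := p) (r' := 5 * δ)
    h.hΨ.r_pos h.hΨ.r_le
  have hκ : 0 < 1 - κ := by linarith [h.hΨ.k_lt]
  -- The lift through `Ψ` is controlled in the scale `r₀`, the lift through `Φ` in the scale `5 *
  -- δ`; `R` is the radius at which the first bound implies what the second needs. It may depend on
  -- `δ`.
  obtain ⟨R, hR, hCR⟩ : ∃ R : ℝ, 0 < R ∧ C * R = s₀ / 1000000 :=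
    ⟨s₀ / 1000000 / C, by positivity, mul_div_cancel₀ _ hC.ne'⟩
  refine ⟨(1 - κ) * R / C, by positivity, fun u w hur hus hwr hdist => ?_⟩
  have hu := mem_of_real hs₀ hδ hur (by linarith)
  have hvr := h.hΦ.real u hu hur
  have hvs := h.size_image_le hs₀ hs₀' hδ hu
  have hle : ∀ x : Phase n S p, ‖scaling n S p r₀ x‖ ≤ R →
      ‖scaling n S p (5 * δ) x‖ ≤ s₀ / 1000000 := fun x hx =>
    (hC2 x).trans ((mul_le_mul_of_nonneg_left hx hC.le).trans hCR.le)
  obtain ⟨v, hv, hv1, hv2⟩ := h.hΨ.exists_real_preimage hp (R := R) hvr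
    (fun a ha => h.subset (mem_of_near hs₀ hs₀' hδ hvr (by linarith)
      ((hle _ ha).trans (by linarith)))) hwr (by
      refine (hC1 _).trans ?_
      rw [dist_eq_norm, lt_div_iff₀ hC] at hdist
      linarith)
  obtain ⟨u', hu', hu's, hu'v⟩ := h.exists_preimage hp hs₀ hs₀' hδ hur (by linarith) hv (hle _ hv1)
  exact ⟨u', hu', hu's, by rw [hu'v, hv2]⟩

end IsNormalCoordinates

end

end KamTori

/-! ### The stability theorem -/

open KamTori

theorem theorem3p3 (d n M N₀ : ℕ) (hd : 1 ≤ d) (hn : 1 ≤ n) (p s₀ r₀ η c : ℝ)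
    (hp : 24 * ((M : ℝ) + 7) ^ 4 + 1 ≤ p) (hpd : 12 * ((M : ℝ) + 7) ^ 4 + (d : ℝ) ≤ p)
    (hs₀ : 0 < s₀) (hs₀' : s₀ ≤ 1) (hr₀ : 0 < r₀) (hr₀' : r₀ ≤ 1)
    (hη : 0 < η) (hη' : η < 1) (hc : 0 < c) :
    ∃ ρ : ℝ, 0 < ρ ∧
      ∀ (S : Finset (Fin d → ℤ)), S.card = n →
      ∀ (H : KamTori.Phase n S p → ℂ) (Ψ : KamTori.Phase n S p → KamTori.Phase n S p)
        (ω : Fin n → ℝ) (Ω : KamTori.Site S → ℝ) (κ : ℝ), κ < 1 / 4 →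
      KamTori.IsNormalFormTwo s₀ r₀ κ H Ψ ω Ω →
      (∀ N : ℕ, 1 ≤ N → N₀ ≤ N → ∀ σ : ℝ, 0 < σ →
        c * (N : ℝ) ^ (6 * (M + 7) ^ 2) * σ ≤ η ^ 2 →
        ∃ (Φ : KamTori.Phase n S p → KamTori.Phase n S p) (Z P Q : KamTori.Coeff n S),
          KamTori.IsPartialNormalForm s₀ η c M N σ (H ∘ Ψ) ω Ω Φ Z P Q) →
      ∀ δ : ℝ, 0 < δ → δ < ρ →
      ∀ (T : Set ℝ) (w : ℝ → KamTori.Phase n S p), T.OrdConnected → (0 : ℝ) ∈ T →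
      KamTori.IsSolution H (KamTori.Dom n S p s₀ r₀) T w →
      KamTori.torusDist Ψ (KamTori.Dom n S p (s₀ / 2) (r₀ / 2)) (w 0) ≤ ENNReal.ofReal δ →
      ∀ t ∈ T, |t| ≤ δ ^ (-(M : ℤ)) →
        KamTori.torusDist Ψ (KamTori.Dom n S p (s₀ / 2) (r₀ / 2)) (w t) ≤
          ENNReal.ofReal (2 * δ) := by
  have hp0 : 0 ≤ p := le_trans (by positivity) hp
  have hpd' : (d : ℝ) ≤ p := (le_add_of_nonneg_left (by positivity)).trans hpd
  -- The first bound makes `Φ` close to the identity and the drift at most `(1 / 1000) ^ 2`; the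
  -- second keeps the radius `5 * δ` below `r₀ / 2`.
  obtain ⟨ε, hε0, hεs, hεr⟩ : ∃ ε : ℝ, 0 < ε ∧ ε ≤ s₀ / 1000000 ∧ ε ≤ r₀ / 100 :=
    ⟨min (s₀ / 1000000) (r₀ / 100), by positivity, min_le_left _ _, min_le_right _ _⟩
  obtain ⟨ρ, hρ, hcut⟩ := exists_cutoff d M N₀ hpd hη hc hε0
  refine ⟨ρ, hρ, ?_⟩
  intro S _ H Ψ ω Ω κ hκ hΨ hpnf δ hδ hδρ T w hT h0T hw hw0 t₁ ht₁ ht₁δ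
  obtain ⟨N, hN1, hN0, hδε, hxε, hL, hE⟩ := hcut δ hδ hδρ
  obtain ⟨Φ, Z, P, Q, hΦ⟩ := hpnf N hN1 hN0 δ hδ (by
    rw [div_le_iff₀ (by positivity)] at hxε
    exact hxε.trans (mul_le_of_le_one_left (by positivity) (by linarith)))
  have h5 : 0 < 5 * δ := by linarith
  have h294 : c * (N : ℝ) ^ 294 * δ / η ^ 2 ≤ ε := by
    refine le_trans ?_ hxε
    have hN1' : (1 : ℝ) ≤ N := by exact_mod_cast hN1
    gcongr
    calc 294 = 6 * (0 + 7) ^ 2 := by norm_num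
      _ ≤ 6 * (M + 7) ^ 2 := by gcongr; omega
  have hV4 : Dom n S p (s₀ / 8) (3 * δ) ⊆ Dom n S p (s₀ / 4) (4 * δ) :=
    Dom_mono (by linarith) (by linarith) (by linarith)
  have hco : IsNormalCoordinates r₀ (4 * κ) s₀ δ Ψ Φ (Dom n S p (s₀ / 2) (r₀ / 2)) :=
    { hΨ := hΨ.isNearIdMap hs₀ hr₀ hr₀' hκ
      hΦ := hΦ.isNearIdMap hs₀ hs₀' hδ (by linarith) (by linarith)
      mapsTo := fun a ha => Dom_mono le_rfl h5.le (by linarith) (hΦ.map.mapsTo (hV4 ha))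
      subset := Dom_mono (by linarith) (by linarith) (by linarith)
      near := fun a ha => by
        rw [norm_scaling h5]
        exact ((hΦ.near_id a (hV4 ha)).trans h294).trans hεs }
  -- the initial point
  obtain ⟨v₀, -, hv₀r, hv₀w, hv₀s⟩ := exists_of_torusDist_lt (hw0.trans_lt
    ((ENNReal.ofReal_lt_ofReal_iff (by linarith)).mpr (by linarith : δ < 1.01 * δ)))
  -- The preimage of `v₀` under `Φ` is sought near `v₀` itself, so its size is at most `1.03 * δ`.
  obtain ⟨u₀, hu₀r, hu₀s, hu₀v⟩ := hco.exists_preimage hp0 hs₀ hs₀' hδ hv₀r (by linarith) hv₀r (by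
    rw [← neg_sub, map_neg, norm_neg]
    exact hco.near v₀ (IsNormalCoordinates.mem_of_real hs₀ hδ hv₀r (by linarith)))
  have hu₀V := IsNormalCoordinates.mem_of_real hs₀ hδ hu₀r (by linarith)
  -- the continuation argument
  obtain ⟨h, hh, hcover⟩ := hco.exists_cover hp0 hs₀ hs₀' hδ
  have hclose : ∃ u, IsRealPt u ∧ normalSize u ≤ 1.1 * δ ∧ Ψ (Φ u) = w t₁ := by
    refine bootstrap hT h0T hw.cont
      (Good := fun x => ∃ u, IsRealPt u ∧ normalSize u ≤ 1.5 * δ ∧ Ψ (Φ u) = x)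
      (Better := fun x => ∃ u, IsRealPt u ∧ normalSize u ≤ 1.1 * δ ∧ Ψ (Φ u) = x)
      ⟨u₀, hu₀r, by linarith, by rw [hu₀v, hv₀w]⟩ ht₁ ?_ hh ?_
    · intro J hJT hJ h0J hJt hgood
      -- The lift is chosen pointwise; its continuity is supplied by the pullbacks, which use the
      -- lower Lipschitz bounds of `Ψ` and `Φ`.
      choose! u hur hus huw using hgood
      have huV : ∀ t ∈ J, u t ∈ Dom n S p (s₀ / 8) (3 * δ) := fun t ht =>
        IsNormalCoordinates.mem_of_real hs₀ hδ (hur t ht) ((hus t ht).trans (by linarith))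
      have hHΨ : ∀ a ∈ Dom n S p (s₀ / 2) (r₀ / 2), AnalyticAt ℂ (H ∘ Ψ) a := fun a ha =>
        (hΨ.analytic _ (hΨ.map.mapsTo ha)).comp (hΨ.map.analytic a ha)
      have hweakv := hco.hΨ.pullback hp0 ((hw.weakSolution hp0 hT hΨ.analytic).mono hJT) hJ
        (fun t ht => hΨ.analytic _ (hw.mem t (hJT ht))) (u := fun t => Φ (u t))
        (fun t ht => hco.mapsTo (huV t ht)) huw
      have hweaku := hco.hΦ.pullback hp0 hweakv hJ
        (fun t ht => hHΨ _ (hco.mapsTo (huV t ht))) huV (fun _ _ => rfl)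
      -- By injectivity the chosen lift starts at `u₀`, so the drift is added to `1.03 * δ` and not
      -- to the a priori bound `1.5 * δ`.
      have hu0 : u 0 = u₀ := hco.hΦ.injOn (huV 0 h0J) hu₀V
        (hco.hΨ.injOn (hco.mapsTo (huV 0 h0J)) (hco.mapsTo hu₀V) (by
          rw [huw 0 h0J, hu₀v, hv₀w]))
      intro t ht
      refine ⟨u t, hur t ht, ?_, huw t ht⟩
      have hev := hΦ.normalSize_le hp0 hpd' hδ hc hL hJ h0J hweaku hur
        (fun τ hτ => hV4 (huV τ hτ))
        (fun τ hτ => ((hHΨ _ (hco.mapsTo (huV τ hτ))).comp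
          (hΦ.map.analytic _ (hV4 (huV τ hτ)))).differentiableAt)
        -- The drift is `12 * δ / 1000`, which keeps the size below `1.1 * δ`.
        (e := 1 / 1000) (by norm_num) ht (by
          have h1 : δ ^ M * |t| ≤ 1 := by
            have h2 := (hJt t ht).trans ht₁δ
            rw [zpow_neg, zpow_natCast] at h2
            exact (mul_le_mul_of_nonneg_left h2 (by positivity)).trans_eq
              (mul_inv_cancel₀ (by positivity))
          refine (mul_le_mul_of_nonneg_right hE (abs_nonneg t)).trans ?_
          rw [mul_assoc]
          exact (mul_le_of_le_one_right hε0.le h1).trans (by linarith))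
      rw [hu0] at hev
      linarith
    · rintro t ht t' ht' ⟨u, hur, hus, huw⟩ hdist
      obtain ⟨u', hu'r, hu's, hu'w⟩ := hcover u (w t') hur (by linarith) (hw.real t' ht')
        (by rwa [huw])
      exact ⟨u', hu'r, by linarith, hu'w⟩
  obtain ⟨u, hur, hus, huw⟩ := hclose
  have huV := IsNormalCoordinates.mem_of_real hs₀ hδ hur (by linarith)
  have hvs := hco.size_image_le hs₀ hs₀' hδ huV
  exact torusDist_le (hco.mapsTo huV) (hco.hΦ.real u huV hur) huw (by linarith)

end
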